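/- **Setting.** Identify $\mathbb R^4$ with the quaternions $\mathbb H$, $\mathbb S^3=\{q\in\mathbb H: |q|=1\}$, $\mathbb S^2=\mathbb S^3\cap\mathrm{span}\{1,j,k\}$. Let $q\mapsto\tilde q$ be the linear involution fixing $1,j,k$ and sending $i$ to $-i$, and let $\pi(q)=\tilde q\,q$ be the Hopf fibration; its fibres in $\mathbb S^3$ are the circles $\{e^{i\varphi}q\}$. Let $\gamma:\mathbb R/L\mathbb Z\to\mathbb S^2$ be a smooth regular closed curve which performs exactly one loop through its trace (that is, $\gamma$ is injective on $\mathbb R/L\mathbb Z$). With $\partial_{\ell}=|\gamma'|^{-1}\frac{d}{ds}$, $\nabla_{\gamma'/|\gamma'|}$ the covariant derivative in $T\mathbb S^2$ along $\gamma$ and $\nabla^\perp_{\gamma'/|\gamma'|}$ its projection to the normal bundle of $\gamma$ in $T\mathbb S^2$, let $\vec\kappa_\gamma=\nabla_{\gamma'/|\gamma'|}\frac{\gamma'}{|\gamma'|}$ be the curvature vector, and $$\mathcal E(\gamma)=\int 1+|\vec\kappa_\gamma|^2\,d\mu_\gamma,\qquad \nabla_{L^2}\mathcal E(\gamma)=2\big(\nabla^\perp_{\gamma'/|\gamma'|}\big)^2\vec\kappa_\gamma+|\vec\kappa_\gamma|^2\vec\kappa_\gamma+\vec\kappa_\gamma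 .$$ Let $\Sigma$ be a smooth compact torus and $F:\Sigma\to\mathbb S^3$ a smooth immersion that maps $\Sigma$ simply onto the Hopf torus $\mathbb S^3\cap\pi^{-1}(\mathrm{trace}\,\gamma)$, i.e. onto it and with mapping degree $\pm1$ (it induces an isomorphism on $H_2(\,\cdot\,;\mathbb Z)$). With respect to the induced metric $g$, with area measure $\mu_F$, let $A_F$ be the second fundamental form of $F$ in $\mathbb S^3$ (with values in the normal bundle of $F$ in $T\mathbb S^3$), $\vec H_F=\mathrm{trace}\,A_F$, $A^0_F=A_F-\frac12 g\,\vec H_F$, $Q(A^0_F)\phi=\sum_{i,j}A^0_F(e_i,e_j)\langle A^0_F(e_i,e_j),\phi\rangle$ for an orthonormal basis $(e_i)$, $\nabla^{\perp_F}$ the normal covariant derivative, $\triangle^\perp_F$ the normal Laplacian, and $$\mathcal W(F)=\int_\Sigma 1+\tfrac14|\vec H_F|^2\,d\mu_F,\qquad \nabla_{L^2}\mathcal W(F)=\tfrac12\big(\triangle^\perp_F\vec H_F+Q(A^0_F)(\vec H_F)\big).$$ A smooth path $\eta_F$ in $\Sigma$, defined on an open interval, is a horizontal lift of $\gamma$ with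 respect to $\pi\circ F$ if $\pi\circ F\circ\eta_F=\gamma$ there and $\eta_F'$ is $g$-orthogonal to $\ker D(\pi\circ F)$. **Proposition 3.2 (Hopf–Willmore identity).** There is $\varepsilon=\varepsilon(F,\gamma)\in(0,L/2]$ such that for every $s^*$ and every $x^*\in\Sigma$ with $\pi(F(x^*))=\gamma(s^*)$ there is a horizontal lift $\eta_F$ of $\gamma|_{(s^*-\varepsilon,s^*+\varepsilon)}$ with $\eta_F(s^*)=x^*$, and such that the following holds for every smooth unit normal field $\nu_\gamma$ along $\gamma$ in $T\mathbb S^2$. The curvature vector satisfies $\vec\kappa_\gamma=-|\gamma'|^{-2}\,(\overline{\gamma'}\cdot\nu_\gamma')\cdot\nu_\gamma$. Put $\kappa_\gamma=\langle\vec\kappa_\gamma,\nu_\gamma\rangle$. There are a smooth unit normal field $N_F$ along $F$ in $T\mathbb S^3$, with $D\pi_{F(x)}(N_F(x))=2\nu_\gamma(s)$ whenever $\pi(F(x))=\gamma(s)$, and a sign $\sigma\in\{1,-1\}$, such that for every $s^*$, every horizontal lift $\eta_F$ of $\gamma|_{(s^*-\varepsilon,s^*+\varepsilon)}$ and every $s\in(s^*-\varepsilon,s^*+\varepsilon)$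 the following formulae hold at $x=\eta_F(s)$. 1. There is an orthonormal basis $(e_1,e_2)$ of $T_x\Sigma$, where $DF(e_1)$ is the unit vector in direction of $(F\circ\eta_F)'(s)\neq0$ and $DF(e_2)=\sigma\, iF(x)$, in which $$A_F=N_F(x)\begin{pmatrix}2\kappa_\gamma(s)&1\\1&0\end{pmatrix},\qquad A^0_F=N_F(x)\begin{pmatrix}\kappa_\gamma(s)&1\\1&-\kappa_\gamma(s)\end{pmatrix}.$$ 2. $\vec H_F(x)=2\kappa_\gamma(s)\,N_F(x)$ and $|A^0_F|^2(x)=2(\kappa_\gamma(s)^2+1)$. 3. $Q(A^0_F)(\vec H_F)(x)=4(\kappa_\gamma^3(s)+\kappa_\gamma(s))\,N_F(x)$. 4. $\triangle^\perp_F(\vec H_F)(x)=8\,(\partial_{\ell}^2\kappa_\gamma)(s)\,N_F(x)$. 5. $|(\nabla^{\perp_F})^kA_F|^2(x)=2^{2+2k}\,|(\partial_{\ell}^k\kappa_\gamma)(s)|^2$ for every integer $k\ge1$. 6. $\nabla_{L^2}\mathcal W(F)(x)=2\big(2\,\partial_{\ell}^2\kappa_\gamma+\kappa_\gamma^3+\kappa_\gamma\big)(s)\,N_F(x)$.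 7. (Hopf–Willmore identity) $D\pi_{F(x)}\big(\nabla_{L^2}\mathcal W(F)(x)\big)=4\,\nabla_{L^2}\mathcal E(\gamma)(s)$. Moreover, $$\mathcal W(F)=\pi\,\mathcal E(\gamma),\qquad \int_\Sigma|\nabla_{L^2}\mathcal W(F)|^2\,d\mu_F=4\pi\int|\nabla_{L^2}\mathcal E(\gamma)|^2\,d\mu_\gamma ,$$ where $\pi$ as a factor is the number. -/

import Mathlib

open scoped Manifold ContDiff Quaternion

noncomputable section

namespace HopfWillmore

/-! ### The Hopf fibration on the quaternions -/

/-- The quaternion unit `i`. -/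
def qi : ℍ[ℝ] := ⟨0, 1, 0, 0⟩

/-- The involution `q ↦ q̃`, which fixes `1, j, k` and sends `i` to `-i`. -/
def tilde (q : ℍ[ℝ]) : ℍ[ℝ] := ⟨q.re, -q.imI, q.imJ, q.imK⟩

/-- The Hopf fibration `π(q) = q̃ q`, mapping the unit sphere of `ℍ` onto the unit sphere of
`span {1, j, k}`. -/
def hopf (q : ℍ[ℝ]) : ℍ[ℝ] := tilde q * q

/-- The differential `Dπ_q(v)`. -/
def dHopf (q v : ℍ[ℝ]) : ℍ[ℝ] := fderiv ℝ hopf q v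

/-- The preimage in the unit 3-sphere of a subset `C` of the 2-sphere under the Hopf fibration. -/
def hopfPreimage (C : Set ℍ[ℝ]) : Set ℍ[ℝ] := {q | ‖q‖ = 1 ∧ hopf q ∈ C}

/-! ### Closed curves in the 2-sphere, the unit sphere of `span {1, j, k}` -/

/-- `γ` is a smooth regular closed curve `ℝ / Lℤ → S²`, given as an `L`-periodic map on `ℝ`,
which performs exactly one loop through its trace. -/
structure IsSimpleClosedCurve (γ : ℝ → ℍ[ℝ]) (L : ℝ) : Prop where
  pos : 0 < L
  smooth : ContDiff ℝ ∞ γ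
  periodic : Function.Periodic γ L
  norm_eq_one : ∀ s, ‖γ s‖ = 1
  imI_eq_zero : ∀ s, (γ s).imI = 0
  regular : ∀ s, deriv γ s ≠ 0
  one_loop : Set.InjOn γ (Set.Ico 0 L)

/-- `ν` is a unit normal field along the curve `γ` within the tangent bundle of the 2-sphere. -/
structure IsUnitNormalAlongCurve (γ ν : ℝ → ℍ[ℝ]) : Prop where
  smooth : ContDiff ℝ ∞ ν
  norm_eq_one : ∀ s, ‖ν s‖ = 1
  imI_eq_zero : ∀ s, (ν s).imI = 0
  tangent_sphere : ∀ s, inner ℝ (ν s) (γ s) = 0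
  normal : ∀ s, inner ℝ (ν s) (deriv γ s) = 0

section Curve

variable {V : Type*} [NormedAddCommGroup V] [NormedSpace ℝ V]

/-- The derivative `|γ'|⁻¹ d/ds` with respect to arc length. -/
def arcDeriv (γ : ℝ → ℍ[ℝ]) (W : ℝ → V) (s : ℝ) : V := ‖deriv γ s‖⁻¹ • deriv W s

/-- The derivative with respect to arc length of a field along `γ`, projected to the tangent
space of the 2-sphere: the covariant derivative in direction `γ' / |γ'|`. -/
def covDerivCurve (γ W : ℝ → ℍ[ℝ]) (s : ℝ) : ℍ[ℝ] :=
  arcDeriv γ W s - (inner ℝ (arcDeriv γ W s) (γ s) : ℝ) • γ s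

/-- The covariant derivative in direction `γ' / |γ'|`, projected to the normal bundle of `γ`
within the tangent bundle of the 2-sphere. -/
def normalCovDerivCurve (γ W : ℝ → ℍ[ℝ]) (s : ℝ) : ℍ[ℝ] :=
  covDerivCurve γ W s
    - (inner ℝ (covDerivCurve γ W s) (arcDeriv γ γ s) : ℝ) • arcDeriv γ γ s

/-- The curvature vector of a curve in the 2-sphere: the covariant derivative of the unit
tangent in direction of the unit tangent. -/
def curvatureVector (γ : ℝ → ℍ[ℝ]) : ℝ → ℍ[ℝ] := covDerivCurve γ (arcDeriv γ γ)

/-- The signed curvature of `γ` with respect to the unit normal field `ν`. -/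
def signedCurvature (γ ν : ℝ → ℍ[ℝ]) (s : ℝ) : ℝ := inner ℝ (curvatureVector γ s) (ν s)

/-- The elastic energy `∫ 1 + |κ|² dμ_γ` of the closed curve `γ` of period `L`. -/
def elasticEnergy (γ : ℝ → ℍ[ℝ]) (L : ℝ) : ℝ :=
  ∫ s in (0 : ℝ)..L, (1 + ‖curvatureVector γ s‖ ^ 2) * ‖deriv γ s‖

/-- The `L²`-gradient of the elastic energy, `2 (∇^⊥)² κ + |κ|² κ + κ`. -/
def elasticGradient (γ : ℝ → ℍ[ℝ]) (s : ℝ) : ℍ[ℝ] :=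
  (2 : ℝ) • normalCovDerivCurve γ (normalCovDerivCurve γ (curvatureVector γ)) s
    + ‖curvatureVector γ s‖ ^ 2 • curvatureVector γ s + curvatureVector γ s

end Curve

/-! ### Extrinsic geometry, in one chart, of an immersed surface in the 3-sphere

`f` is a map from (an open subset of) the plane to the unit sphere of `ℍ`, and `y` is a point. -/

/-- The coordinate plane. -/
abbrev Plane : Type := EuclideanSpace ℝ (Fin 2)

/-- The `i`-th coordinate vector. -/
def coordVec (i : Fin 2) : Plane := EuclideanSpace.single i 1

/-- The partial derivative `∂_i` of a map on the plane. -/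
def pderiv {V : Type*} [NormedAddCommGroup V] [NormedSpace ℝ V]
    (i : Fin 2) (f : Plane → V) (y : Plane) : V := fderiv ℝ f y (coordVec i)

namespace Loc

variable (f : Plane → ℍ[ℝ]) (y : Plane)

/-- The first fundamental form `g_ij = ⟨∂_i f, ∂_j f⟩`. -/
def g : Matrix (Fin 2) (Fin 2) ℝ := fun i j => inner ℝ (pderiv i f y) (pderiv j f y)

/-- The inverse `g^{ij}` of the first fundamental form. -/
def ginv : Matrix (Fin 2) (Fin 2) ℝ := (g f y)⁻¹

/-- The Christoffel symbols `Γ^m_kl = g^{mj} ⟨∂_kl f, ∂_j f⟩`. -/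
def christoffel (m k l : Fin 2) : ℝ :=
  ∑ j, ginv f y m j * inner ℝ (pderiv k (pderiv l f) y) (pderiv j f y)

/-- The orthogonal projection of `ℍ` onto the normal space of `f` within the tangent space of
the 3-sphere, i.e. onto the orthogonal complement of `f y` and of the image of `Df y`. -/
def normalProj : ℍ[ℝ] →L[ℝ] ℍ[ℝ] :=
  ((Submodule.span ℝ {f y} ⊔ LinearMap.range (fderiv ℝ f y).toLinearMap)ᗮ).starProjection

/-- The second fundamental form `A(v, w) = (D_v D_w f)^⊥`. -/
def secondFF (v w : Plane) : ℍ[ℝ] := normalProj f y (fderiv ℝ (fderiv ℝ f) y v w)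

/-- The mean curvature vector `H = g^{ij} A_ij`. -/
def meanCurv : ℍ[ℝ] :=
  ∑ i, ∑ j, ginv f y i j • secondFF f y (coordVec i) (coordVec j)

/-- The trace-free part `A⁰(v, w) = A(v, w) - ½ g(v, w) H` of the second fundamental form. -/
def tracefreeFF (v w : Plane) : ℍ[ℝ] :=
  secondFF f y v w
    - ((1 / 2 : ℝ) * inner ℝ (fderiv ℝ f y v) (fderiv ℝ f y w)) • meanCurv f y

/-- The operator `Q(A⁰) φ = g^{ik} g^{jl} A⁰_ij ⟨A⁰_kl, φ⟩`. -/
def Q (φ : ℍ[ℝ]) : ℍ[ℝ] :=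
  ∑ i, ∑ j, ∑ k, ∑ l, (ginv f y i k * ginv f y j l
      * inner ℝ (tracefreeFF f y (coordVec k) (coordVec l)) φ)
    • tracefreeFF f y (coordVec i) (coordVec j)

/-- The normal derivative `∇^⊥_k V = (∂_k V)^⊥` of a field `V` along `f`. -/
def normalDeriv (k : Fin 2) (V : Plane → ℍ[ℝ]) : ℍ[ℝ] := normalProj f y (pderiv k V y)

/-- The normal Laplacian `g^{kl} (∇^⊥_k ∇^⊥_l V - Γ^m_kl ∇^⊥_m V)`. -/
def normalLaplacian (V : Plane → ℍ[ℝ]) : ℍ[ℝ] :=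
  ∑ k, ∑ l, ginv f y k l •
    (normalDeriv f y k (fun z => normalDeriv f z l V)
      - ∑ m, christoffel f y m k l • normalDeriv f y m V)

/-- The covariant derivative of a normal-bundle-valued covariant tensor field of degree `n`,
given by its components; the new index comes first:
`(∇T)_{i i₁…iₙ} = ∇^⊥_i (T_{i₁…iₙ}) - ∑ₐ Γ^m_{i iₐ} T_{i₁…m…iₙ}`. -/
def tensorCovDeriv {n : ℕ} (T : Plane → (Fin n → Fin 2) → ℍ[ℝ]) (I : Fin (n + 1) → Fin 2) :
    ℍ[ℝ] :=
  normalDeriv f y (I 0) (fun z => T z (Fin.tail I))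
    - ∑ a : Fin n, ∑ m : Fin 2,
        christoffel f y m (I 0) (Fin.tail I a) • T y (Function.update (Fin.tail I) a m)

/-- The `k`-th covariant derivative `(∇^⊥)^k A` of the second fundamental form, a tensor field
of degree `k + 2`. -/
def secondFFDeriv : (k : ℕ) → Plane → (Fin (k + 2) → Fin 2) → ℍ[ℝ]
  | 0, z, I => secondFF f z (coordVec (I 0)) (coordVec (I 1))
  | k + 1, z, I => tensorCovDeriv f z (secondFFDeriv k) I

/-- The squared norm `g^{i₁j₁} ⋯ g^{iₙjₙ} ⟨T_{i₁…iₙ}, T_{j₁…jₙ}⟩` of a tensor at the point `y`. -/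
def tensorNormSq {n : ℕ} (T : (Fin n → Fin 2) → ℍ[ℝ]) : ℝ :=
  ∑ I : Fin n → Fin 2, ∑ J : Fin n → Fin 2,
    (∏ a, ginv f y (I a) (J a)) * inner ℝ (T I) (T J)

end Loc

/-! ### Immersed tori in the 3-sphere -/

section Surface

variable {M : Type} [TopologicalSpace M] [ChartedSpace Plane M]

/-- A smooth immersion of the surface `M` into the unit 3-sphere of `ℍ`. -/
structure IsSphereImmersion (F : M → ℍ[ℝ]) : Prop where
  smooth : ContMDiff (𝓡 2) 𝓘(ℝ, ℍ[ℝ]) ∞ F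
  norm_eq_one : ∀ x, ‖F x‖ = 1
  injective_mfderiv : ∀ x, Function.Injective (mfderiv (𝓡 2) 𝓘(ℝ, ℍ[ℝ]) F x)

/-- The differential of `F : M → ℍ` at `x`, as a linear map from `T_x M` to `ℍ`. -/
def dF (F : M → ℍ[ℝ]) (x : M) : TangentSpace (𝓡 2) x →L[ℝ] ℍ[ℝ] :=
  mfderiv (𝓡 2) 𝓘(ℝ, ℍ[ℝ]) F x

/-- The expression of `F` in the preferred chart around `x`; this is the chart by which the
tangent space `T_x M` is identified with the plane. -/
def inChart (F : M → ℍ[ℝ]) (x : M) : Plane → ℍ[ℝ] := F ∘ (extChartAt (𝓡 2) x).symm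

/-- The second fundamental form `A_F` at `x`, with values in the normal space. -/
def secondFF (F : M → ℍ[ℝ]) (x : M) (v w : TangentSpace (𝓡 2) x) : ℍ[ℝ] :=
  Loc.secondFF (inChart F x) (extChartAt (𝓡 2) x x) v w

/-- The mean curvature vector `H_F` at `x`. -/
def meanCurv (F : M → ℍ[ℝ]) (x : M) : ℍ[ℝ] :=
  Loc.meanCurv (inChart F x) (extChartAt (𝓡 2) x x)

/-- The trace-free second fundamental form `A⁰_F` at `x`. -/
def tracefreeFF (F : M → ℍ[ℝ]) (x : M) (v w : TangentSpace (𝓡 2) x) : ℍ[ℝ] :=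
  Loc.tracefreeFF (inChart F x) (extChartAt (𝓡 2) x x) v w

/-- The squared norm `|A⁰_F|²` at `x`. -/
def tracefreeFFNormSq (F : M → ℍ[ℝ]) (x : M) : ℝ :=
  Loc.tensorNormSq (inChart F x) (extChartAt (𝓡 2) x x)
    (fun I : Fin 2 → Fin 2 => Loc.tracefreeFF (inChart F x) (extChartAt (𝓡 2) x x)
      (coordVec (I 0)) (coordVec (I 1)))

/-- The vector `Q(A⁰_F)(φ)` at `x`. -/
def Q (F : M → ℍ[ℝ]) (x : M) (φ : ℍ[ℝ]) : ℍ[ℝ] :=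
  Loc.Q (inChart F x) (extChartAt (𝓡 2) x x) φ

/-- The normal Laplacian of the field `V` along `F`, at `x`. -/
def normalLaplacian (F V : M → ℍ[ℝ]) (x : M) : ℍ[ℝ] :=
  Loc.normalLaplacian (inChart F x) (extChartAt (𝓡 2) x x) (inChart V x)

/-- The squared norm `|(∇^⊥)^k A_F|²` at `x`. -/
def secondFFDerivNormSq (k : ℕ) (F : M → ℍ[ℝ]) (x : M) : ℝ :=
  Loc.tensorNormSq (inChart F x) (extChartAt (𝓡 2) x x)
    (Loc.secondFFDeriv (inChart F x) k (extChartAt (𝓡 2) x x))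

/-- The `L²`-gradient `½ (Δ^⊥ H + Q(A⁰) H)` of the Willmore energy at `F`. -/
def willmoreGradient (F : M → ℍ[ℝ]) (x : M) : ℍ[ℝ] :=
  (1 / 2 : ℝ) • (normalLaplacian F (meanCurv F) x + Q F x (meanCurv F x))

/-- `N` is a smooth unit normal field along the immersion `F` within the tangent bundle of the
3-sphere. -/
structure IsUnitNormalAlongSurface (F N : M → ℍ[ℝ]) : Prop where
  smooth : ContMDiff (𝓡 2) 𝓘(ℝ, ℍ[ℝ]) ∞ N
  norm_eq_one : ∀ x, ‖N x‖ = 1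
  tangent_sphere : ∀ x, inner ℝ (N x) (F x) = 0
  normal : ∀ x, ∀ v : TangentSpace (𝓡 2) x, inner ℝ (N x) (dF F x v) = 0

/-- The area measure of the metric induced by `F`. In the chart around `x` it has the density
`√(det g)` with respect to Lebesgue measure; the measures obtained on the chart domains agree on
the overlaps, and the area measure is their supremum. -/
def areaMeasure [MeasurableSpace M] (F : M → ℍ[ℝ]) : MeasureTheory.Measure M :=
  ⨆ x : M, MeasureTheory.Measure.map (extChartAt (𝓡 2) x).symm
    ((MeasureTheory.volume.restrict (extChartAt (𝓡 2) x).target).withDensity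
      (fun y => ENNReal.ofReal (Real.sqrt (Loc.g (inChart F x) y).det)))

/-- The Willmore energy `∫ 1 + ¼ |H|² dμ_F` of an immersion into the 3-sphere. -/
def willmoreEnergy [MeasurableSpace M] (F : M → ℍ[ℝ]) : ℝ :=
  ∫ x, (1 + (1 / 4 : ℝ) * ‖meanCurv F x‖ ^ 2) ∂(areaMeasure F)

/-- `η` is, on the open interval `(a, b)`, a smooth lift of `γ` with respect to `π ∘ F` which is
horizontal: its velocity is perpendicular, in the metric induced by `F`, to the kernels of the
differential of `π ∘ F`. -/
structure IsHorizontalLift (F : M → ℍ[ℝ]) (γ : ℝ → ℍ[ℝ]) (a b : ℝ) (η : ℝ → M) : Prop where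
  smooth : ContMDiffOn 𝓘(ℝ, ℝ) (𝓡 2) ∞ η (Set.Ioo a b)
  lift : ∀ s ∈ Set.Ioo a b, hopf (F (η s)) = γ s
  horizontal : ∀ s ∈ Set.Ioo a b, ∀ v : TangentSpace (𝓡 2) (η s),
    dHopf (F (η s)) (dF F (η s) v) = 0 →
      inner ℝ (dF F (η s) v) (deriv (fun t => F (η t)) s) = 0

end Surface

/-! ### Simple maps between tori -/

/-- The space is a topological torus. -/
def IsTorus (X : Type) [TopologicalSpace X] : Prop := Nonempty (X ≃ₜ Circle × Circle)

/-- A continuous map between two topological tori is simple if it has mapping degree `±1`, i.e.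
if it induces an isomorphism of the singular homology groups `H₂( · , ℤ)`. -/
structure IsSimpleMap {X Y : Type} [TopologicalSpace X] [TopologicalSpace Y] (f : C(X, Y)) :
    Prop where
  source_torus : IsTorus X
  target_torus : IsTorus Y
  isIso_homology : CategoryTheory.IsIso
    (((AlgebraicTopology.singularHomologyFunctor (ModuleCat.{0} ℤ) 2).obj
      (ModuleCat.of ℤ ℤ)).map (TopCat.ofHom f))

/-- `F` maps `X` simply onto the subset `T` of `ℍ`. -/
def MapsSimplyOnto {X : Type} [TopologicalSpace X] (F : X → ℍ[ℝ]) (T : Set ℍ[ℝ]) : Prop :=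
  Set.range F = T ∧ ∃ f : C(X, T), (∀ x, (f x : ℍ[ℝ]) = F x) ∧ IsSimpleMap f

end HopfWillmore

end

/-! Locally, everything is a computation in one orthonormal frame. For a unit quaternion p over
γ(s), left multiplication by `transport p` is an isometry of ℍ that carries the frame (γ, T, i, ν)
along the curve to (p, E, ip, N), with E and N horizontal over T and ν. The differential of the Hopf
map doubles horizontal vectors and kills ip. If q is a lift of γ to the 3-sphere, the Hopf torus is
parametrized by e^{it}q(s). Its structure equations (`IsClosedLift.hopfFrame`) use the coframe α =
½|γ'| ds, β = σ(⟨q', iq⟩ ds + dt) dual to E and V = σip.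

Three features of these equations give all pointwise formulae. The derivative of E has no
V-component and conversely, so α and β are parallel and the torus is flat
(`HopfFrame.christoffel_coframe`). The derivative of N is tangential, so N is parallel in the normal
bundle. A function c of s satisfies dc = 2(∂_ℓ c)α. Hence A = (2κ α⊗α + α⊗β + β⊗α)N, and each
covariant derivative replaces κ by 2∂_ℓκ and adds one factor α, while the mixed terms disappear.
What remains is contraction with |α| = |β| = 1 and α ⊥ β. Since Dπ(N) = 2ν, the Willmore gradient
goes to four times the elastic gradient.

Globally, the degree hypothesis has to be turned into injectivity of F. An immersion of a compact
surface onto the Hopf torus is a covering, and a covering of a torus that is epi on H₂ is injective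
(`IsTorusCovering.injective_of_epi_homology`). For the proof, let Λ be the period group of the
covering. The tautological class in H¹( · ; ℤ²/Λ) pulls back to zero, so its cup products with
integral classes vanish on the fundamental cycle of the torus, and this forces Λ = ℤ². F is then a
reparametrization of e^{it}q(s) (`IsClosedLift.exists_isTorusParam`), and the density ½|γ'| over
fibres of parameter length 2π produces the factor π in the integrals. -/

noncomputable section

/-! ### Cup products of 1-cocycles and maps that are epi on second homology. -/

namespace SSet

open CategoryTheory Limits Simplicial

/-- The homomorphism from simplicial `n`-chains with coefficients in `ℤ` given by its values on
simplices. -/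
def chainDesc {X : SSet.{0}} {Q : Type} [AddCommGroup Q] {n : ℕ} (c : X _⦋n⦌ → Q) :
    (X.chainComplex (ModuleCat.of ℤ ℤ)).X n ⟶ ModuleCat.of ℤ Q :=
  Sigma.desc fun x => ModuleCat.ofHom (LinearMap.toSpanSingleton ℤ Q (c x))

@[simp]
lemma ι_chainDesc {X : SSet.{0}} {Q : Type} [AddCommGroup Q] {n : ℕ} (c : X _⦋n⦌ → Q)
    (x : X _⦋n⦌) :
    X.ιChainComplex x ≫ chainDesc c = ModuleCat.ofHom (LinearMap.toSpanSingleton ℤ Q (c x)) := by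
  unfold ιChainComplex chainDesc
  exact Sigma.ι_desc _ _

lemma ofHom_toSpanSingleton_eq_zero {Q : Type} [AddCommGroup Q] {q : Q}
    (h : ModuleCat.ofHom (LinearMap.toSpanSingleton ℤ Q q) = 0) : q = 0 := by
  have := congrArg (fun f => f.hom (1 : ℤ)) h
  simpa using this

/-- Precomposition with the boundary map is the coboundary of cochains, so cocycle and coboundary
conditions become identities between values on faces. -/
lemma d_comp_chainDesc {X : SSet.{0}} {Q : Type} [AddCommGroup Q] {n : ℕ} (c : X _⦋n⦌ → Q) :
    (X.chainComplex (ModuleCat.of ℤ ℤ)).d (n + 1) n ≫ chainDesc c =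
      chainDesc fun x => ∑ i : Fin (n + 2), (-1 : ℤ) ^ i.val • c (X.δ i x) := by
  refine chainComplex_hom_ext fun x => ?_
  rw [ιChainComplex_d_assoc, ι_chainDesc, Preadditive.sum_comp]
  ext
  simp [ModuleCat.hom_sum, LinearMap.sum_apply]

/-- If `f` is epi on `H₂` and the `1`-cocycle `x` becomes the coboundary of `u` after pulling back
along `f`, then the cup product of `x` with any `1`-cocycle `y` vanishes on the `2`-cycle which is
the difference of two simplices with the same boundary. -/
theorem cup_eq_of_epi_homologyMap {S T : SSet.{0}} (f : S ⟶ T) {Q : Type} [AddCommGroup Q]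
    (hf : Epi (SSet.homologyMap f (ModuleCat.of ℤ ℤ) 2))
    (x : T _⦋1⦌ → Q) (y : T _⦋1⦌ → ℤ)
    (hx : ∀ σ : T _⦋2⦌, x (T.δ 1 σ) = x (T.δ 2 σ) + x (T.δ 0 σ))
    (hy : ∀ σ : T _⦋2⦌, y (T.δ 1 σ) = y (T.δ 2 σ) + y (T.δ 0 σ))
    (u : S _⦋0⦌ → Q) (hu : ∀ e : S _⦋1⦌, x (f.app _ e) = u (S.δ 0 e) - u (S.δ 1 e))
    (τ₁ τ₂ : T _⦋2⦌) (h02 : T.δ 0 τ₁ = T.δ 2 τ₂) (h11 : T.δ 1 τ₁ = T.δ 1 τ₂)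
    (h20 : T.δ 2 τ₁ = T.δ 0 τ₂) :
    y (T.δ 0 τ₁) • x (T.δ 2 τ₁) = y (T.δ 2 τ₁) • x (T.δ 0 τ₁) := by
  set R := ModuleCat.of ℤ ℤ with hR
  -- The cup product of `x` and `y`: `δ 2` is the front edge and `δ 0` the back edge of a triangle.
  let c : T _⦋2⦌ → Q := fun σ => y (T.δ 0 σ) • x (T.δ 2 σ)
  have hd : (T.chainComplex R).d 3 2 ≫ chainDesc c = 0 := by
    rw [d_comp_chainDesc]
    refine chainComplex_hom_ext fun σ => ?_
    rw [ι_chainDesc, comp_zero]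
    have e23 : T.δ 0 (T.δ 1 σ) = T.δ 0 (T.δ 0 σ) :=
      T.δ_comp_δ_apply (i := (0 : Fin 3)) (j := 0) le_rfl σ
    have e13 : T.δ 0 (T.δ 2 σ) = T.δ 1 (T.δ 0 σ) :=
      T.δ_comp_δ_apply (i := (0 : Fin 3)) (j := 1) (by decide) σ
    have e12 : T.δ 0 (T.δ 3 σ) = T.δ 2 (T.δ 0 σ) :=
      T.δ_comp_δ_apply (i := (0 : Fin 3)) (j := 2) (by decide) σ
    have e02 : T.δ 1 (T.δ 3 σ) = T.δ 2 (T.δ 1 σ) :=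
      T.δ_comp_δ_apply (i := (1 : Fin 3)) (j := 2) (by decide) σ
    have e01 : T.δ 2 (T.δ 3 σ) = T.δ 2 (T.δ 2 σ) :=
      T.δ_comp_δ_apply (i := (2 : Fin 3)) (j := 2) le_rfl σ
    have hx3 := hx (T.δ 3 σ)
    have hy0 := hy (T.δ 0 σ)
    have : ∑ i : Fin 4, (-1 : ℤ) ^ i.val • c (T.δ i σ) = 0 := by
      simp only [Fin.sum_univ_four, c]
      rw [e23, e13, e12, e01, hy0, ← e02, hx3, e01, e12]
      simp only [Fin.val_zero, Fin.val_one, Fin.val_two, show ((3 : Fin 4).val) = 3 from rfl]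
      module
    rw [this]
    ext
    simp
  -- Pulled back along `f`, `x` is the coboundary of `u`, so the product is the coboundary of `u`
  -- times the pullback of `y`. This 1-cochain evaluates `u` at the initial vertex of an edge, which
  -- is `δ 1 e`.
  have hpull : (chainComplexMap f R).f 2 ≫ chainDesc c =
      (S.chainComplex R).d 2 1 ≫ chainDesc fun e => y (f.app _ e) • u (S.δ 1 e) := by
    rw [d_comp_chainDesc]
    refine chainComplex_hom_ext fun σ => ?_
    rw [ι_chainComplexMap_f_assoc, ι_chainDesc, ι_chainDesc]
    have nat : ∀ i : Fin 3, T.δ i (f.app _ σ) = f.app _ (S.δ i σ) := fun i =>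
      (SSet.δ_naturality_apply f i σ).symm
    have hyσ := hy (f.app _ σ)
    have v1 : S.δ 0 (S.δ 2 σ) = S.δ 1 (S.δ 0 σ) :=
      S.δ_comp_δ_apply (i := (0 : Fin 2)) (j := 1) (by decide) σ
    have v0 : S.δ 1 (S.δ 2 σ) = S.δ 1 (S.δ 1 σ) :=
      S.δ_comp_δ_apply (i := (1 : Fin 2)) (j := 1) le_rfl σ
    have : c (f.app _ σ) =
        ∑ i : Fin 3, (-1 : ℤ) ^ i.val • (y (f.app _ (S.δ i σ)) • u (S.δ 1 (S.δ i σ))) := by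
      simp only [nat] at hyσ
      simp only [Fin.sum_univ_three, c, nat]
      rw [hu, v1, v0, hyσ]
      simp only [Fin.val_zero, Fin.val_one, Fin.val_two]
      module
    rw [this]
  let Φ : (T.chainComplex R).homology 2 ⟶ ModuleCat.of ℤ Q :=
    (T.chainComplex R).homologyι 2 ≫ (T.chainComplex R).descOpcycles (chainDesc c) 3 (by simp) hd
  -- `Φ` is evaluation of the cup product on H₂; it vanishes on the image of `f`, which is
  -- everything because `f` is epi there.
  have hΦ : Φ = 0 := by
    rw [← cancel_epi (SSet.homologyMap f R 2), comp_zero]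
    simp only [Φ, SSet.homologyMap]
    rw [HomologicalComplex.homologyι_naturality_assoc,
      HomologicalComplex.opcyclesMap_comp_descOpcycles]
    exact HomologicalComplex.homologyι_descOpcycles_eq_zero_of_boundary _ _ _ _ _ hpull
  let z : R ⟶ (T.chainComplex R).X 2 := T.ιChainComplex τ₁ - T.ιChainComplex τ₂
  have hz : z ≫ (T.chainComplex R).d 2 1 = 0 := by
    simp only [z, Preadditive.sub_comp, ιChainComplex_d]
    erw [Fin.sum_univ_three, Fin.sum_univ_three, h02, h11, h20]
    simp only [Fin.val_zero, Fin.val_one, Fin.val_two]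
    module
  have hzc : z ≫ chainDesc c = 0 := by
    have := congrArg (fun g => (T.chainComplex R).liftCycles z 1 (by simp) hz ≫
      (T.chainComplex R).homologyπ 2 ≫ g) hΦ
    simpa [Φ] using this
  have hc : ModuleCat.ofHom (LinearMap.toSpanSingleton ℤ Q (c τ₁ - c τ₂)) = 0 := by
    rw [← hzc]
    simp only [z, Preadditive.sub_comp, ι_chainDesc]
    ext
    simp
  have := sub_eq_zero.1 (ofHom_toSpanSingleton_eq_zero hc)
  simpa [c, h02, h20] using this

end SSet

/-! ### Coverings of a torus and their periods. -/

instance stdSimplex.simplyConnectedSpace (n : ℕ) :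
    SimplyConnectedSpace (stdSimplex ℝ (Fin (n + 1))) := by
  have : ContractibleSpace (stdSimplex ℝ (Fin (n + 1))) :=
    (convex_stdSimplex ℝ (Fin (n + 1))).contractibleSpace ⟨_, single_mem_stdSimplex ℝ 0⟩
  infer_instance

instance stdSimplex.locallyPathConnectedSpace (n : ℕ) :
    LocallyPathConnectedSpace (stdSimplex ℝ (Fin (n + 1))) :=
  (convex_stdSimplex ℝ _).locallyPathConnectedSpace

/-- The singular simplex in the plane with given vertices. -/
def affineSimplex {n : ℕ} (v : Fin (n + 1) → ℝ × ℝ) :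
    C(stdSimplex ℝ (Fin (n + 1)), ℝ × ℝ) where
  toFun b := ∑ j, (b : Fin (n + 1) → ℝ) j • v j
  continuous_toFun := by
    have (j : Fin (n + 1)) :
        Continuous fun b : stdSimplex ℝ (Fin (n + 1)) => (b : Fin (n + 1) → ℝ) j :=
      (continuous_apply j).comp continuous_subtype_val
    exact continuous_finsetSum _ fun j _ => (this j).smul continuous_const

lemma affineSimplex_apply {n : ℕ} (v : Fin (n + 1) → ℝ × ℝ) (b : stdSimplex ℝ (Fin (n + 1))) :
    affineSimplex v b = ∑ j, (b : Fin (n + 1) → ℝ) j • v j := rfl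

lemma affineSimplex_map {n m : ℕ} (v : Fin (n + 1) → ℝ × ℝ) (f : Fin (m + 1) → Fin (n + 1))
    (b : stdSimplex ℝ (Fin (m + 1))) :
    affineSimplex v (stdSimplex.map f b) = affineSimplex (v ∘ f) b := by
  simp only [affineSimplex_apply, stdSimplex.map_coe, FunOnFinite.linearMap_apply_apply,
    Finset.sum_smul, Function.comp]
  rw [← Finset.sum_fiberwise Finset.univ f]
  refine Finset.sum_congr rfl fun j _ => Finset.sum_congr rfl fun i hi => ?_
  rw [(Finset.mem_filter.1 hi).2]

lemma affineSimplex_vertex {n : ℕ} (v : Fin (n + 1) → ℝ × ℝ) (j : Fin (n + 1)) :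
    affineSimplex v (stdSimplex.vertex j) = v j := by
  simp [affineSimplex_apply, Pi.single_apply]

lemma affineSimplex_add {n : ℕ} (v : Fin (n + 1) → ℝ × ℝ) (w : ℝ × ℝ)
    (b : stdSimplex ℝ (Fin (n + 1))) :
    affineSimplex (fun j => v j + w) b = affineSimplex v b + w := by
  have : ∑ j, (b : Fin (n + 1) → ℝ) j = 1 := b.2.2
  simp [affineSimplex_apply, Finset.sum_add_distrib, ← Finset.sum_smul, this]

/-- The index of the unit square that contains a point of the plane. -/
def cellIndex (v : ℝ × ℝ) : ℤ × ℤ := (⌊v.1⌋, ⌊v.2⌋)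

/-- The inclusion of the integral lattice into the plane. -/
def latticePoint (l : ℤ × ℤ) : ℝ × ℝ := (l.1, l.2)

lemma latticePoint_zero : latticePoint 0 = 0 := by
  simp [latticePoint]

lemma latticePoint_add (l l' : ℤ × ℤ) :
    latticePoint (l + l') = latticePoint l + latticePoint l' := by
  simp [latticePoint]

/-- The floor is discontinuous, but equivariance under the lattice is all that is needed to turn it
into an integral cocycle on the quotient. -/
lemma cellIndex_add (v : ℝ × ℝ) (l : ℤ × ℤ) :
    cellIndex (v + latticePoint l) = cellIndex v + l := by
  simp [cellIndex, latticePoint, Prod.ext_iff]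

lemma cellIndex_latticePoint (l : ℤ × ℤ) : cellIndex (latticePoint l) = l := by
  simp [cellIndex, latticePoint]

/-- `p` is a universal covering by the plane with the integral lattice as deck group. -/
structure IsTorusCovering {Y : Type} [TopologicalSpace Y] (p : ℝ × ℝ → Y) : Prop where
  isCoveringMap : IsCoveringMap p
  surjective : Function.Surjective p
  apply_eq_iff : ∀ v w, p v = p w ↔ ∃ l, w = v + latticePoint l

namespace IsTorusCovering

variable {X Y : Type} [TopologicalSpace X] [TopologicalSpace Y] {p : ℝ × ℝ → Y}

lemma apply_add (hp : IsTorusCovering p) (v : ℝ × ℝ) (l : ℤ × ℤ) :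
    p (v + latticePoint l) = p v := ((hp.apply_eq_iff _ _).2 ⟨l, rfl⟩).symm

lemma exists_lift (hp : IsTorusCovering p) {n : ℕ} (σ : C(stdSimplex ℝ (Fin (n + 1)), Y))
    (a : stdSimplex ℝ (Fin (n + 1))) (v : ℝ × ℝ) (hv : p v = σ a) :
    ∃ τ : C(stdSimplex ℝ (Fin (n + 1)), ℝ × ℝ), τ a = v ∧ p ∘ τ = σ :=
  (hp.isCoveringMap.existsUnique_continuousMap_lifts σ a v hv).exists

lemma exists_lift' (hp : IsTorusCovering p) {n : ℕ} (σ : C(stdSimplex ℝ (Fin (n + 1)), Y)) :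
    ∃ τ : C(stdSimplex ℝ (Fin (n + 1)), ℝ × ℝ), p ∘ τ = σ := by
  obtain ⟨v, hv⟩ := hp.surjective (σ (stdSimplex.vertex 0))
  obtain ⟨τ, -, h⟩ := hp.exists_lift σ _ v hv
  exact ⟨τ, h⟩

/-- The difference of the cell indices of the end points of a lift of a singular `1`-simplex:
an integral cocycle which represents the identity of the deck group. -/
def edgeIndex (hp : IsTorusCovering p) (e : C(stdSimplex ℝ (Fin 2), Y)) : ℤ × ℤ :=
  cellIndex ((hp.exists_lift' e).choose (stdSimplex.vertex 1))
    - cellIndex ((hp.exists_lift' e).choose (stdSimplex.vertex 0))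

/-- Two lifts of an edge differ by a lattice translation, which cancels in the difference of the
cell indices. -/
lemma edgeIndex_eq (hp : IsTorusCovering p) (e : C(stdSimplex ℝ (Fin 2), Y))
    {g : stdSimplex ℝ (Fin 2) → ℝ × ℝ} (hg : Continuous g) (h : p ∘ g = e) :
    hp.edgeIndex e = cellIndex (g (stdSimplex.vertex 1)) - cellIndex (g (stdSimplex.vertex 0)) := by
  have hτ := (hp.exists_lift' e).choose_spec
  set τ := (hp.exists_lift' e).choose with hτdef
  obtain ⟨l, hl⟩ := (hp.apply_eq_iff (g (stdSimplex.vertex 0)) (τ (stdSimplex.vertex 0))).1 (by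
    rw [← Function.comp_apply (f := p), h, ← hτ]; rfl)
  have : ⇑τ = fun b => g b + latticePoint l := by
    refine hp.isCoveringMap.eq_of_comp_eq τ.continuous (hg.add continuous_const) ?_ _ hl
    rw [hτ, ← h]
    ext b
    simp [hp.apply_add]
  rw [edgeIndex, ← hτdef, this]
  simp [cellIndex_add]

open CategoryTheory Simplicial

/-- The cochain `edgeIndex` on the singular simplicial set. -/
def edgeCochain (hp : IsTorusCovering p) (e : (TopCat.toSSet.obj (TopCat.of Y)) _⦋1⦌) : ℤ × ℤ :=
  hp.edgeIndex ((TopCat.of Y).toSSetObjEquiv (.op ⦋1⦌) e)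

/-- The projection to `Y` of the singular simplex in the plane with given vertices. -/
def projSimplex (hp : IsTorusCovering p) {n : ℕ} (v : Fin (n + 1) → ℝ × ℝ) :
    (TopCat.toSSet.obj (TopCat.of Y)) _⦋n⦌ :=
  ((TopCat.of Y).toSSetObjEquiv (.op ⦋n⦌)).symm
    ((⟨p, hp.isCoveringMap.continuous⟩ : C(ℝ × ℝ, Y)).comp (affineSimplex v))

lemma δ_projSimplex (hp : IsTorusCovering p) (v : Fin 3 → ℝ × ℝ) (i : Fin 3) :
    (TopCat.toSSet.obj (TopCat.of Y)).δ i (hp.projSimplex v) =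
      hp.projSimplex (n := 1) (v ∘ i.succAbove) := by
  apply ((TopCat.of Y).toSSetObjEquiv (.op ⦋1⦌)).injective
  rw [projSimplex, projSimplex, Equiv.apply_symm_apply]
  ext b
  exact congrArg p (affineSimplex_map v i.succAbove b)

lemma projSimplex_add (hp : IsTorusCovering p) {n : ℕ} (v : Fin (n + 1) → ℝ × ℝ) (l : ℤ × ℤ) :
    hp.projSimplex (fun j => v j + latticePoint l) = hp.projSimplex v := by
  apply ((TopCat.of Y).toSSetObjEquiv (.op ⦋n⦌)).injective
  rw [projSimplex, projSimplex, Equiv.apply_symm_apply, Equiv.apply_symm_apply]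
  ext b
  exact (congrArg p (affineSimplex_add v _ b)).trans (hp.apply_add _ _)

lemma edgeCochain_projSimplex (hp : IsTorusCovering p) (v : Fin 2 → ℝ × ℝ) :
    hp.edgeCochain (hp.projSimplex (n := 1) v) = cellIndex (v 1) - cellIndex (v 0) := by
  rw [edgeCochain, projSimplex, Equiv.apply_symm_apply,
    hp.edgeIndex_eq _ (affineSimplex v).continuous rfl]
  rw [affineSimplex_vertex, affineSimplex_vertex]

/-- One lift of the whole triangle restricts to lifts of its three edges, and the differences
telescope. -/
lemma edgeCochain_cocycle (hp : IsTorusCovering p)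
    (σ : (TopCat.toSSet.obj (TopCat.of Y)) _⦋2⦌) :
    hp.edgeCochain ((TopCat.toSSet.obj (TopCat.of Y)).δ 1 σ) =
      hp.edgeCochain ((TopCat.toSSet.obj (TopCat.of Y)).δ 2 σ)
        + hp.edgeCochain ((TopCat.toSSet.obj (TopCat.of Y)).δ 0 σ) := by
  obtain ⟨τ, hτ⟩ := hp.exists_lift' (n := 2) ((TopCat.of Y).toSSetObjEquiv (.op ⦋2⦌) σ)
  have key (i : Fin 3) : hp.edgeCochain ((TopCat.toSSet.obj (TopCat.of Y)).δ i σ) =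
      cellIndex (τ (stdSimplex.vertex (i.succAbove 1)))
        - cellIndex (τ (stdSimplex.vertex (i.succAbove 0))) := by
    rw [edgeCochain, hp.edgeIndex_eq _ (g := fun b => τ (stdSimplex.map i.succAbove b))
      (τ.continuous.comp (stdSimplex.continuous_map _))]
    · rw [stdSimplex.map_vertex, stdSimplex.map_vertex]
    · ext b
      exact congrFun hτ _
  rw [key, key, key]
  simp only [show (1 : Fin 3).succAbove (1 : Fin 2) = 2 from rfl,
    show (1 : Fin 3).succAbove (0 : Fin 2) = 0 from rfl,
    show (2 : Fin 3).succAbove (1 : Fin 2) = 1 from rfl,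
    show (2 : Fin 3).succAbove (0 : Fin 2) = 0 from rfl,
    show (0 : Fin 3).succAbove (1 : Fin 2) = 2 from rfl,
    show (0 : Fin 3).succAbove (0 : Fin 2) = 1 from rfl]
  abel

/-- A covering of a torus which is epi on `H₂( · , ℤ)` is injective. -/
theorem injective_of_epi_homology [PathConnectedSpace X] (hp : IsTorusCovering p) (f : C(X, Y))
    (hf : IsCoveringMap f)
    (hepi : Epi (SSet.homologyMap (TopCat.toSSet.map (TopCat.ofHom f)) (ModuleCat.of ℤ ℤ) 2)) :
    Function.Injective f := by
  obtain ⟨x₀⟩ : Nonempty X := inferInstance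
  obtain ⟨v₀, hv₀⟩ := hp.surjective (f x₀)
  -- The plane is simply connected, so the universal covering `p` factors through `f` as `f ∘ G`.
  obtain ⟨G, ⟨hG₀, hG⟩, -⟩ := hf.existsUnique_continuousMap_lifts
    (⟨p, hp.isCoveringMap.continuous⟩ : C(ℝ × ℝ, Y)) v₀ x₀ hv₀.symm
  have hG' (v : ℝ × ℝ) : f (G v) = p v := congrFun hG v
  have shift {v w : ℝ × ℝ} (h : G v = G w) (l : ℤ × ℤ) (hl : w = v + latticePoint l)
      (z : ℝ × ℝ) : G (z + latticePoint l) = G z := by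
    have := hf.eq_of_comp_eq (g₁ := fun z => G (z + latticePoint l)) (g₂ := G)
      (by fun_prop) G.continuous (by ext z; simp [hG', hp.apply_add]) v (by rw [← hl, h])
    exact congrFun this z
  -- The group of periods of `G`. By `shift`, a single coincidence `G v = G (v + l)` already makes
  -- `l` a period, so `f` is injective once `Λ` is the whole lattice.
  let Λ : AddSubgroup (ℤ × ℤ) :=
    { carrier := {l | ∀ z, G (z + latticePoint l) = G z}
      add_mem' := fun {a b} ha hb z => by
        rw [latticePoint_add, ← add_assoc, hb, ha]
      zero_mem' := fun z => by rw [latticePoint_zero, add_zero]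
      neg_mem' := fun {a} ha z => by
        rw [← ha, add_assoc, ← latticePoint_add, neg_add_cancel, latticePoint_zero, add_zero] }
  have hsurj : Function.Surjective G := by
    intro x
    obtain ⟨c⟩ : Joined x₀ x := PathConnectedSpace.joined x₀ x
    obtain ⟨Γ, hΓ, hΓ0⟩ := hp.isCoveringMap.exists_path_lifts (f.comp c.toContinuousMap) v₀
      (by simp [hv₀])
    refine ⟨Γ 1, ?_⟩
    have := hf.eq_of_comp_eq (g₁ := fun t => G (Γ t)) (g₂ := c) (by fun_prop) c.continuous
      (by ext t; simpa [hG'] using congrFun hΓ t) 0 (by simp [hΓ0, hG₀])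
    simpa using congrFun this 1
  -- The cell index of a preimage under `G` is determined modulo `Λ`. The coboundary of `u` is the
  -- pullback along `f` of the edge cochain reduced modulo `Λ`.
  let u : X → (ℤ × ℤ) ⧸ Λ := fun x => QuotientAddGroup.mk (cellIndex (Function.surjInv hsurj x))
  have hu (v : ℝ × ℝ) : u (G v) = QuotientAddGroup.mk (cellIndex v) := by
    have h := Function.surjInv_eq hsurj (G v)
    obtain ⟨l, hl⟩ := (hp.apply_eq_iff v (Function.surjInv hsurj (G v))).1 (by
      rw [← hG', ← hG', h])
    simp only [u]
    rw [hl, cellIndex_add, QuotientAddGroup.mk_add_of_mem]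
    exact shift h.symm l hl
  set S := TopCat.toSSet.obj (TopCat.of X)
  set T := TopCat.toSSet.obj (TopCat.of Y) with hT
  let x : T _⦋1⦌ → (ℤ × ℤ) ⧸ Λ := fun e => QuotientAddGroup.mk (hp.edgeCochain e)
  -- The two triangles of the unit square, with common diagonal from 0 to (1, 1), have the same
  -- boundary modulo the lattice. Their difference is the fundamental cycle of the torus, and the
  -- vanishing cup product is evaluated on it.
  have key (φ : ℤ × ℤ →+ ℤ) : φ (0, 1) • (QuotientAddGroup.mk (1, 0) : (ℤ × ℤ) ⧸ Λ) =
      φ (1, 0) • (QuotientAddGroup.mk (0, 1) : (ℤ × ℤ) ⧸ Λ) := by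
    have := SSet.cup_eq_of_epi_homologyMap (TopCat.toSSet.map (TopCat.ofHom f)) hepi x
      (fun e => φ (hp.edgeCochain e))
      (fun σ => by simp only [x]; rw [hp.edgeCochain_cocycle]; rfl)
      (fun σ => by rw [hp.edgeCochain_cocycle, map_add])
      (fun q => u ((TopCat.of X).toSSetObjEquiv (.op ⦋0⦌) q (stdSimplex.vertex 0)))
      (fun e => by
        set q := (TopCat.of X).toSSetObjEquiv (.op ⦋1⦌) e with hq
        obtain ⟨v, hv⟩ := hsurj (q (stdSimplex.vertex 0))
        obtain ⟨τ, hτ0, hτ⟩ := hp.exists_lift (n := 1) (f.comp q) (stdSimplex.vertex 0) v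
          (by rw [← hG', hv]; rfl)
        have hGτ := hf.eq_of_comp_eq (g₁ := fun b => G (τ b)) (g₂ := q) (by fun_prop)
          q.continuous (by ext b; simpa [hG'] using congrFun hτ b) (stdSimplex.vertex 0)
          (by rw [hτ0, hv])
        have h0 : (TopCat.of X).toSSetObjEquiv (.op ⦋0⦌) (S.δ 0 e) (stdSimplex.vertex 0) =
            q (stdSimplex.vertex 1) :=
          congrArg q (stdSimplex.map_vertex (S := ℝ) (Fin.succAbove (0 : Fin 2)) (0 : Fin 1))
        have h1 : (TopCat.of X).toSSetObjEquiv (.op ⦋0⦌) (S.δ 1 e) (stdSimplex.vertex 0) =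
            q (stdSimplex.vertex 0) :=
          congrArg q (stdSimplex.map_vertex (S := ℝ) (Fin.succAbove (1 : Fin 2)) (0 : Fin 1))
        rw [h0, h1, ← hGτ, hu, hu]
        simp only [x]
        rw [edgeCochain, hp.edgeIndex_eq _ τ.continuous]
        · rfl
        · rw [hτ]; rfl)
      (hp.projSimplex ![0, latticePoint (1, 0), latticePoint (1, 1)])
      (hp.projSimplex ![0, latticePoint (0, 1), latticePoint (1, 1)])
      (by
        rw [hp.δ_projSimplex, hp.δ_projSimplex, ← hp.projSimplex_add (n := 1)
          (![0, latticePoint (0, 1), latticePoint (1, 1)] ∘ Fin.succAbove 2) (1, 0)]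
        congr 1
        ext j : 1
        fin_cases j <;> simp [latticePoint, Fin.succAbove])
      (by
        rw [hp.δ_projSimplex, hp.δ_projSimplex]
        congr 1
        ext j : 1
        fin_cases j <;> simp [latticePoint, Fin.succAbove])
      (by
        rw [hp.δ_projSimplex, hp.δ_projSimplex, ← hp.projSimplex_add (n := 1)
          (![0, latticePoint (1, 0), latticePoint (1, 1)] ∘ Fin.succAbove 2) (0, 1)]
        congr 1
        ext j : 1
        fin_cases j <;> simp [latticePoint, Fin.succAbove])
    simp only [x] at this
    rw [hp.δ_projSimplex, hp.δ_projSimplex, hp.edgeCochain_projSimplex,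
      hp.edgeCochain_projSimplex] at this
    simp only [Function.comp_apply, show (2 : Fin 3).succAbove (1 : Fin 2) = 1 from rfl,
      show (2 : Fin 3).succAbove (0 : Fin 2) = 0 from rfl,
      show (0 : Fin 3).succAbove (1 : Fin 2) = 2 from rfl,
      show (0 : Fin 3).succAbove (0 : Fin 2) = 1 from rfl, Matrix.cons_val_zero,
      Matrix.cons_val_one, Matrix.cons_val, cellIndex_latticePoint, ← latticePoint_zero] at this
    simpa using this
  have hΛ (l : ℤ × ℤ) : l ∈ Λ := by
    -- Each coordinate projection makes one side of `key` vanish and thereby puts one of the two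
    -- generators in `Λ`.
    have k2 := key (AddMonoidHom.snd ℤ ℤ)
    have k1 := key (AddMonoidHom.fst ℤ ℤ)
    simp only [AddMonoidHom.coe_fst, AddMonoidHom.coe_snd, one_smul, zero_smul] at k1 k2
    rw [QuotientAddGroup.eq_zero_iff] at k2
    rw [eq_comm, QuotientAddGroup.eq_zero_iff] at k1
    have : l = l.1 • ((1, 0) : ℤ × ℤ) + l.2 • ((0, 1) : ℤ × ℤ) := by
      ext <;> simp
    rw [this]
    exact Λ.add_mem (Λ.zsmul_mem k2 _) (Λ.zsmul_mem k1 _)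
  intro x₁ x₂ h
  obtain ⟨v, rfl⟩ := hsurj x₁
  obtain ⟨w, rfl⟩ := hsurj x₂
  obtain ⟨l, rfl⟩ := (hp.apply_eq_iff v w).1 (by rw [← hG', ← hG', h])
  exact (hΛ l v).symm

end IsTorusCovering

/-! ### Extrinsic geometry of a surface with the structure equations of a Hopf torus. -/

namespace HopfWillmore

lemma orthonormal_expansion {e : Fin 4 → ℍ[ℝ]} (he : Orthonormal ℝ e) (w : ℍ[ℝ]) :
    w = ∑ i, (inner ℝ (e i) w : ℝ) • e i := by
  have hspan : ⊤ ≤ Submodule.span ℝ (Set.range e) := by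
    rw [he.linearIndependent.span_eq_top_of_card_eq_finrank']
    rw [Quaternion.finrank_eq_four, Fintype.card_fin]
  have := (OrthonormalBasis.mk he hspan).sum_repr' w
  simpa using this.symm

lemma sum_coordVec (v : Plane) : v = ∑ i, v i • coordVec i := by
  ext j
  fin_cases j <;> simp [coordVec]

/-- An orthonormal frame `E, V, N` in the tangent bundle of the 3-sphere along `f`, adapted to `f`,
with coframe `α, β` and structure equations of a Hopf surface; `k n` are the iterated derivatives
of the curvature of the base curve in direction of `E`. -/
structure HopfFrame (f E V N : Plane → ℍ[ℝ]) (α β : Plane → Plane →L[ℝ] ℝ) (k : ℕ → Plane → ℝ)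
    (U : Set Plane) : Prop where
  isOpen : IsOpen U
  deriv_f : ∀ y ∈ U, HasFDerivAt f ((α y).smulRight (E y) + (β y).smulRight (V y)) y
  deriv_E : ∀ y ∈ U, HasFDerivAt E
    ((α y).smulRight ((2 * k 0 y) • N y - f y) + (β y).smulRight (N y)) y
  deriv_V : ∀ y ∈ U, HasFDerivAt V ((α y).smulRight (N y) - (β y).smulRight (f y)) y
  deriv_N : ∀ y ∈ U, HasFDerivAt N
    (-((α y).smulRight ((2 * k 0 y) • E y + V y) + (β y).smulRight (E y))) y
  deriv_k : ∀ n, ∀ y ∈ U, HasFDerivAt (k n) (k (n + 1) y • α y) y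
  diff_α : ∀ y ∈ U, DifferentiableAt ℝ α y
  diff_β : ∀ y ∈ U, DifferentiableAt ℝ β y
  orthonormal : ∀ y ∈ U, Orthonormal ℝ ![f y, E y, V y, N y]
  indep : ∀ y ∈ U, ∀ v, α y v = 0 → β y v = 0 → v = 0

namespace HopfFrame

variable {f E V N : Plane → ℍ[ℝ]} {α β : Plane → Plane →L[ℝ] ℝ} {k : ℕ → Plane → ℝ}
  {U : Set Plane} (h : HopfFrame f E V N α β k U) {y : Plane} (hy : y ∈ U)

include h hy

lemma eventually_mem : ∀ᶠ z in nhds y, z ∈ U := h.isOpen.mem_nhds hy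

lemma inner_frame (i j : Fin 4) :
    inner ℝ (![f y, E y, V y, N y] i) (![f y, E y, V y, N y] j) = if i = j then (1 : ℝ) else 0 :=
  orthonormal_iff_ite.1 (h.orthonormal y hy) i j

lemma inner_fE : inner ℝ (f y) (E y) = (0 : ℝ) := h.inner_frame hy 0 1
lemma inner_fV : inner ℝ (f y) (V y) = (0 : ℝ) := h.inner_frame hy 0 2
lemma inner_fN : inner ℝ (f y) (N y) = (0 : ℝ) := h.inner_frame hy 0 3
lemma inner_EE : inner ℝ (E y) (E y) = (1 : ℝ) := h.inner_frame hy 1 1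
lemma inner_EV : inner ℝ (E y) (V y) = (0 : ℝ) := h.inner_frame hy 1 2
lemma inner_EN : inner ℝ (E y) (N y) = (0 : ℝ) := h.inner_frame hy 1 3
lemma inner_VE : inner ℝ (V y) (E y) = (0 : ℝ) := h.inner_frame hy 2 1
lemma inner_VV : inner ℝ (V y) (V y) = (1 : ℝ) := h.inner_frame hy 2 2
lemma inner_VN : inner ℝ (V y) (N y) = (0 : ℝ) := h.inner_frame hy 2 3
lemma inner_Nf : inner ℝ (N y) (f y) = (0 : ℝ) := h.inner_frame hy 3 0
lemma inner_NE : inner ℝ (N y) (E y) = (0 : ℝ) := h.inner_frame hy 3 1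
lemma inner_NV : inner ℝ (N y) (V y) = (0 : ℝ) := h.inner_frame hy 3 2
lemma inner_NN : inner ℝ (N y) (N y) = (1 : ℝ) := h.inner_frame hy 3 3

lemma fderiv_f (v : Plane) : fderiv ℝ f y v = α y v • E y + β y v • V y := by
  rw [(h.deriv_f y hy).fderiv]; simp

lemma pderiv_f (i : Fin 2) :
    pderiv i f y = α y (coordVec i) • E y + β y (coordVec i) • V y := h.fderiv_f hy _

lemma det_ne_zero : α y (coordVec 0) * β y (coordVec 1) - α y (coordVec 1) * β y (coordVec 0) ≠ 0 := by
  intro h0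
  have key (p q : ℝ) (ha : p * α y (coordVec 0) + q * α y (coordVec 1) = 0)
      (hb : p * β y (coordVec 0) + q * β y (coordVec 1) = 0) : p = 0 ∧ q = 0 := by
    have := h.indep y hy (p • coordVec 0 + q • coordVec 1) (by simpa using ha) (by simpa using hb)
    have h0 := congrArg (fun v : Plane => v 0) this
    have h1 := congrArg (fun v : Plane => v 1) this
    simp [coordVec] at h0 h1
    exact ⟨h0, h1⟩
  obtain ⟨-, ha0⟩ := key (-α y (coordVec 1)) (α y (coordVec 0)) (by ring) (by linarith)
  obtain ⟨-, hb0⟩ := key (-β y (coordVec 1)) (β y (coordVec 0)) (by linarith) (by ring)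
  exact one_ne_zero (key 1 0 (by simp [ha0]) (by simp [hb0])).1

lemma exists_dual (p q : ℝ) : ∃ v, α y v = p ∧ β y v = q := by
  have hD := h.det_ne_zero hy
  set a0 := α y (coordVec 0)
  set a1 := α y (coordVec 1)
  set b0 := β y (coordVec 0)
  set b1 := β y (coordVec 1)
  refine ⟨((p * b1 - q * a1) / (a0 * b1 - a1 * b0)) • coordVec 0
    + ((q * a0 - p * b0) / (a0 * b1 - a1 * b0)) • coordVec 1, ?_, ?_⟩
  · rw [map_add, map_smul, map_smul, smul_eq_mul, smul_eq_mul]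
    change _ * a0 + _ * a1 = p
    rw [div_mul_eq_mul_div, div_mul_eq_mul_div, ← add_div, div_eq_iff hD]
    ring
  · rw [map_add, map_smul, map_smul, smul_eq_mul, smul_eq_mul]
    change _ * b0 + _ * b1 = q
    rw [div_mul_eq_mul_div, div_mul_eq_mul_div, ← add_div, div_eq_iff hD]
    ring

lemma g_apply (i j : Fin 2) : Loc.g f y i j =
    α y (coordVec i) * α y (coordVec j) + β y (coordVec i) * β y (coordVec j) := by
  simp only [Loc.g, h.pderiv_f hy, inner_add_left, inner_add_right, real_inner_smul_left,
    real_inner_smul_right, h.inner_EE hy, h.inner_EV hy, h.inner_VE hy, h.inner_VV hy]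
  ring

lemma det_g : (Loc.g f y).det =
    (α y (coordVec 0) * β y (coordVec 1) - α y (coordVec 1) * β y (coordVec 0)) ^ 2 := by
  rw [Matrix.det_fin_two]
  simp only [h.g_apply hy]
  ring

lemma sum_ginv_mul (u : Fin 2 → ℝ) (i : Fin 2) :
    ∑ j, Loc.ginv f y i j * ∑ l, Loc.g f y j l * u l = u i := by
  have hdet : IsUnit (Loc.g f y).det := by
    rw [h.det_g hy]; exact (pow_ne_zero 2 (h.det_ne_zero hy)).isUnit
  have : (Loc.ginv f y).mulVec ((Loc.g f y).mulVec u) = u := by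
    rw [Matrix.mulVec_mulVec, Loc.ginv, Matrix.nonsing_inv_mul _ hdet, Matrix.one_mulVec]
  exact congrFun this i

/-- The inverse first fundamental form on components of `p α + q β`. -/
lemma sum_ginv_coframe (v : Plane) (i : Fin 2) :
    ∑ j, Loc.ginv f y i j * (α y v * α y (coordVec j) + β y v * β y (coordVec j)) = v i := by
  rw [← h.sum_ginv_mul hy (fun l => v l) i]
  refine Finset.sum_congr rfl fun j _ => ?_
  congr 1
  conv_lhs => rw [sum_coordVec v]
  simp only [h.g_apply hy, Fin.sum_univ_two, map_add, map_smul, smul_eq_mul]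
  ring

lemma ginv_αα : ∑ i, ∑ j, Loc.ginv f y i j * (α y (coordVec i) * α y (coordVec j)) = 1 := by
  obtain ⟨v, h1, h2⟩ := h.exists_dual hy 1 0
  have := h.sum_ginv_coframe hy v
  calc _ = ∑ i, (∑ j, Loc.ginv f y i j *
        (α y v * α y (coordVec j) + β y v * β y (coordVec j))) * α y (coordVec i) := by
        simp only [h1, h2, Fin.sum_univ_two]; ring
    _ = α y v := by
        simp only [this]
        conv_rhs => rw [sum_coordVec v]
        simp
    _ = 1 := h1

lemma ginv_αβ : ∑ i, ∑ j, Loc.ginv f y i j * (α y (coordVec i) * β y (coordVec j)) = 0 := by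
  obtain ⟨v, h1, h2⟩ := h.exists_dual hy 0 1
  have := h.sum_ginv_coframe hy v
  calc _ = ∑ i, (∑ j, Loc.ginv f y i j *
        (α y v * α y (coordVec j) + β y v * β y (coordVec j))) * α y (coordVec i) := by
        simp only [h1, h2, Fin.sum_univ_two]; ring
    _ = α y v := by
        simp only [this]
        conv_rhs => rw [sum_coordVec v]
        simp
    _ = 0 := h1

lemma ginv_βα : ∑ i, ∑ j, Loc.ginv f y i j * (β y (coordVec i) * α y (coordVec j)) = 0 := by
  obtain ⟨v, h1, h2⟩ := h.exists_dual hy 1 0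
  have := h.sum_ginv_coframe hy v
  calc _ = ∑ i, (∑ j, Loc.ginv f y i j *
        (α y v * α y (coordVec j) + β y v * β y (coordVec j))) * β y (coordVec i) := by
        simp only [h1, h2, Fin.sum_univ_two]; ring
    _ = β y v := by
        simp only [this]
        conv_rhs => rw [sum_coordVec v]
        simp
    _ = 0 := h2

lemma ginv_ββ : ∑ i, ∑ j, Loc.ginv f y i j * (β y (coordVec i) * β y (coordVec j)) = 1 := by
  obtain ⟨v, h1, h2⟩ := h.exists_dual hy 0 1
  have := h.sum_ginv_coframe hy v
  calc _ = ∑ i, (∑ j, Loc.ginv f y i j *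
        (α y v * α y (coordVec j) + β y v * β y (coordVec j))) * β y (coordVec i) := by
        simp only [h1, h2, Fin.sum_univ_two]; ring
    _ = β y v := by
        simp only [this]
        conv_rhs => rw [sum_coordVec v]
        simp
    _ = 1 := h2

/-- The orthonormal vectors `f`, `E`, `V` lie in the subspace that is projected away, and `N` is
orthogonal to it, so its complement is the line of `N`. -/
lemma normalProj_apply (w : ℍ[ℝ]) : Loc.normalProj f y w = (inner ℝ (N y) w : ℝ) • N y := by
  rw [Loc.normalProj]
  set K := Submodule.span ℝ {f y} ⊔ LinearMap.range (fderiv ℝ f y).toLinearMap with hK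
  have hfK : f y ∈ K := Submodule.mem_sup_left (Submodule.mem_span_singleton_self _)
  have hEK : E y ∈ K := by
    obtain ⟨v, h1, h2⟩ := h.exists_dual hy 1 0
    refine Submodule.mem_sup_right ⟨v, ?_⟩
    have := h.fderiv_f hy v
    rw [h1, h2] at this
    simpa using this
  have hVK : V y ∈ K := by
    obtain ⟨v, h1, h2⟩ := h.exists_dual hy 0 1
    refine Submodule.mem_sup_right ⟨v, ?_⟩
    have := h.fderiv_f hy v
    rw [h1, h2] at this
    simpa using this
  have hN : N y ∈ Kᗮ := by
    rw [hK, ← Submodule.inf_orthogonal, Submodule.mem_inf]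
    refine ⟨?_, ?_⟩
    · rw [Submodule.mem_orthogonal_singleton_iff_inner_right, h.inner_fN hy]
    · rw [Submodule.mem_orthogonal]
      rintro _ ⟨v, rfl⟩
      have := h.fderiv_f hy v
      simp only [ContinuousLinearMap.coe_coe, this, inner_add_left, real_inner_smul_left,
        h.inner_EN hy, h.inner_VN hy]
      simp
  refine (Submodule.eq_starProjection_of_mem_orthogonal (K := Kᗮ) (u := w)
    (Submodule.smul_mem _ _ hN) ?_)
  refine Submodule.le_orthogonal_orthogonal K ?_
  have := orthonormal_expansion (h.orthonormal y hy) w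
  simp only [Fin.sum_univ_four, Matrix.cons_val_zero, Matrix.cons_val_one, Matrix.cons_val] at this
  nth_rewrite 1 [this]
  rw [add_sub_cancel_right]
  exact K.add_mem (K.add_mem (K.smul_mem _ hfK) (K.smul_mem _ hEK)) (K.smul_mem _ hVK)

end HopfFrame

lemma Loc.normalDeriv_congr {f : Plane → ℍ[ℝ]} {y : Plane} {V W : Plane → ℍ[ℝ]}
    (hVW : V =ᶠ[nhds y] W) (i : Fin 2) : Loc.normalDeriv f y i V = Loc.normalDeriv f y i W := by
  rw [Loc.normalDeriv, Loc.normalDeriv, pderiv, pderiv, hVW.fderiv_eq]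

lemma Loc.tensorCovDeriv_congr {f : Plane → ℍ[ℝ]} {y : Plane} {n : ℕ}
    {S T : Plane → (Fin n → Fin 2) → ℍ[ℝ]} (hST : ∀ᶠ z in nhds y, S z = T z)
    (I : Fin (n + 1) → Fin 2) : Loc.tensorCovDeriv f y S I = Loc.tensorCovDeriv f y T I := by
  rw [Loc.tensorCovDeriv, Loc.tensorCovDeriv, hST.self_of_nhds,
    Loc.normalDeriv_congr (hST.mono fun z hz => congrFun hz (Fin.tail I))]

namespace HopfFrame

variable {f E V N : Plane → ℍ[ℝ]} {α β : Plane → Plane →L[ℝ] ℝ} {k : ℕ → Plane → ℝ}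
  {U : Set Plane} (h : HopfFrame f E V N α β k U) {y : Plane} (hy : y ∈ U)

include h hy

lemma hasFDerivAt_α_apply (w : Plane) :
    HasFDerivAt (fun z => α z w) ((fderiv ℝ α y).flip w) y := by
  simpa using (h.diff_α y hy).hasFDerivAt.clm_apply (hasFDerivAt_const w y)

lemma hasFDerivAt_β_apply (w : Plane) :
    HasFDerivAt (fun z => β z w) ((fderiv ℝ β y).flip w) y := by
  simpa using (h.diff_β y hy).hasFDerivAt.clm_apply (hasFDerivAt_const w y)

/-- The tangential part contains only the derivatives of `α` and `β`: since the derivative of `E`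
has no `V`-component and conversely, no connection form appears. -/
lemma fderiv_fderiv_f_apply (v w : Plane) : fderiv ℝ (fun z => fderiv ℝ f z w) y v =
    (fderiv ℝ α y v w) • E y + (fderiv ℝ β y v w) • V y
      + (2 * k 0 y * (α y v * α y w) + α y v * β y w + β y v * α y w) • N y
      - (α y v * α y w + β y v * β y w) • f y := by
  have hev : (fun z => fderiv ℝ f z w) =ᶠ[nhds y] fun z => α z w • E z + β z w • V z :=
    (h.eventually_mem hy).mono fun z hz => h.fderiv_f hz w
  rw [hev.fderiv_eq, HasFDerivAt.fderiv (((h.hasFDerivAt_α_apply hy w).fun_smul (h.deriv_E y hy)).fun_add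
    ((h.hasFDerivAt_β_apply hy w).fun_smul (h.deriv_V y hy)))]
  simp only [add_apply, smul_apply,
    ContinuousLinearMap.smulRight_apply, sub_apply,
    ContinuousLinearMap.flip_apply]
  module

lemma differentiableAt_fderiv_f : DifferentiableAt ℝ (fderiv ℝ f) y := by
  have hev : fderiv ℝ f =ᶠ[nhds y]
      fun z => (α z).smulRight (E z) + (β z).smulRight (V z) :=
    (h.eventually_mem hy).mono fun z hz => (h.deriv_f z hz).fderiv
  have hsmul (θ : Plane → Plane →L[ℝ] ℝ) (W : Plane → ℍ[ℝ]) (hθ : DifferentiableAt ℝ θ y)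
      (hW : DifferentiableAt ℝ W y) : DifferentiableAt ℝ (fun z => (θ z).smulRight (W z)) y := by
    have := ((isBoundedBilinearMap_smulRight (𝕜 := ℝ) (E := Plane) (F := ℍ[ℝ])).differentiableAt
      (θ y, W y)).comp y (hθ.prodMk hW)
    exact this
  have d1 := hsmul α E (h.diff_α y hy) (h.deriv_E y hy).differentiableAt
  have d2 := hsmul β V (h.diff_β y hy) (h.deriv_V y hy).differentiableAt
  have d3 := DifferentiableAt.fun_add (𝕜 := ℝ) (E := Plane) (F := Plane →L[ℝ] ℍ[ℝ])
    (f := fun z => (α z).smulRight (E z)) (g := fun z => (β z).smulRight (V z)) (x := y) d1 d2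
  exact DifferentiableAt.congr_of_eventuallyEq (𝕜 := ℝ) (E := Plane) (F := Plane →L[ℝ] ℍ[ℝ])
    (f := fun z => (α z).smulRight (E z) + (β z).smulRight (V z)) d3 hev

lemma secondFF_apply (v w : Plane) : Loc.secondFF f y v w =
    (2 * k 0 y * (α y v * α y w) + α y v * β y w + β y v * α y w) • N y := by
  have : fderiv ℝ (fderiv ℝ f) y v w = fderiv ℝ (fun z => fderiv ℝ f z w) y v := by
    rw [((h.differentiableAt_fderiv_f hy).hasFDerivAt.clm_apply (hasFDerivAt_const w y)).fderiv]
    simp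
  rw [Loc.secondFF, this, h.fderiv_fderiv_f_apply hy, h.normalProj_apply hy]
  simp only [inner_add_right, inner_sub_right, real_inner_smul_right, h.inner_NE hy,
    h.inner_NV hy, h.inner_NN hy, h.inner_Nf hy]
  congr 1
  ring

lemma inner_pderiv_pderiv_f (i j l : Fin 2) :
    inner ℝ (pderiv i (pderiv l f) y) (pderiv j f y) =
      fderiv ℝ α y (coordVec i) (coordVec l) * α y (coordVec j)
        + fderiv ℝ β y (coordVec i) (coordVec l) * β y (coordVec j) := by
  have : pderiv i (pderiv l f) y =
    fderiv ℝ (fun z => fderiv ℝ f z (coordVec l)) y (coordVec i) := rfl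
  rw [this, h.fderiv_fderiv_f_apply hy, h.pderiv_f hy]
  simp only [inner_add_left, inner_sub_left, inner_add_right, real_inner_smul_left,
    real_inner_smul_right, h.inner_EE hy, h.inner_EV hy, h.inner_VE hy, h.inner_VV hy,
    h.inner_NE hy, h.inner_NV hy, h.inner_fE hy, h.inner_fV hy]
  ring

/-- This is the parallelism of the coframe: the tangential part of the second derivatives of `f` has
components ∂α and ∂β in the frame, so the Christoffel symbols account for all of ∂α and ∂β. -/
lemma christoffel_coframe (i l : Fin 2) :
    ∑ m, Loc.christoffel f y m i l * α y (coordVec m) = fderiv ℝ α y (coordVec i) (coordVec l) ∧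
    ∑ m, Loc.christoffel f y m i l * β y (coordVec m) =
      fderiv ℝ β y (coordVec i) (coordVec l) := by
  obtain ⟨u, h1, h2⟩ := h.exists_dual hy (fderiv ℝ α y (coordVec i) (coordVec l))
    (fderiv ℝ β y (coordVec i) (coordVec l))
  have hu (m : Fin 2) : Loc.christoffel f y m i l = u m := by
    rw [Loc.christoffel, ← h.sum_ginv_coframe hy u m, h1, h2]
    exact Finset.sum_congr rfl fun j _ => by rw [h.inner_pderiv_pderiv_f hy]
  simp only [hu]
  rw [← h1, ← h2]
  constructor <;>
  · conv_rhs => rw [sum_coordVec u]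
    simp

/-- The derivative of `N` is tangential, so only the coefficient is differentiated. -/
lemma normalDeriv_smul_N {c : Plane → ℝ} {c' : Plane →L[ℝ] ℝ} (hc : HasFDerivAt c c' y)
    (i : Fin 2) : Loc.normalDeriv f y i (fun z => c z • N z) = c' (coordVec i) • N y := by
  rw [Loc.normalDeriv, pderiv, (hc.fun_smul (h.deriv_N y hy)).fderiv, h.normalProj_apply hy]
  congr 1
  simp only [add_apply, smul_apply,
    ContinuousLinearMap.smulRight_apply, neg_apply, inner_add_right,
    inner_neg_right, real_inner_smul_right, h.inner_NE hy, h.inner_NV hy, h.inner_NN hy]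
  ring

/-- The covariant derivative of a product of parallel forms with coefficient `c N`. -/
lemma tensorCovDeriv_prod {n : ℕ} (θ : Fin n → Plane → Plane →L[ℝ] ℝ)
    (hθ : ∀ a, θ a = α ∨ θ a = β) {c : Plane → ℝ} {c' : Plane →L[ℝ] ℝ} (hc : HasFDerivAt c c' y)
    (I : Fin (n + 1) → Fin 2) :
    Loc.tensorCovDeriv f y (fun z K => (c z * ∏ a, θ a z (coordVec (K a))) • N z) I =
      (c' (coordVec (I 0)) * ∏ a, θ a y (coordVec (Fin.tail I a))) • N y := by
  set K := Fin.tail I with hK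
  have hdθ (a : Fin n) (w : Plane) :
      HasFDerivAt (fun z => θ a z w) ((fderiv ℝ (θ a) y).flip w) y := by
    rcases hθ a with e | e <;> rw [e]
    exacts [h.hasFDerivAt_α_apply hy w, h.hasFDerivAt_β_apply hy w]
  have hΓ (a : Fin n) (i l : Fin 2) :
      ∑ m, Loc.christoffel f y m i l * θ a y (coordVec m) =
        fderiv ℝ (θ a) y (coordVec i) (coordVec l) := by
    rcases hθ a with e | e <;> rw [e]
    exacts [(h.christoffel_coframe hy i l).1, (h.christoffel_coframe hy i l).2]
  have hprod := HasFDerivAt.finsetProd (u := Finset.univ) fun a (_ : a ∈ Finset.univ) =>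
    hdθ a (coordVec (K a))
  have hd := h.normalDeriv_smul_N hy (hc.fun_mul hprod) (I 0)
  rw [Loc.tensorCovDeriv]
  refine (congrArg (· - _) hd).trans ?_
  have hupd (a : Fin n) (m : Fin 2) :
      ∏ b, θ b y (coordVec (Function.update K a m b)) =
        θ a y (coordVec m) * ∏ b ∈ Finset.univ.erase a, θ b y (coordVec (K b)) := by
    rw [← Finset.mul_prod_erase _ _ (Finset.mem_univ a), Function.update_self]
    congr 1
    refine Finset.prod_congr rfl fun b hb => ?_
    rw [Function.update_of_ne (Finset.ne_of_mem_erase hb)]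
  -- By `hΓ`, the Christoffel terms coincide with those in which the product rule differentiates one
  -- of the factors `θ a`; the two cancel and only the derivative of `c` survives.
  have hsum : ∑ a : Fin n, ∑ m : Fin 2, Loc.christoffel f y m (I 0) (K a) •
        (c y * ∏ b, θ b y (coordVec (Function.update K a m b))) • N y =
      (c y * ∑ a, (∏ b ∈ Finset.univ.erase a, θ b y (coordVec (K b))) *
        fderiv ℝ (θ a) y (coordVec (I 0)) (coordVec (K a))) • N y := by
    rw [Finset.mul_sum, Finset.sum_smul]
    refine Finset.sum_congr rfl fun a _ => ?_
    rw [← hΓ a (I 0) (K a), Finset.mul_sum, Finset.mul_sum, Finset.sum_smul]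
    refine Finset.sum_congr rfl fun m _ => ?_
    rw [hupd, smul_smul]
    congr 1
    ring
  rw [hsum, ← sub_smul]
  congr 1
  simp only [add_apply, smul_apply,
    sum_apply, ContinuousLinearMap.flip_apply, smul_eq_mul]
  ring

end HopfFrame

lemma Loc.tensorCovDeriv_add {f : Plane → ℍ[ℝ]} {y : Plane} {n : ℕ}
    {S T : Plane → (Fin n → Fin 2) → ℍ[ℝ]} (hS : ∀ K, DifferentiableAt ℝ (fun z => S z K) y)
    (hT : ∀ K, DifferentiableAt ℝ (fun z => T z K) y) (I : Fin (n + 1) → Fin 2) :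
    Loc.tensorCovDeriv f y (fun z K => S z K + T z K) I =
      Loc.tensorCovDeriv f y S I + Loc.tensorCovDeriv f y T I := by
  simp only [Loc.tensorCovDeriv, Loc.normalDeriv, pderiv, smul_add, Finset.sum_add_distrib]
  rw [fderiv_fun_add (hS _) (hT _), add_apply, map_add]
  abel

namespace HopfFrame

variable {f E V N : Plane → ℍ[ℝ]} {α β : Plane → Plane →L[ℝ] ℝ} {k : ℕ → Plane → ℝ}
  {U : Set Plane} (h : HopfFrame f E V N α β k U) {y : Plane} (hy : y ∈ U)

include h hy

lemma differentiableAt_prod {n : ℕ} (θ : Fin n → Plane → Plane →L[ℝ] ℝ)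
    (hθ : ∀ a, θ a = α ∨ θ a = β) {c : Plane → ℝ} {c' : Plane →L[ℝ] ℝ} (hc : HasFDerivAt c c' y)
    (K : Fin n → Fin 2) :
    DifferentiableAt ℝ (fun z => (c z * ∏ a, θ a z (coordVec (K a))) • N z) y := by
  refine DifferentiableAt.fun_smul (DifferentiableAt.fun_mul hc.differentiableAt ?_)
    (h.deriv_N y hy).differentiableAt
  have hd (a : Fin n) : DifferentiableAt ℝ (fun z => θ a z (coordVec (K a))) y := by
    rcases hθ a with e | e <;> rw [e]
    exacts [(h.hasFDerivAt_α_apply hy _).differentiableAt,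
      (h.hasFDerivAt_β_apply hy _).differentiableAt]
  exact (HasFDerivAt.finsetProd (u := Finset.univ) fun a _ => (hd a).hasFDerivAt).differentiableAt

/-- The mixed terms α⊗β and β⊗α of `A` have constant coefficients and parallel factors, so the first
covariant derivative annihilates them. From then on each derivative raises the index of `k` and
contributes one factor `α`. -/
lemma secondFFDeriv_succ (n : ℕ) (I : Fin (n + 1 + 2) → Fin 2) :
    Loc.secondFFDeriv f (n + 1) y I =
      (2 * k (n + 1) y * ∏ a, α y (coordVec (I a))) • N y := by
  induction n generalizing y with
  | zero =>
    rw [Loc.secondFFDeriv]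
    have hev : ∀ᶠ z in nhds y, Loc.secondFFDeriv f 0 z =
        (fun z K => (2 * k 0 z * ∏ a, (fun _ : Fin 2 => α) a z (coordVec (K a))) • N z
          + (1 * ∏ a, (![α, β] : Fin 2 → _) a z (coordVec (K a))) • N z
          + (1 * ∏ a, (![β, α] : Fin 2 → _) a z (coordVec (K a))) • N z) z := by
      filter_upwards [h.eventually_mem hy] with z hz
      ext1 K
      rw [Loc.secondFFDeriv, h.secondFF_apply hz, ← add_smul, ← add_smul]
      congr 1
      simp [Fin.prod_univ_two]
    rw [Loc.tensorCovDeriv_congr hev]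
    have k1 := h.tensorCovDeriv_prod hy (fun _ : Fin 2 => α) (fun _ => .inl rfl)
      ((h.deriv_k 0 y hy).const_mul 2) I
    have k2 := h.tensorCovDeriv_prod hy (![α, β] : Fin 2 → _) (fun a => by fin_cases a <;> simp)
      (hasFDerivAt_const 1 y) I
    have k3 := h.tensorCovDeriv_prod hy (![β, α] : Fin 2 → _) (fun a => by fin_cases a <;> simp)
      (hasFDerivAt_const 1 y) I
    have d1 := h.differentiableAt_prod hy (fun _ : Fin 2 => α) (fun _ => .inl rfl)
      ((h.deriv_k 0 y hy).const_mul 2)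
    have d2 := h.differentiableAt_prod hy (![α, β] : Fin 2 → _)
      (fun a => by fin_cases a <;> simp) (hasFDerivAt_const 1 y)
    have d3 := h.differentiableAt_prod hy (![β, α] : Fin 2 → _)
      (fun a => by fin_cases a <;> simp) (hasFDerivAt_const 1 y)
    rw [Loc.tensorCovDeriv_add (fun K => (d1 K).fun_add (d2 K)) d3,
      Loc.tensorCovDeriv_add d1 d2, k1, k2, k3]
    simp only [zero_apply, zero_mul, zero_smul, add_zero]
    congr 1
    conv_rhs => rw [Fin.prod_univ_succ]
    simp only [smul_apply, smul_eq_mul, Fin.tail]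
    ring
  | succ n ih =>
    rw [Loc.secondFFDeriv]
    have hev : ∀ᶠ z in nhds y, Loc.secondFFDeriv f (n + 1) z =
        (fun z K => (2 * k (n + 1) z * ∏ a, (fun _ => α) a z (coordVec (K a))) • N z) z := by
      filter_upwards [h.eventually_mem hy] with z hz
      ext1 K
      exact ih hz K
    rw [Loc.tensorCovDeriv_congr hev]
    refine (h.tensorCovDeriv_prod hy (fun _ => α) (fun _ => .inl rfl)
      ((h.deriv_k (n + 1) y hy).const_mul 2) I).trans ?_
    congr 1
    conv_rhs => rw [Fin.prod_univ_succ]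
    simp only [smul_apply, smul_eq_mul, Fin.tail]
    ring

/-- The sum over pairs of multi-indices factors into `n` copies of |α|² = 1. -/
lemma tensorNormSq_prod {n : ℕ} (c : ℝ) :
    Loc.tensorNormSq f y (fun I : Fin n → Fin 2 => (c * ∏ a, α y (coordVec (I a))) • N y) =
      c ^ 2 := by
  rw [Loc.tensorNormSq]
  have : ∀ I J : Fin n → Fin 2, (∏ a, Loc.ginv f y (I a) (J a)) *
      (inner ℝ ((c * ∏ a, α y (coordVec (I a))) • N y) ((c * ∏ a, α y (coordVec (J a))) • N y) : ℝ)
      = c ^ 2 * ∏ a, Loc.ginv f y (I a) (J a) * (α y (coordVec (I a)) * α y (coordVec (J a))) := by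
    intro I J
    rw [real_inner_smul_left, real_inner_smul_right, h.inner_NN hy, Finset.prod_mul_distrib,
      Finset.prod_mul_distrib]
    ring
  simp only [this, ← Finset.mul_sum]
  have hpow := Fintype.sum_pow (fun q : Fin 2 × Fin 2 =>
    Loc.ginv f y q.1 q.2 * (α y (coordVec q.1) * α y (coordVec q.2))) n
  rw [Fintype.sum_prod_type, h.ginv_αα hy, one_pow] at hpow
  have : ∑ I : Fin n → Fin 2, ∑ J : Fin n → Fin 2,
      ∏ a, Loc.ginv f y (I a) (J a) * (α y (coordVec (I a)) * α y (coordVec (J a))) = 1 := by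
    rw [hpow, ← Fintype.sum_prod_type']
    refine (Fintype.sum_equiv (Equiv.arrowProdEquivProdArrow (Fin n) (fun _ => Fin 2) (fun _ => Fin 2)) _ _ ?_).symm
    intro q
    rfl
  rw [this, mul_one]

lemma secondFFDeriv_normSq {n : ℕ} (hn : 1 ≤ n) :
    Loc.tensorNormSq f y (Loc.secondFFDeriv f n y) = 4 * k n y ^ 2 := by
  obtain ⟨n, rfl⟩ := Nat.exists_eq_add_of_le' hn
  rw [show Loc.secondFFDeriv f (n + 1) y = fun I => (2 * k (n + 1) y *
    ∏ a, α y (coordVec (I a))) • N y from funext (h.secondFFDeriv_succ hy n),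
    h.tensorNormSq_prod hy]
  ring

lemma meanCurv_eq : Loc.meanCurv f y = (2 * k 0 y) • N y := by
  have h1 := h.ginv_αα hy
  have h2 := h.ginv_αβ hy
  have h3 := h.ginv_βα hy
  simp only [Loc.meanCurv, h.secondFF_apply hy, smul_smul, ← Finset.sum_smul]
  congr 1
  simp only [Fin.sum_univ_two] at *
  linear_combination (2 * k 0 y) * h1 + h2 + h3

lemma tracefreeFF_apply (v w : Plane) : Loc.tracefreeFF f y v w =
    (k 0 y * (α y v * α y w - β y v * β y w) + α y v * β y w + β y v * α y w) • N y := by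
  rw [Loc.tracefreeFF, h.secondFF_apply hy, h.meanCurv_eq hy, h.fderiv_f hy, h.fderiv_f hy]
  simp only [inner_add_left, inner_add_right, real_inner_smul_left,
    real_inner_smul_right, h.inner_EE hy, h.inner_EV hy, h.inner_VE hy, h.inner_VV hy, smul_smul,
    ← sub_smul]
  congr 1
  ring

/-- The components of `A⁰` with respect to `N`, contracted with themselves. -/
lemma sum_tracefree_sq (A : Fin 2 → Fin 2 → ℝ)
    (hA : A = fun i j => k 0 y * (α y (coordVec i) * α y (coordVec j)
      - β y (coordVec i) * β y (coordVec j)) + α y (coordVec i) * β y (coordVec j)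
      + β y (coordVec i) * α y (coordVec j)) :
    ∑ i, ∑ j, ∑ l, ∑ m, Loc.ginv f y i l * Loc.ginv f y j m * A l m * A i j =
      2 * (k 0 y ^ 2 + 1) := by
  have h1 := h.ginv_αα hy
  have h2 := h.ginv_αβ hy
  have h3 := h.ginv_βα hy
  have h4 := h.ginv_ββ hy
  subst hA
  set ip : (Fin 2 → ℝ) → (Fin 2 → ℝ) → ℝ := fun u v => ∑ i, ∑ j, Loc.ginv f y i j * (u i * v j)
    with hip
  set a : Fin 2 → ℝ := fun i => α y (coordVec i)
  set b : Fin 2 → ℝ := fun i => β y (coordVec i)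
  change ip a a = 1 at h1
  change ip a b = 0 at h2
  change ip b a = 0 at h3
  change ip b b = 1 at h4
  set c := k 0 y
  -- The contraction is expressed through the four products of `α` and `β`, kept apart as `ip a b`
  -- and `ip b a`, so that symmetry of the inverse metric is not needed.
  trans c ^ 2 * (ip a a ^ 2 - ip a b ^ 2 - ip b a ^ 2 + ip b b ^ 2)
    + 2 * c * (ip a a * ip a b + ip a a * ip b a - ip a b * ip b b - ip b a * ip b b)
    + 2 * ip a a * ip b b + 2 * ip a b * ip b a
  · simp only [hip, Fin.sum_univ_two]
    simp only [show ∀ i, α y (coordVec i) = a i from fun _ => rfl,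
      show ∀ i, β y (coordVec i) = b i from fun _ => rfl]
    ring
  · rw [h1, h2, h3, h4]
    ring

lemma tracefreeFF_normSq : Loc.tensorNormSq f y (fun I : Fin 2 → Fin 2 =>
    Loc.tracefreeFF f y (coordVec (I 0)) (coordVec (I 1))) = 2 * (k 0 y ^ 2 + 1) := by
  obtain ⟨A, hA⟩ : ∃ A : Fin 2 → Fin 2 → ℝ, A = fun i j => k 0 y * (α y (coordVec i) *
      α y (coordVec j) - β y (coordVec i) * β y (coordVec j)) + α y (coordVec i) * β y (coordVec j)
      + β y (coordVec i) * α y (coordVec j) := ⟨_, rfl⟩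
  have hT (i j : Fin 2) : Loc.tracefreeFF f y (coordVec i) (coordVec j) = A i j • N y := by
    rw [h.tracefreeFF_apply hy, hA]
  rw [← h.sum_tracefree_sq hy A hA, Loc.tensorNormSq]
  simp only [hT]
  rw [Fintype.sum_equiv (finTwoArrowEquiv (Fin 2)) _ (fun p => ∑ l, ∑ m,
    Loc.ginv f y p.1 l * Loc.ginv f y p.2 m * A l m * A p.1 p.2), Fintype.sum_prod_type]
  intro I
  rw [Fintype.sum_equiv (finTwoArrowEquiv (Fin 2)) _ (fun p =>
    Loc.ginv f y (I 0) p.1 * Loc.ginv f y (I 1) p.2 * A p.1 p.2 * A (I 0) (I 1)),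
    Fintype.sum_prod_type]
  · rfl
  intro J
  rw [real_inner_smul_left, real_inner_smul_right, h.inner_NN hy, Fin.prod_univ_two]
  change _ = Loc.ginv f y (I 0) (J 0) * Loc.ginv f y (I 1) (J 1) * A (J 0) (J 1) * A (I 0) (I 1)
  ring

lemma Q_eq (c : ℝ) : Loc.Q f y (c • N y) = (2 * (k 0 y ^ 2 + 1) * c) • N y := by
  rw [← h.sum_tracefree_sq hy _ rfl]
  simp only [Loc.Q, h.tracefreeFF_apply hy, real_inner_smul_left, real_inner_smul_right,
    h.inner_NN hy, smul_smul, ← Finset.sum_smul]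
  congr 1
  simp only [Finset.sum_mul]
  refine Finset.sum_congr rfl fun i _ => Finset.sum_congr rfl fun j _ =>
    Finset.sum_congr rfl fun l _ => Finset.sum_congr rfl fun m _ => by ring

/-- With `N` and `α` parallel, the first derivative of `W` is 2k₁α and the second is 2k₂ α⊗α, each
times `N`; the trace uses |α| = 1. Since `W` is differentiated twice, it has to be known near `y`.
-/
lemma normalLaplacian_eq {W : Plane → ℍ[ℝ]}
    (hW : W =ᶠ[nhds y] fun z => (2 * k 0 z) • N z) :
    Loc.normalLaplacian f y W = (2 * k 2 y) • N y := by
  have hN : ∀ᶠ z in nhds y, ∀ l, Loc.normalDeriv f z l W =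
      (2 * k 1 z * α z (coordVec l)) • N z := by
    filter_upwards [hW.eventually_nhds, h.eventually_mem hy] with z hz hzU l
    rw [Loc.normalDeriv_congr hz, h.normalDeriv_smul_N hzU ((h.deriv_k 0 z hzU).const_mul 2)]
    simp only [smul_apply, smul_eq_mul, mul_assoc]
  have hNN (i l : Fin 2) : Loc.normalDeriv f y i (fun z => Loc.normalDeriv f z l W) =
      (2 * k 2 y * (α y (coordVec i) * α y (coordVec l))
        + 2 * k 1 y * fderiv ℝ α y (coordVec i) (coordVec l)) • N y := by
    rw [Loc.normalDeriv_congr (hN.mono fun z hz => hz l), h.normalDeriv_smul_N hy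
      (((h.deriv_k 1 y hy).const_mul 2).fun_mul (h.hasFDerivAt_α_apply hy (coordVec l)))]
    simp only [add_apply, smul_apply, smul_eq_mul, ContinuousLinearMap.flip_apply]
    congr 1
    ring
  have h1 := h.ginv_αα hy
  have hterm (i l : Fin 2) : Loc.normalDeriv f y i (fun z => Loc.normalDeriv f z l W) -
      ∑ m, Loc.christoffel f y m i l • Loc.normalDeriv f y m W =
      (2 * k 2 y * (α y (coordVec i) * α y (coordVec l))) • N y := by
    rw [hNN, ← (h.christoffel_coframe hy i l).1]
    simp only [hN.self_of_nhds, smul_smul, ← Finset.sum_smul, ← sub_smul]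
    congr 1
    simp only [Fin.sum_univ_two]
    ring
  simp only [Loc.normalLaplacian, hterm, smul_smul, ← Finset.sum_smul]
  congr 1
  simp only [Fin.sum_univ_two] at *
  linear_combination (2 * k 2 y) * h1

end HopfFrame

/-! ### Quaternion algebra -/

@[simp] lemma qi_re : qi.re = 0 := rfl
@[simp] lemma qi_imI : qi.imI = 1 := rfl
@[simp] lemma qi_imJ : qi.imJ = 0 := rfl
@[simp] lemma qi_imK : qi.imK = 0 := rfl
@[simp] lemma tilde_re (x : ℍ[ℝ]) : (tilde x).re = x.re := rfl
@[simp] lemma tilde_imI (x : ℍ[ℝ]) : (tilde x).imI = -x.imI := rfl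
@[simp] lemma tilde_imJ (x : ℍ[ℝ]) : (tilde x).imJ = x.imJ := rfl
@[simp] lemma tilde_imK (x : ℍ[ℝ]) : (tilde x).imK = x.imK := rfl

lemma inner_eq (a b : ℍ[ℝ]) :
    (inner ℝ a b : ℝ) = a.re * b.re + a.imI * b.imI + a.imJ * b.imJ + a.imK * b.imK := by
  rw [Quaternion.inner_def]
  simp

lemma norm_eq_one_iff (a : ℍ[ℝ]) :
    ‖a‖ = 1 ↔ a.re ^ 2 + a.imI ^ 2 + a.imJ ^ 2 + a.imK ^ 2 = 1 := by
  rw [← Quaternion.normSq_def', Quaternion.normSq_eq_norm_mul_self, ← pow_two]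
  exact (pow_eq_one_iff_of_nonneg (norm_nonneg a) two_ne_zero).symm

lemma mul_star_of_norm_eq_one {a : ℍ[ℝ]} (ha : ‖a‖ = 1) : a * star a = 1 := by
  rw [Quaternion.self_mul_star, Quaternion.normSq_eq_norm_mul_self, ha]
  simp

lemma star_mul_of_norm_eq_one {a : ℍ[ℝ]} (ha : ‖a‖ = 1) : star a * a = 1 := by
  rw [Quaternion.star_mul_self, Quaternion.normSq_eq_norm_mul_self, ha]
  simp

lemma inner_mul_left_of_norm_eq_one {b : ℍ[ℝ]} (hb : ‖b‖ = 1) (x y : ℍ[ℝ]) :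
    (inner ℝ (b * x) (b * y) : ℝ) = inner ℝ x y := by
  rw [norm_eq_one_iff] at hb
  simp only [inner_eq, Quaternion.re_mul, Quaternion.imI_mul, Quaternion.imJ_mul,
    Quaternion.imK_mul]
  linear_combination (x.re * y.re + x.imI * y.imI + x.imJ * y.imJ + x.imK * y.imK) * hb

lemma inner_mul_left (b x y : ℍ[ℝ]) : (inner ℝ (b * x) y : ℝ) = inner ℝ x (star b * y) := by
  simp only [inner_eq, Quaternion.re_mul, Quaternion.imI_mul, Quaternion.imJ_mul,
    Quaternion.imK_mul, Quaternion.re_star, Quaternion.imI_star, Quaternion.imJ_star,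
    Quaternion.imK_star]
  ring

/-- The polarized norm identity xȳ + yx̄ = 2⟨x, y⟩, multiplied on the right by x. -/
lemma mul_star_mul (x y : ℍ[ℝ]) :
    x * star y * x = (2 * inner ℝ x y : ℝ) • x - (‖x‖ ^ 2) • y := by
  rw [pow_two, ← Quaternion.normSq_eq_norm_mul_self, Quaternion.normSq_def']
  ext <;> simp [inner_eq] <;> ring

@[simp] lemma qi_mul_qi : qi * qi = -1 := by ext <;> simp

@[simp] lemma norm_qi : ‖qi‖ = 1 := by rw [norm_eq_one_iff]; simp

lemma qi_mul_eq {x : ℍ[ℝ]} (hx : x.imI = 0) : qi * x = star x * qi := by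
  ext <;> simp [hx]

lemma inner_qi {x : ℍ[ℝ]} : (inner ℝ x qi : ℝ) = x.imI := by
  simp [inner_eq]

lemma tilde_eq (x : ℍ[ℝ]) : tilde x = -(qi * star x * qi) := by
  ext <;> simp

lemma tilde_mul (x y : ℍ[ℝ]) : tilde (x * y) = tilde y * tilde x := by
  ext <;> simp <;> ring

@[simp] lemma tilde_tilde (x : ℍ[ℝ]) : tilde (tilde x) = x := by
  ext <;> simp

lemma tilde_eq_self {x : ℍ[ℝ]} (hx : x.imI = 0) : tilde x = x := by
  ext <;> simp [hx]

lemma inner_tilde (x y : ℍ[ℝ]) : (inner ℝ (tilde x) (tilde y) : ℝ) = inner ℝ x y := by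
  simp [inner_eq]

@[simp] lemma norm_tilde (x : ℍ[ℝ]) : ‖tilde x‖ = ‖x‖ := by
  rw [← sq_eq_sq₀ (norm_nonneg _) (norm_nonneg _), ← real_inner_self_eq_norm_sq, inner_tilde,
    real_inner_self_eq_norm_sq]

/-- The involution `q ↦ q̃` as a continuous linear map. -/
def tildeL : ℍ[ℝ] →L[ℝ] ℍ[ℝ] :=
  LinearMap.toContinuousLinearMap
    { toFun := tilde
      map_add' := fun x y => by ext <;> simp; ring
      map_smul' := fun c x => by ext <;> simp }

@[simp] lemma tildeL_apply (x : ℍ[ℝ]) : tildeL x = tilde x := rfl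

/-- The conjugation as a continuous linear map. -/
def starL : ℍ[ℝ] →L[ℝ] ℍ[ℝ] :=
  LinearMap.toContinuousLinearMap
    { toFun := star
      map_add' := fun x y => star_add x y
      map_smul' := fun c x => Quaternion.star_smul c x }

@[simp] lemma starL_apply (x : ℍ[ℝ]) : starL x = star x := rfl

lemma norm_hopf {q : ℍ[ℝ]} (hq : ‖q‖ = 1) : ‖hopf q‖ = 1 := by
  rw [hopf, norm_mul, norm_tilde, hq, one_mul]

lemma hasFDerivAt_hopf (q : ℍ[ℝ]) :
    HasFDerivAt hopf ((ContinuousLinearMap.mul ℝ ℍ[ℝ] (tilde q))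
      + ((ContinuousLinearMap.mul ℝ ℍ[ℝ]).flip q).comp tildeL) q := by
  have := (tildeL.hasFDerivAt (x := q)).mul' (hasFDerivAt_id q)
  refine this.congr_fderiv ?_
  ext1 v
  simp

lemma dHopf_apply (q v : ℍ[ℝ]) : dHopf q v = tilde q * v + tilde (tilde q * v) := by
  rw [dHopf, (hasFDerivAt_hopf q).fderiv, tilde_mul, tilde_tilde]
  simp

lemma dHopf_smul (q : ℍ[ℝ]) (c : ℝ) (v : ℍ[ℝ]) : dHopf q (c • v) = c • dHopf q v := by
  simp [dHopf]

/-- For a unit quaternion, the transport of `X` from `π(p)` to `p`. -/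
def transport (p : ℍ[ℝ]) : ℍ[ℝ] := p * star (hopf p)

lemma transport_eq {p : ℍ[ℝ]} (hp : ‖p‖ = 1) : transport p = star (tilde p) := by
  rw [transport, hopf, star_mul, ← mul_assoc, mul_star_of_norm_eq_one hp, one_mul]

lemma norm_transport {p : ℍ[ℝ]} (hp : ‖p‖ = 1) : ‖transport p‖ = 1 := by
  rw [transport_eq hp, norm_star, norm_tilde, hp]

lemma transport_mul_hopf {p : ℍ[ℝ]} (hp : ‖p‖ = 1) : transport p * hopf p = p := by
  rw [transport, mul_assoc, star_mul_of_norm_eq_one (norm_hopf hp), mul_one]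

/-- Here conj(p̃) = -ipi. Together with `transport_mul_hopf` this shows that left multiplication by
`transport p` takes π(p) to p and i to the fibre direction ip, so it carries frames along the curve
to frames along the Hopf torus. -/
lemma transport_mul_qi {p : ℍ[ℝ]} (hp : ‖p‖ = 1) : transport p * qi = qi * p := by
  rw [transport_eq hp, tilde_eq]
  have : star (-(qi * star p * qi)) = -(qi * p * qi) := by
    have : star qi = -qi := by ext <;> simp
    simp [this, mul_assoc]
  rw [this, neg_mul, mul_assoc, qi_mul_qi]
  simp

/-- The involution is an isometry and fixes `X`, so both summands of the differential contribute
equally; this is the origin of the factor 2. -/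
lemma inner_dHopf {p : ℍ[ℝ]} (hp : ‖p‖ = 1) (v : ℍ[ℝ]) {X : ℍ[ℝ]} (hX : X.imI = 0) :
    (inner ℝ (dHopf p v) X : ℝ) = 2 * inner ℝ v (transport p * X) := by
  have : (inner ℝ (tilde (tilde p * v)) X : ℝ) = inner ℝ (tilde p * v) X := by
    conv_lhs => rw [← tilde_eq_self hX]
    rw [inner_tilde]
  rw [dHopf_apply, inner_add_left, this, inner_mul_left, transport_eq hp]
  ring

lemma dHopf_transport_mul {p : ℍ[ℝ]} (hp : ‖p‖ = 1) {X : ℍ[ℝ]} (hX : X.imI = 0) :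
    dHopf p (transport p * X) = (2 : ℝ) • X := by
  have : tilde p * (transport p * X) = X := by
    rw [transport_eq hp, ← mul_assoc, mul_star_of_norm_eq_one (by rw [norm_tilde, hp]), one_mul]
  rw [dHopf_apply, this, tilde_eq_self hX, two_smul]

lemma dHopf_qi_mul {p : ℍ[ℝ]} (hp : ‖p‖ = 1) : dHopf p (qi * p) = 0 := by
  rw [← transport_mul_qi hp, dHopf_apply, transport_eq hp, ← mul_assoc,
    mul_star_of_norm_eq_one (by rw [norm_tilde, hp]), one_mul]
  ext <;> simp

/-- The quaternion `e^{it}`. -/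
def expI (t : ℝ) : ℍ[ℝ] := ⟨Real.cos t, Real.sin t, 0, 0⟩

@[simp] lemma expI_re (t : ℝ) : (expI t).re = Real.cos t := rfl
@[simp] lemma expI_imI (t : ℝ) : (expI t).imI = Real.sin t := rfl
@[simp] lemma expI_imJ (t : ℝ) : (expI t).imJ = 0 := rfl
@[simp] lemma expI_imK (t : ℝ) : (expI t).imK = 0 := rfl

@[simp] lemma norm_expI (t : ℝ) : ‖expI t‖ = 1 := by
  rw [norm_eq_one_iff]; simp

lemma qi_mul_expI (t : ℝ) : qi * expI t = expI t * qi := by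
  ext <;> simp

lemma expI_eq (t : ℝ) : expI t = Real.cos t • (1 : ℍ[ℝ]) + Real.sin t • qi := by
  ext <;> simp

lemma contDiff_expI : ContDiff ℝ ∞ expI := by
  simp only [funext expI_eq]
  exact (Real.contDiff_cos.smul contDiff_const).add (Real.contDiff_sin.smul contDiff_const)

lemma hasDerivAt_expI (t : ℝ) : HasDerivAt expI (qi * expI t) t := by
  have := ((Real.hasDerivAt_cos t).smul_const (1 : ℍ[ℝ])).add
    ((Real.hasDerivAt_sin t).smul_const qi)
  refine (this.congr_deriv ?_).congr_of_eventuallyEq (Filter.Eventually.of_forall fun x => ?_)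
  · rw [expI_eq, mul_add, mul_smul_comm, mul_smul_comm, qi_mul_qi]
    simp only [mul_one]
    module
  · simp [expI_eq]

lemma hopf_expI_mul (t : ℝ) (q : ℍ[ℝ]) : hopf (expI t * q) = hopf q := by
  have : tilde (expI t) * expI t = 1 := by
    ext <;> simp <;> nlinarith [Real.sin_sq_add_cos_sq t]
  rw [hopf, tilde_mul, mul_assoc, ← mul_assoc (tilde (expI t)), this, one_mul, hopf]

lemma expI_injective_iff (s t : ℝ) : expI s = expI t ↔ ∃ n : ℤ, t = s + n * (2 * Real.pi) := by
  have : expI s = expI t ↔ Complex.exp (s * Complex.I) = Complex.exp (t * Complex.I) := by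
    rw [Complex.exp_mul_I, Complex.exp_mul_I, ← Complex.ofReal_cos, ← Complex.ofReal_sin,
      ← Complex.ofReal_cos, ← Complex.ofReal_sin, Complex.ext_iff]
    simp [Quaternion.ext_iff, -Complex.ofReal_cos, -Complex.ofReal_sin]
  rw [this, eq_comm, Complex.exp_eq_exp_iff_exists_int]
  refine exists_congr fun n => ?_
  rw [← sub_eq_zero, ← sub_eq_zero (a := t)]
  have : (t : ℂ) * Complex.I - (s * Complex.I + n * (2 * Real.pi * Complex.I)) =
      ((t - (s + n * (2 * Real.pi)) : ℝ) : ℂ) * Complex.I := by push_cast; ring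
  rw [this, mul_eq_zero, or_iff_left Complex.I_ne_zero, Complex.ofReal_eq_zero]

/-- The fibres of the Hopf fibration of the 3-sphere are circles. -/
lemma exists_expI_mul_eq {p q : ℍ[ℝ]} (hp : ‖p‖ = 1) (hq : ‖q‖ = 1) (h : hopf p = hopf q) :
    ∃ t, p = expI t * q := by
  set u := p * star q with hu
  have hpu : p = u * q := by rw [hu, mul_assoc, star_mul_of_norm_eq_one hq, mul_one]
  have hnu : ‖u‖ = 1 := by rw [hu, norm_mul, norm_star, hp, hq, one_mul]
  -- Cancelling `q` and its involute leaves ũu = 1. As |u| = 1, this says ũ = ū, and comparison of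
  -- the j- and k-components places u on the unit circle of span{1, i}.
  have h1 : tilde u * u = 1 := by
    have hh : tilde q * (tilde u * u) * q = tilde q * q := by
      rw [hpu, hopf, hopf, tilde_mul] at h
      rw [← h]; simp only [mul_assoc]
    have e1 : star (tilde q) * (tilde q * (tilde u * u) * q) * star q =
        (star (tilde q) * tilde q) * (tilde u * u) * (q * star q) := by simp only [mul_assoc]
    have e2 : star (tilde q) * (tilde q * q) * star q =
        (star (tilde q) * tilde q) * (q * star q) := by simp only [mul_assoc]
    rw [star_mul_of_norm_eq_one (by rw [norm_tilde, hq]), mul_star_of_norm_eq_one hq] at e1 e2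
    rw [one_mul, mul_one] at e1
    rw [← e1, hh, e2, one_mul]
  have h2 : tilde u = star u := by
    calc tilde u = tilde u * (u * star u) := by rw [mul_star_of_norm_eq_one hnu, mul_one]
      _ = star u := by rw [← mul_assoc, h1, one_mul]
  have hJ : u.imJ = 0 := by
    have := congrArg (fun x : ℍ[ℝ] => x.imJ) h2
    simp at this; linarith
  have hK : u.imK = 0 := by
    have := congrArg (fun x : ℍ[ℝ] => x.imK) h2
    simp at this; linarith
  rw [norm_eq_one_iff, hJ, hK] at hnu
  set z : ℂ := ⟨u.re, u.imI⟩ with hz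
  have hzn : ‖z‖ = 1 := by
    rw [← pow_eq_one_iff_of_nonneg (norm_nonneg z) two_ne_zero, ← Complex.normSq_eq_norm_sq,
      Complex.normSq_mk]
    linarith
  refine ⟨z.arg, ?_⟩
  have hz0 : z ≠ 0 := by rw [← norm_pos_iff, hzn]; exact one_pos
  have : u = expI z.arg := by
    ext
    · rw [expI_re, Complex.cos_arg hz0, hzn, div_one]
    · rw [expI_imI, Complex.sin_arg, hzn, div_one]
    · simp [hJ]
    · simp [hK]
  rw [← this, ← hpu]

lemma hasDerivAt_inner_const {c : ℝ → ℍ[ℝ]} {c' : ℍ[ℝ]} {s : ℝ} (hc : HasDerivAt c c' s)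
    (x : ℍ[ℝ]) : HasDerivAt (fun t => (inner ℝ (c t) x : ℝ)) (inner ℝ c' x) s := by
  simpa using hc.inner ℝ (hasDerivAt_const s x)

/-! ### Frenet equations of a curve in the 2-sphere, in the frame (γ, T, i, ν) of ℍ. -/

namespace IsSimpleClosedCurve

variable {γ : ℝ → ℍ[ℝ]} {L : ℝ} (hγ : IsSimpleClosedCurve γ L)

include hγ

lemma contDiff_deriv : ContDiff ℝ ∞ (deriv γ) := (contDiff_infty_iff_deriv.1 hγ.smooth).2

lemma hasDerivAt (s : ℝ) : HasDerivAt γ (deriv γ s) s :=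
  (hγ.smooth.differentiable (by simp)).differentiableAt.hasDerivAt

lemma speed_pos (s : ℝ) : 0 < ‖deriv γ s‖ := norm_pos_iff.2 (hγ.regular s)

lemma contDiff_speed : ContDiff ℝ ∞ (fun s => ‖deriv γ s‖) :=
  hγ.contDiff_deriv.norm ℝ hγ.regular

lemma contDiff_speed_inv : ContDiff ℝ ∞ (fun s => ‖deriv γ s‖⁻¹) :=
  hγ.contDiff_speed.inv fun s => (hγ.speed_pos s).ne'

lemma periodic_deriv : Function.Periodic (deriv γ) L := by
  intro s
  rw [← deriv_comp_add_const, hγ.periodic.funext]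

lemma contDiff_arcDeriv {V : Type*} [NormedAddCommGroup V] [NormedSpace ℝ V] {W : ℝ → V}
    (hW : ContDiff ℝ ∞ W) : ContDiff ℝ ∞ (arcDeriv γ W) :=
  hγ.contDiff_speed_inv.smul (contDiff_infty_iff_deriv.1 hW).2

lemma deriv_eq_smul_arcDeriv {V : Type*} [NormedAddCommGroup V] [NormedSpace ℝ V] (W : ℝ → V)
    (s : ℝ) : deriv W s = ‖deriv γ s‖ • arcDeriv γ W s := by
  rw [arcDeriv, smul_smul, mul_inv_cancel₀ (hγ.speed_pos s).ne', one_smul]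

lemma hasDerivAt_of_contDiff {V : Type*} [NormedAddCommGroup V] [NormedSpace ℝ V] {W : ℝ → V}
    (hW : ContDiff ℝ ∞ W) (s : ℝ) : HasDerivAt W (‖deriv γ s‖ • arcDeriv γ W s) s := by
  rw [← hγ.deriv_eq_smul_arcDeriv]
  exact (hW.differentiable (by simp)).differentiableAt.hasDerivAt

lemma contDiff_tangent : ContDiff ℝ ∞ (arcDeriv γ γ) := hγ.contDiff_arcDeriv hγ.smooth

lemma norm_tangent (s : ℝ) : ‖arcDeriv γ γ s‖ = 1 := by
  rw [arcDeriv, norm_smul, norm_inv, norm_norm, inv_mul_cancel₀ (hγ.speed_pos s).ne']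

lemma imI_deriv (s : ℝ) : (deriv γ s).imI = 0 := by
  have := (hasDerivAt_inner_const (hγ.hasDerivAt s) qi).unique
    ((hasDerivAt_const s (0 : ℝ)).congr_of_eventuallyEq (Filter.Eventually.of_forall fun t => by
      simp only [inner_qi, hγ.imI_eq_zero]))
  rwa [inner_qi] at this

lemma imI_tangent (s : ℝ) : (arcDeriv γ γ s).imI = 0 := by
  simp [arcDeriv, hγ.imI_deriv]

lemma inner_self (s : ℝ) : (inner ℝ (γ s) (γ s) : ℝ) = 1 := by
  rw [real_inner_self_eq_norm_sq, hγ.norm_eq_one, one_pow]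

lemma inner_tangent_tangent (s : ℝ) : (inner ℝ (arcDeriv γ γ s) (arcDeriv γ γ s) : ℝ) = 1 := by
  rw [real_inner_self_eq_norm_sq, hγ.norm_tangent, one_pow]

lemma inner_tangent_deriv (s : ℝ) :
    (inner ℝ (arcDeriv γ γ s) (deriv γ s) : ℝ) = ‖deriv γ s‖ := by
  rw [arcDeriv, real_inner_smul_left, real_inner_self_eq_norm_sq]
  field_simp [(hγ.speed_pos s).ne']

lemma inner_deriv_self (s : ℝ) : (inner ℝ (deriv γ s) (γ s) : ℝ) = 0 := by
  have := ((hγ.hasDerivAt s).inner ℝ (hγ.hasDerivAt s)).unique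
    ((hasDerivAt_const s (1 : ℝ)).congr_of_eventuallyEq (Filter.Eventually.of_forall fun t =>
      hγ.inner_self t))
  rw [real_inner_comm] at this
  linarith

lemma inner_tangent_self (s : ℝ) : (inner ℝ (arcDeriv γ γ s) (γ s) : ℝ) = 0 := by
  rw [arcDeriv, real_inner_smul_left, hγ.inner_deriv_self, mul_zero]

section Normal

variable {ν : ℝ → ℍ[ℝ]} (hν : IsUnitNormalAlongCurve γ ν)

include hν

omit hγ in
lemma inner_normal_tangent (s : ℝ) : (inner ℝ (ν s) (arcDeriv γ γ s) : ℝ) = 0 := by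
  rw [arcDeriv, real_inner_smul_right, hν.normal, mul_zero]

omit hγ in
lemma inner_normal_normal (s : ℝ) : (inner ℝ (ν s) (ν s) : ℝ) = 1 := by
  rw [real_inner_self_eq_norm_sq, hν.norm_eq_one, one_pow]

lemma orthonormal_frame (s : ℝ) : Orthonormal ℝ ![γ s, arcDeriv γ γ s, qi, ν s] := by
  have h1 := hγ.inner_tangent_self s
  have h2 := inner_normal_tangent hν s
  have h3 := hν.tangent_sphere s
  constructor
  · intro i
    fin_cases i
    exacts [hγ.norm_eq_one s, hγ.norm_tangent s, norm_qi, hν.norm_eq_one s]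
  · intro i j hij
    fin_cases i <;> fin_cases j <;> simp at hij ⊢ <;>
      first
        | assumption
        | (rw [real_inner_comm]; assumption)
        | (rw [inner_qi]; simp [hγ.imI_eq_zero, hγ.imI_tangent, hν.imI_eq_zero])
        | (rw [real_inner_comm, inner_qi]; simp [hγ.imI_eq_zero, hγ.imI_tangent, hν.imI_eq_zero])

lemma expansion (s : ℝ) (w : ℍ[ℝ]) : w = (inner ℝ w (γ s) : ℝ) • γ s
    + (inner ℝ w (arcDeriv γ γ s) : ℝ) • arcDeriv γ γ s + w.imI • qi
    + (inner ℝ w (ν s) : ℝ) • ν s := by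
  have := orthonormal_expansion (hγ.orthonormal_frame hν s) w
  simp only [Fin.sum_univ_four, Matrix.cons_val_zero, Matrix.cons_val_one, Matrix.cons_val] at this
  rw [← inner_qi, real_inner_comm, real_inner_comm (arcDeriv γ γ s) w, real_inner_comm qi w,
    real_inner_comm (ν s) w]
  exact this

omit hγ in
lemma curvatureVector_inner (s : ℝ) :
    signedCurvature γ ν s = inner ℝ (arcDeriv γ (arcDeriv γ γ) s) (ν s) := by
  rw [signedCurvature, curvatureVector, covDerivCurve, inner_sub_left, real_inner_smul_left,
    real_inner_comm, real_inner_comm (ν s) (γ s), hν.tangent_sphere]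
  ring

lemma contDiff_signedCurvature : ContDiff ℝ ∞ (signedCurvature γ ν) := by
  rw [funext (curvatureVector_inner hν)]
  exact (hγ.contDiff_arcDeriv hγ.contDiff_tangent).inner ℝ hν.smooth

/-- The components come from differentiating ⟨T, γ⟩ = 0, |T|² = 1 and the vanishing of the
i-component of T; the term -γ is the curvature of the sphere. -/
lemma arcDeriv_tangent (s : ℝ) :
    arcDeriv γ (arcDeriv γ γ) s = signedCurvature γ ν s • ν s - γ s := by
  have hT := hγ.hasDerivAt_of_contDiff hγ.contDiff_tangent s
  have hr := (hγ.speed_pos s).ne'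
  have e1 : (inner ℝ (arcDeriv γ (arcDeriv γ γ) s) (γ s) : ℝ) = -1 := by
    have := (hT.inner ℝ (hγ.hasDerivAt s)).unique
      ((hasDerivAt_const s (0 : ℝ)).congr_of_eventuallyEq (Filter.Eventually.of_forall fun t =>
        hγ.inner_tangent_self t))
    rw [hγ.inner_tangent_deriv, real_inner_smul_left] at this
    refine mul_left_cancel₀ hr ?_
    linarith
  have e2 : (inner ℝ (arcDeriv γ (arcDeriv γ γ) s) (arcDeriv γ γ s) : ℝ) = 0 := by
    have := (hT.inner ℝ hT).unique
      ((hasDerivAt_const s (1 : ℝ)).congr_of_eventuallyEq (Filter.Eventually.of_forall fun t =>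
        hγ.inner_tangent_tangent t))
    rw [real_inner_comm, ← two_mul, mul_eq_zero, or_iff_right two_ne_zero, real_inner_smul_left,
      mul_eq_zero, or_iff_right hr] at this
    exact this
  have e3 : (arcDeriv γ (arcDeriv γ γ) s).imI = 0 := by
    have := (hasDerivAt_inner_const hT qi).unique
      ((hasDerivAt_const s (0 : ℝ)).congr_of_eventuallyEq (Filter.Eventually.of_forall fun t => by
        simp only [inner_qi, hγ.imI_tangent]))
    rw [real_inner_smul_left, mul_eq_zero, or_iff_right hr, inner_qi] at this
    exact this
  rw [hγ.expansion hν s (arcDeriv γ (arcDeriv γ γ) s), e1, e2, e3, ← curvatureVector_inner hν]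
  module

lemma arcDeriv_normal (s : ℝ) :
    arcDeriv γ ν s = -(signedCurvature γ ν s • arcDeriv γ γ s) := by
  have hT := hγ.hasDerivAt_of_contDiff hγ.contDiff_tangent s
  have hN := hγ.hasDerivAt_of_contDiff hν.smooth s
  have hr := (hγ.speed_pos s).ne'
  have e1 : (inner ℝ (arcDeriv γ ν s) (γ s) : ℝ) = 0 := by
    have := (hN.inner ℝ (hγ.hasDerivAt s)).unique
      ((hasDerivAt_const s (0 : ℝ)).congr_of_eventuallyEq (Filter.Eventually.of_forall fun t =>
        hν.tangent_sphere t))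
    rw [hν.normal, zero_add, real_inner_smul_left, mul_eq_zero, or_iff_right hr] at this
    exact this
  have e2 : (inner ℝ (arcDeriv γ ν s) (arcDeriv γ γ s) : ℝ) = -signedCurvature γ ν s := by
    have := (hN.inner ℝ hT).unique
      ((hasDerivAt_const s (0 : ℝ)).congr_of_eventuallyEq (Filter.Eventually.of_forall fun t =>
        inner_normal_tangent hν t))
    rw [real_inner_smul_left, real_inner_smul_right, ← mul_add, mul_eq_zero, or_iff_right hr,
      real_inner_comm, ← curvatureVector_inner hν] at this
    linarith
  have e3 : (arcDeriv γ ν s).imI = 0 := by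
    have := (hasDerivAt_inner_const hN qi).unique
      ((hasDerivAt_const s (0 : ℝ)).congr_of_eventuallyEq (Filter.Eventually.of_forall fun t => by
        simp only [inner_qi, hν.imI_eq_zero]))
    rw [real_inner_smul_left, mul_eq_zero, or_iff_right hr, inner_qi] at this
    exact this
  have e4 : (inner ℝ (arcDeriv γ ν s) (ν s) : ℝ) = 0 := by
    have := (hN.inner ℝ hN).unique
      ((hasDerivAt_const s (1 : ℝ)).congr_of_eventuallyEq (Filter.Eventually.of_forall fun t =>
        inner_normal_normal hν t))
    rw [real_inner_comm, ← two_mul, mul_eq_zero, or_iff_right two_ne_zero, real_inner_smul_left,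
      mul_eq_zero, or_iff_right hr] at this
    exact this
  rw [hγ.expansion hν s (arcDeriv γ ν s), e1, e2, e3, e4]
  module

lemma curvatureVector_eq (s : ℝ) : curvatureVector γ s = signedCurvature γ ν s • ν s := by
  rw [curvatureVector, covDerivCurve, hγ.arcDeriv_tangent hν, inner_sub_left,
    real_inner_smul_left, hν.tangent_sphere, hγ.inner_self]
  module

lemma norm_curvatureVector_sq (s : ℝ) :
    ‖curvatureVector γ s‖ ^ 2 = signedCurvature γ ν s ^ 2 := by
  rw [hγ.curvatureVector_eq hν, norm_smul, hν.norm_eq_one, mul_one, Real.norm_eq_abs, sq_abs]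

/-- By the Frenet equation ν' = -κγ', the quaternion conj(γ')ν' is the real number -κ|γ'|². -/
lemma curvatureVector_formula (s : ℝ) : curvatureVector γ s =
    -((‖deriv γ s‖ ^ 2)⁻¹ • ((star (deriv γ s) * deriv ν s) * ν s)) := by
  have hr := (hγ.speed_pos s).ne'
  have h1 := hγ.deriv_eq_smul_arcDeriv ν s
  have h2 := hγ.deriv_eq_smul_arcDeriv γ s
  set r := ‖deriv γ s‖ with hrdef
  rw [h1, h2, hγ.curvatureVector_eq hν, hγ.arcDeriv_normal hν, Quaternion.star_smul, smul_neg,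
    mul_neg, neg_mul, smul_neg, neg_neg, smul_mul_smul_comm, mul_smul_comm,
    star_mul_of_norm_eq_one (hγ.norm_tangent s), smul_mul_assoc, smul_smul, smul_mul_assoc,
    one_mul, smul_smul]
  congr 1
  field_simp

lemma normalCovDerivCurve_smul {c : ℝ → ℝ} (hc : ContDiff ℝ ∞ c) (s : ℝ) :
    normalCovDerivCurve γ (fun t => c t • ν t) s = arcDeriv γ c s • ν s := by
  have h1 : arcDeriv γ (fun t => c t • ν t) s =
      arcDeriv γ c s • ν s - (c s * signedCurvature γ ν s) • arcDeriv γ γ s := by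
    have hd := (hγ.hasDerivAt_of_contDiff hc s).fun_smul (hγ.hasDerivAt_of_contDiff hν.smooth s)
    rw [arcDeriv, hd.deriv, hγ.arcDeriv_normal hν, smul_comm (c s), smul_assoc, ← smul_add,
      smul_smul, inv_mul_cancel₀ (hγ.speed_pos s).ne']
    module
  have h2 : covDerivCurve γ (fun t => c t • ν t) s =
      arcDeriv γ c s • ν s - (c s * signedCurvature γ ν s) • arcDeriv γ γ s := by
    rw [covDerivCurve, h1, inner_sub_left, real_inner_smul_left, real_inner_smul_left,
      hν.tangent_sphere, hγ.inner_tangent_self]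
    module
  rw [normalCovDerivCurve, h2, inner_sub_left, real_inner_smul_left, real_inner_smul_left,
    inner_normal_tangent hν, hγ.inner_tangent_tangent]
  module

/-- A normal field is a function times ν, and ν is parallel in the normal bundle, so the normal
derivatives fall on the curvature alone. -/
lemma elasticGradient_eq (s : ℝ) : elasticGradient γ s =
    (2 * (arcDeriv γ)^[2] (signedCurvature γ ν) s + signedCurvature γ ν s ^ 3
      + signedCurvature γ ν s) • ν s := by
  have hκ := hγ.contDiff_signedCurvature hν
  rw [elasticGradient, hγ.norm_curvatureVector_sq hν, funext (hγ.curvatureVector_eq hν),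
    funext (hγ.normalCovDerivCurve_smul hν hκ),
    hγ.normalCovDerivCurve_smul hν (hγ.contDiff_arcDeriv hκ)]
  simp only [Function.iterate_succ, Function.iterate_zero, Function.comp, id]
  module

lemma contDiff_iterate_arcDeriv (n : ℕ) :
    ContDiff ℝ ∞ ((arcDeriv γ)^[n] (signedCurvature γ ν)) := by
  induction n with
  | zero => exact hγ.contDiff_signedCurvature hν
  | succ n ih => rw [Function.iterate_succ_apply']; exact hγ.contDiff_arcDeriv ih

/-- The sign `σ` with `σ i γ̄ T = ν`. -/
lemma exists_sign : ∃ σ : ℝ, (σ = 1 ∨ σ = -1) ∧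
    ∀ s, σ • (qi * star (γ s) * arcDeriv γ γ s) = ν s := by
  -- The product iγ̄T is orthogonal to γ, T and i, hence equals c ν with c² = 1. By continuity on
  -- the connected line, c has a constant sign.
  set c : ℝ → ℝ := fun s => inner ℝ (qi * star (γ s) * arcDeriv γ γ s) (ν s) with hc
  have hexp (s : ℝ) : qi * star (γ s) * arcDeriv γ γ s = c s • ν s := by
    have hT := hγ.inner_tangent_self s
    have i1 := hγ.imI_eq_zero s
    have i2 := hγ.imI_tangent s
    have e1 : (inner ℝ (qi * star (γ s) * arcDeriv γ γ s) (γ s) : ℝ) = 0 := by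
      simp only [inner_eq, Quaternion.re_mul, Quaternion.imI_mul, Quaternion.imJ_mul,
        Quaternion.imK_mul, Quaternion.re_star, Quaternion.imI_star, Quaternion.imJ_star,
        Quaternion.imK_star, qi_re, qi_imI, qi_imJ, qi_imK, i1, i2]
      ring
    have e2 : (inner ℝ (qi * star (γ s) * arcDeriv γ γ s) (arcDeriv γ γ s) : ℝ) = 0 := by
      simp only [inner_eq, Quaternion.re_mul, Quaternion.imI_mul, Quaternion.imJ_mul,
        Quaternion.imK_mul, Quaternion.re_star, Quaternion.imI_star, Quaternion.imJ_star,
        Quaternion.imK_star, qi_re, qi_imI, qi_imJ, qi_imK, i1, i2]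
      ring
    have e3 : (qi * star (γ s) * arcDeriv γ γ s).imI = 0 := by
      rw [inner_eq, i1, i2] at hT
      simp [i1, i2]
      linarith
    rw [hγ.expansion hν s (qi * star (γ s) * arcDeriv γ γ s), e1, e2, e3]
    simp [hc]
  have hsq (s : ℝ) : c s ^ 2 = 1 := by
    have := congrArg norm (hexp s)
    rw [norm_mul, norm_mul, norm_star, norm_qi, hγ.norm_eq_one, hγ.norm_tangent, norm_smul,
      hν.norm_eq_one, Real.norm_eq_abs] at this
    rw [← sq_abs, ← mul_one |c s|, ← this]; norm_num
  have hcont : Continuous c := by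
    refine Continuous.inner ((continuous_const.mul ?_).mul hγ.contDiff_tangent.continuous)
      hν.smooth.continuous
    exact continuous_star.comp hγ.smooth.continuous
  have key : (∀ s, c s = 1) ∨ ∀ s, c s = -1 := by
    have := isPreconnected_univ.eq_one_or_eq_neg_one_of_sq_eq hcont.continuousOn
      (fun s _ => hsq s)
    rcases this with h | h
    · exact .inl fun s => h (Set.mem_univ s)
    · exact .inr fun s => h (Set.mem_univ s)
  rcases key with h | h
  · exact ⟨1, .inl rfl, fun s => by rw [hexp, h]; simp⟩
  · exact ⟨-1, .inr rfl, fun s => by rw [hexp, h]; simp⟩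

end Normal

/-- A unit normal field along `γ`. -/
lemma isUnitNormalAlongCurve :
    IsUnitNormalAlongCurve γ (fun s => qi * star (γ s) * arcDeriv γ γ s) where
  smooth := (contDiff_const.mul (starL.contDiff.comp hγ.smooth)).mul
    hγ.contDiff_tangent
  norm_eq_one s := by
    rw [norm_mul, norm_mul, norm_star, norm_qi, hγ.norm_eq_one, hγ.norm_tangent]; norm_num
  imI_eq_zero s := by
    have hT := hγ.inner_tangent_self s
    rw [inner_eq, hγ.imI_eq_zero s, hγ.imI_tangent s] at hT
    simp [hγ.imI_eq_zero s, hγ.imI_tangent s]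
    linarith
  tangent_sphere s := by
    simp only [inner_eq, Quaternion.re_mul, Quaternion.imI_mul, Quaternion.imJ_mul,
      Quaternion.imK_mul, Quaternion.re_star, Quaternion.imI_star, Quaternion.imJ_star,
      Quaternion.imK_star, qi_re, qi_imI, qi_imJ, qi_imK, hγ.imI_eq_zero s, hγ.imI_tangent s]
    ring
  normal s := by
    rw [hγ.deriv_eq_smul_arcDeriv, real_inner_smul_right]
    simp only [inner_eq, Quaternion.re_mul, Quaternion.imI_mul, Quaternion.imJ_mul,
      Quaternion.imK_mul, Quaternion.re_star, Quaternion.imI_star, Quaternion.imJ_star,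
      Quaternion.imK_star, qi_re, qi_imI, qi_imJ, qi_imK, hγ.imI_eq_zero s, hγ.imI_tangent s]
    ring

end IsSimpleClosedCurve

/-! ### Closed lifts of the curve to the 3-sphere. -/

lemma tilde_star_tilde (w : ℍ[ℝ]) : tilde (star (tilde w)) = star w := by
  ext <;> simp

lemma hopf_smul (c : ℝ) (q : ℍ[ℝ]) : hopf (c • q) = (c ^ 2) • hopf q := by
  have : tilde (c • q) = c • tilde q := tildeL.map_smul c q
  rw [hopf, hopf, this, smul_mul_smul_comm, pow_two]

lemma norm_hopf_eq (q : ℍ[ℝ]) : ‖hopf q‖ = ‖q‖ ^ 2 := by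
  rw [hopf, norm_mul, norm_tilde, pow_two]

lemma tilde_add (x y : ℍ[ℝ]) : tilde (x + y) = tilde x + tilde y := tildeL.map_add x y

/-- A multiple of the section `y ↦ w + conj(w̃) y` of the Hopf fibration over the complement of
`-π(w)`. -/
lemma hopf_section {w y : ℍ[ℝ]} (hw : ‖w‖ = 1) (hy : ‖y‖ = 1) (hyI : y.imI = 0) :
    hopf (w + star (tilde w) * y) = (2 * (1 + inner ℝ y (hopf w)) : ℝ) • y := by
  have h1 : tilde (w + star (tilde w) * y) = tilde w + y * star w := by
    rw [tilde_add, tilde_mul, tilde_star_tilde, tilde_eq_self hyI]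
  have h2 : tilde w * star (tilde w) = 1 := mul_star_of_norm_eq_one (by rw [norm_tilde, hw])
  have h3 : star w * w = 1 := star_mul_of_norm_eq_one hw
  have h4 := mul_star_mul y (hopf w)
  rw [hy, one_pow, one_smul] at h4
  calc hopf (w + star (tilde w) * y)
      = hopf w + (tilde w * star (tilde w)) * y + y * (star w * w) + y * star (hopf w) * y := by
        rw [hopf, h1, hopf, star_mul]
        simp only [mul_add, add_mul, mul_assoc]
        abel
    _ = _ := by
        rw [h2, h3, h4, one_mul, mul_one]
        module

/-- The vector `a + b j + c k`. -/
def vecS (a b c : ℝ) : ℍ[ℝ] := ⟨a, 0, b, c⟩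

@[simp] lemma vecS_re (a b c : ℝ) : (vecS a b c).re = a := rfl
@[simp] lemma vecS_imI (a b c : ℝ) : (vecS a b c).imI = 0 := rfl
@[simp] lemma vecS_imJ (a b c : ℝ) : (vecS a b c).imJ = b := rfl
@[simp] lemma vecS_imK (a b c : ℝ) : (vecS a b c).imK = c := rfl

namespace IsSimpleClosedCurve

variable {γ : ℝ → ℍ[ℝ]} {L : ℝ} (hγ : IsSimpleClosedCurve γ L)

include hγ

/-- The closed curve omits the antipode of a point of the 2-sphere. -/
lemma exists_inner_hopf_ne : ∃ w : ℍ[ℝ], ‖w‖ = 1 ∧ ∀ s, (inner ℝ (γ s) (hopf w) : ℝ) ≠ -1 := by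
  -- The C¹ map (r, s) ↦ rγ(s) from the plane to the 3-space span{1, j, k} has a range with dense
  -- complement. A point outside the range lies on no line through 0 and the curve, and so does its
  -- negative, which allows a nonnegative real part.
  obtain ⟨x, hxI, hxre, hx⟩ : ∃ x : ℍ[ℝ], x.imI = 0 ∧ 0 ≤ x.re ∧ ∀ (r s : ℝ), x ≠ r • γ s := by
    have hγ1 : ContDiff ℝ 1 fun v : ℝ × ℝ => γ v.2 :=
      (hγ.smooth.of_le (by simp)).comp contDiff_snd
    have hcoord (c : ℍ[ℝ]) : ContDiff ℝ 1 fun v : ℝ × ℝ => v.1 * (inner ℝ (γ v.2) c : ℝ) :=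
      contDiff_fst.mul (hγ1.inner ℝ contDiff_const)
    obtain ⟨c, hc⟩ := (((hcoord (vecS 1 0 0)).prodMk ((hcoord (vecS 0 1 0)).prodMk
      (hcoord (vecS 0 0 1)))).dense_compl_range_of_finrank_lt_finrank (by simp)).nonempty
    have hc' (r s : ℝ) : vecS c.1 c.2.1 c.2.2 ≠ r • γ s := fun h => hc ⟨(r, s), by
      have h1 := congrArg (fun x : ℍ[ℝ] => x.re) h
      have h2 := congrArg (fun x : ℍ[ℝ] => x.imJ) h
      have h3 := congrArg (fun x : ℍ[ℝ] => x.imK) h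
      simp only [vecS_re, vecS_imJ, vecS_imK, Quaternion.re_smul, Quaternion.imJ_smul,
        Quaternion.imK_smul, smul_eq_mul] at h1 h2 h3
      simp [inner_eq, Prod.ext_iff, h1, h2, h3]⟩
    rcases le_total 0 c.1 with h0 | h0
    · exact ⟨vecS c.1 c.2.1 c.2.2, rfl, h0, hc'⟩
    · refine ⟨-vecS c.1 c.2.1 c.2.2, by simp, by simpa using h0, fun r s h => hc' (-r) s ?_⟩
      rw [neg_smul, ← h, neg_neg]
  have hx0 : x ≠ 0 := fun h => hx 0 0 (by rw [h, zero_smul])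
  have hm := norm_pos_iff.2 hx0
  -- On span{1, j, k} the Hopf map is squaring, and (|x| + x)² = 2(|x| + Re x)x, so `w₀` is a square
  -- root of x up to a positive factor. The condition Re x ≥ 0 keeps it away from 0.
  set w₀ : ℍ[ℝ] := ‖x‖ • 1 + x with hw₀
  have hw₀re : 0 < w₀.re := by simp [hw₀]; linarith
  have hw₀n : 0 < ‖w₀‖ := norm_pos_iff.2 fun h => by simp [h] at hw₀re
  have hxx : x * x = (2 * x.re) • x - (‖x‖ ^ 2) • 1 := by
    rw [pow_two, ← Quaternion.normSq_eq_norm_mul_self, Quaternion.normSq_def']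
    ext <;> simp <;> ring
  have hhopf₀ : hopf w₀ = (2 * (‖x‖ + x.re)) • x := by
    rw [hopf, tilde_eq_self (by simp [hw₀, hxI]), hw₀]
    simp only [mul_add, add_mul, smul_mul_assoc, mul_smul_comm, one_mul, mul_one, hxx]
    module
  refine ⟨‖w₀‖⁻¹ • w₀, by rw [norm_smul, norm_inv, norm_norm, inv_mul_cancel₀ hw₀n.ne'],
    fun s h => ?_⟩
  have hn : ‖hopf (‖w₀‖⁻¹ • w₀)‖ = 1 := by
    rw [norm_hopf_eq, norm_smul, norm_inv, norm_norm, inv_mul_cancel₀ hw₀n.ne', one_pow]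
  rw [inner_eq_neg_one_iff_of_norm_eq_one (hγ.norm_eq_one s) hn, hopf_smul, hhopf₀, smul_smul] at h
  set lam := (‖w₀‖⁻¹ ^ 2 * (2 * (‖x‖ + x.re))) with hlam
  have hpos : lam ≠ 0 := by positivity
  refine hx (-lam⁻¹) s ?_
  rw [h, smul_neg, neg_smul, neg_neg, smul_smul, inv_mul_cancel₀ hpos, one_smul]

/-- A smooth closed curve has a smooth closed lift to the 3-sphere. -/
lemma exists_closed_lift : ∃ q : ℝ → ℍ[ℝ], ContDiff ℝ ∞ q ∧ Function.Periodic q L ∧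
    (∀ s, ‖q s‖ = 1) ∧ ∀ s, hopf (q s) = γ s := by
  obtain ⟨w, hw, hne⟩ := hγ.exists_inner_hopf_ne
  -- The curve avoids -π(w), so one section of the Hopf fibration covers all of it; the lift is a
  -- function of γ(s) and inherits the period.
  set p : ℝ → ℍ[ℝ] := fun s => w + star (tilde w) * γ s with hp
  have hhopf (s : ℝ) : hopf (p s) = (2 * (1 + inner ℝ (γ s) (hopf w)) : ℝ) • γ s :=
    hopf_section hw (hγ.norm_eq_one s) (hγ.imI_eq_zero s)
  have hpos (s : ℝ) : 0 < 2 * (1 + inner ℝ (γ s) (hopf w) : ℝ) := by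
    have h1 := neg_le_of_abs_le (abs_real_inner_le_norm (γ s) (hopf w))
    rw [hγ.norm_eq_one, norm_hopf hw, mul_one] at h1
    have := lt_of_le_of_ne h1 (hne s).symm
    linarith
  have hn (s : ℝ) : ‖p s‖ ^ 2 = 2 * (1 + inner ℝ (γ s) (hopf w) : ℝ) := by
    rw [← norm_hopf_eq, hhopf, norm_smul, hγ.norm_eq_one, mul_one, Real.norm_eq_abs,
      abs_of_pos (hpos s)]
  have hp0 (s : ℝ) : p s ≠ 0 := fun h => by
    have := hpos s
    rw [← hn, h] at this
    simp at this
  have hps : ContDiff ℝ ∞ p := contDiff_const.add (contDiff_const.mul hγ.smooth)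
  refine ⟨fun s => ‖p s‖⁻¹ • p s, ?_, fun s => ?_, fun s => ?_, fun s => ?_⟩
  · exact ((hps.norm ℝ hp0).inv fun s => norm_ne_zero_iff.2 (hp0 s)).smul hps
  · simp only [hp, hγ.periodic s]
  · rw [norm_smul, norm_inv, norm_norm, inv_mul_cancel₀ (norm_ne_zero_iff.2 (hp0 s))]
  · rw [hopf_smul, hhopf, ← hn, smul_smul, ← mul_pow,
      inv_mul_cancel₀ (norm_ne_zero_iff.2 (hp0 s)), one_pow, one_smul]

lemma apply_eq_iff (s s' : ℝ) : γ s = γ s' ↔ ∃ n : ℤ, s' = s + n * L := by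
  constructor
  · intro h
    have hmod (t : ℝ) : γ (toIcoMod hγ.pos 0 t) = γ t := by
      rw [toIcoMod, hγ.periodic.sub_zsmul_eq]
    have hmem (t : ℝ) : toIcoMod hγ.pos 0 t ∈ Set.Ico 0 L := by
      simpa using toIcoMod_mem_Ico hγ.pos 0 t
    have := hγ.one_loop (hmem s) (hmem s') (by rw [hmod, hmod, h])
    rw [toIcoMod, toIcoMod] at this
    refine ⟨toIcoDiv hγ.pos 0 s' - toIcoDiv hγ.pos 0 s, ?_⟩
    simp only [zsmul_eq_mul] at this
    push_cast
    linarith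
  · rintro ⟨n, rfl⟩
    rw [← zsmul_eq_mul, hγ.periodic.zsmul n s]

section Transport

variable {ν : ℝ → ℍ[ℝ]} (hν : IsUnitNormalAlongCurve γ ν) {p : ℍ[ℝ]} (hp : ‖p‖ = 1) {s : ℝ}
  (hps : hopf p = γ s)

include hν hp hps

lemma orthonormal_transport : Orthonormal ℝ
    ![p, transport p * arcDeriv γ γ s, qi * p, transport p * ν s] := by
  have h := hγ.orthonormal_frame hν s
  rw [orthonormal_iff_ite] at h ⊢
  have e : ![p, transport p * arcDeriv γ γ s, qi * p, transport p * ν s] =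
      fun i => transport p * ![γ s, arcDeriv γ γ s, qi, ν s] i := by
    funext i
    fin_cases i
    · simp [← hps, transport_mul_hopf hp]
    · rfl
    · simp [transport_mul_qi hp]
    · rfl
  intro i j
  rw [e]
  simp only [inner_mul_left_of_norm_eq_one (norm_transport hp)]
  exact h i j

lemma expansion_transport (w : ℍ[ℝ]) : w = (inner ℝ w p : ℝ) • p
    + (inner ℝ w (transport p * arcDeriv γ γ s) : ℝ) • (transport p * arcDeriv γ γ s)
    + (inner ℝ w (qi * p) : ℝ) • (qi * p)
    + (inner ℝ w (transport p * ν s) : ℝ) • (transport p * ν s) := by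
  have := orthonormal_expansion (hγ.orthonormal_transport hν hp hps) w
  simp only [Fin.sum_univ_four, Matrix.cons_val_zero, Matrix.cons_val_one, Matrix.cons_val] at this
  rw [real_inner_comm p w, real_inner_comm (transport p * arcDeriv γ γ s) w,
    real_inner_comm (qi * p) w, real_inner_comm (transport p * ν s) w]
  exact this

/-- A tangent vector of the 3-sphere over a multiple of the velocity of `γ` is the sum of a
horizontal and a vertical vector. -/
lemma eq_of_dHopf_eq {w : ℍ[ℝ]} (hw : (inner ℝ w p : ℝ) = 0) {c : ℝ}
    (h : dHopf p w = c • arcDeriv γ γ s) :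
    w = (c / 2) • (transport p * arcDeriv γ γ s) + (inner ℝ w (qi * p) : ℝ) • (qi * p) := by
  have h1 := inner_dHopf hp w (hγ.imI_tangent s)
  have h2 := inner_dHopf hp w (hν.imI_eq_zero s)
  rw [h, real_inner_smul_left, hγ.inner_tangent_tangent, mul_one] at h1
  rw [h, real_inner_smul_left, real_inner_comm, inner_normal_tangent hν, mul_zero] at h2
  have h3 : (inner ℝ w (transport p * arcDeriv γ γ s) : ℝ) = c / 2 := by linarith
  have h4 : (inner ℝ w (transport p * ν s) : ℝ) = 0 := by linarith
  have := hγ.expansion_transport hν hp hps w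
  rw [hw, h3, h4] at this
  rw [zero_smul, zero_smul, zero_add, add_zero] at this
  exact this

end Transport

end IsSimpleClosedCurve

/-! ### The parametrized Hopf torus and its structure equations. -/

/-- `q` is a smooth closed lift of the curve `γ` to the 3-sphere. -/
structure IsClosedLift (γ q : ℝ → ℍ[ℝ]) (L : ℝ) : Prop where
  contDiff : ContDiff ℝ ∞ q
  periodic : Function.Periodic q L
  norm_eq_one : ∀ s, ‖q s‖ = 1
  hopf_eq : ∀ s, hopf (q s) = γ s

/-- The parametrization `(s, t) ↦ e^{it} q(s)` of the Hopf torus. -/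
def hopfTorus (q : ℝ → ℍ[ℝ]) (v : ℝ × ℝ) : ℍ[ℝ] := expI v.2 * q v.1

/-- The vertical speed `⟨q', iq⟩` of a curve in the 3-sphere. -/
def fibreSpeed (q : ℝ → ℍ[ℝ]) (s : ℝ) : ℝ := inner ℝ (deriv q s) (qi * q s)

/-- The horizontal vector field over the unit field `X` along `γ`. -/
def horizontal (γ q X : ℝ → ℍ[ℝ]) (v : ℝ × ℝ) : ℍ[ℝ] :=
  hopfTorus q v * (star (γ v.1) * X v.1)

/-- The coframe field dual to the horizontal lift of the unit tangent. -/
def horizontalForm (γ : ℝ → ℍ[ℝ]) (v : ℝ × ℝ) : ℝ × ℝ →L[ℝ] ℝ :=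
  (‖deriv γ v.1‖ / 2) • ContinuousLinearMap.fst ℝ ℝ ℝ

/-- The coframe field dual to the vertical unit field. -/
def verticalForm (q : ℝ → ℍ[ℝ]) (v : ℝ × ℝ) : ℝ × ℝ →L[ℝ] ℝ :=
  fibreSpeed q v.1 • ContinuousLinearMap.fst ℝ ℝ ℝ + ContinuousLinearMap.snd ℝ ℝ ℝ

lemma horizontalForm_apply (γ : ℝ → ℍ[ℝ]) (v w : ℝ × ℝ) :
    horizontalForm γ v w = ‖deriv γ v.1‖ / 2 * w.1 := by simp [horizontalForm]

lemma verticalForm_apply (q : ℝ → ℍ[ℝ]) (v w : ℝ × ℝ) :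
    verticalForm q v w = fibreSpeed q v.1 * w.1 + w.2 := by simp [verticalForm]

section Products

variable {x y : ℍ[ℝ]}

lemma mul_star_eq_neg (h : (inner ℝ x y : ℝ) = 0) : x * star y = -(y * star x) := by
  have h' := h
  rw [inner_eq] at h'
  ext <;> simp <;> linarith

lemma star_mul_mul_star_mul_self (hx : ‖x‖ = 1) (hy : ‖y‖ = 1) (h : (inner ℝ x y : ℝ) = 0) :
    star y * x * (star y * x) = -1 := by
  calc star y * x * (star y * x) = star y * (x * star y * x) := by simp only [mul_assoc]
    _ = -1 := by
      rw [mul_star_mul, h, hx]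
      simp [star_mul_of_norm_eq_one hy]

end Products

namespace IsClosedLift

variable {γ q : ℝ → ℍ[ℝ]} {L : ℝ} (hq : IsClosedLift γ q L)

include hq

lemma contDiff_hopfTorus : ContDiff ℝ ∞ (hopfTorus q) :=
  (contDiff_expI.comp contDiff_snd).mul (hq.contDiff.comp contDiff_fst)

lemma norm_hopfTorus (v : ℝ × ℝ) : ‖hopfTorus q v‖ = 1 := by
  rw [hopfTorus, norm_mul, norm_expI, hq.norm_eq_one, one_mul]

lemma hopf_hopfTorus (v : ℝ × ℝ) : hopf (hopfTorus q v) = γ v.1 := by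
  rw [hopfTorus, hopf_expI_mul, hq.hopf_eq]

lemma transport_mul_eq (X : ℝ → ℍ[ℝ]) (v : ℝ × ℝ) :
    transport (hopfTorus q v) * X v.1 = horizontal γ q X v := by
  rw [transport, hq.hopf_hopfTorus, horizontal, mul_assoc]

variable (hγ : IsSimpleClosedCurve γ L)

include hγ

lemma hopfTorus_eq_iff (v w : ℝ × ℝ) : hopfTorus q v = hopfTorus q w ↔
    ∃ m n : ℤ, w = (v.1 + m * L, v.2 + n * (2 * Real.pi)) := by
  have hper (s : ℝ) (m : ℤ) : q (s + m * L) = q s := by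
    rw [← zsmul_eq_mul]; exact hq.periodic.zsmul m s
  constructor
  · intro h
    obtain ⟨m, hm⟩ := (hγ.apply_eq_iff v.1 w.1).1 (by
      rw [← hq.hopf_hopfTorus, h, hq.hopf_hopfTorus])
    rw [hopfTorus, hopfTorus, hm, hper] at h
    have hq0 : q v.1 ≠ 0 := norm_ne_zero_iff.1 (by rw [hq.norm_eq_one]; exact one_ne_zero)
    obtain ⟨n, hn⟩ := (expI_injective_iff v.2 w.2).1 (mul_right_cancel₀ hq0 h)
    exact ⟨m, n, Prod.ext hm hn⟩
  · rintro ⟨m, n, rfl⟩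
    rw [hopfTorus, hopfTorus, hper, (expI_injective_iff v.2 _).2 ⟨n, rfl⟩]

omit hγ in
lemma range_hopfTorus : Set.range (hopfTorus q) = hopfPreimage (Set.range γ) := by
  ext p
  constructor
  · rintro ⟨v, rfl⟩
    exact ⟨hq.norm_hopfTorus v, v.1, (hq.hopf_hopfTorus v).symm⟩
  · rintro ⟨hp, s, hs⟩
    obtain ⟨t, ht⟩ := exists_expI_mul_eq hp (hq.norm_eq_one s) (by rw [hq.hopf_eq, hs])
    exact ⟨(s, t), ht.symm⟩

/-- The projection of q' is γ', and the Hopf differential doubles horizontal lengths, so the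
horizontal part has half the speed of γ. -/
lemma deriv_eq (s : ℝ) : deriv q s =
    (‖deriv γ s‖ / 2) • (q s * (star (γ s) * arcDeriv γ γ s)) + fibreSpeed q s • (qi * q s) := by
  have hd : HasDerivAt q (deriv q s) s :=
    (hq.contDiff.differentiable (by simp)).differentiableAt.hasDerivAt
  have h1 : dHopf (q s) (deriv q s) = ‖deriv γ s‖ • arcDeriv γ γ s := by
    rw [← hγ.deriv_eq_smul_arcDeriv, dHopf, (hasFDerivAt_hopf (q s)).fderiv]
    refine ((hasFDerivAt_hopf (q s)).comp_hasDerivAt s hd).unique ?_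
    exact (hγ.hasDerivAt s).congr_of_eventuallyEq (Filter.Eventually.of_forall hq.hopf_eq)
  have h2 : (inner ℝ (deriv q s) (q s) : ℝ) = 0 := by
    have := (hd.inner ℝ hd).unique
      ((hasDerivAt_const s (1 : ℝ)).congr_of_eventuallyEq (Filter.Eventually.of_forall fun t => by
        change (inner ℝ (q t) (q t) : ℝ) = 1
        rw [real_inner_self_eq_norm_sq, hq.norm_eq_one, one_pow]))
    rw [real_inner_comm] at this
    linarith
  have := hγ.eq_of_dHopf_eq hγ.isUnitNormalAlongCurve (hq.norm_eq_one s) (hq.hopf_eq s) h2 h1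
  rwa [transport, hq.hopf_eq, mul_assoc] at this

lemma hasFDerivAt_hopfTorus (v : ℝ × ℝ) : HasFDerivAt (hopfTorus q)
    ((horizontalForm γ v).smulRight (horizontal γ q (arcDeriv γ γ) v)
      + (verticalForm q v).smulRight (qi * hopfTorus q v)) v := by
  have hd : HasDerivAt q (deriv q v.1) v.1 :=
    (hq.contDiff.differentiable (by simp)).differentiableAt.hasDerivAt
  have h1 := (hasDerivAt_expI v.2).hasFDerivAt.comp v (hasFDerivAt_snd (𝕜 := ℝ) (p := v))
  have h2 := hd.hasFDerivAt.comp v (hasFDerivAt_fst (𝕜 := ℝ) (p := v))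
  refine (h1.mul' h2).congr_fderiv (ContinuousLinearMap.ext fun w => ?_)
  have e : expI v.2 * (qi * q v.1) = qi * (expI v.2 * q v.1) := by
    rw [← mul_assoc, ← qi_mul_expI, mul_assoc]
  simp only [add_apply, ContinuousLinearMap.smulRight_apply, horizontalForm_apply,
    verticalForm_apply, horizontal, hopfTorus, smul_apply, ContinuousLinearMap.comp_apply,
    ContinuousLinearMap.coe_fst', ContinuousLinearMap.coe_snd', Function.comp_apply, smul_eq_mul,
    MulOpposite.smul_eq_mul_unop, MulOpposite.unop_op, hq.deriv_eq hγ v.1,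
    ContinuousLinearMap.toSpanSingleton_apply, smul_add, mul_add, mul_smul_comm, smul_mul_assoc, e,
    mul_assoc]
  module

/-- The factor 2 in front of `m'` arises because |γ'| ds is twice `horizontalForm`. It is applied
with `m` equal to γ̄T and γ̄ν to differentiate `E` and `N`. -/
lemma hasFDerivAt_hopfTorus_mul {m : ℝ → ℍ[ℝ]} {m' : ℍ[ℝ]} {v : ℝ × ℝ}
    (hm : HasDerivAt m (‖deriv γ v.1‖ • m') v.1) :
    HasFDerivAt (fun w => hopfTorus q w * m w.1)
      ((horizontalForm γ v).smulRight
          (horizontal γ q (arcDeriv γ γ) v * m v.1 + (2 : ℝ) • (hopfTorus q v * m'))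
        + (verticalForm q v).smulRight (qi * hopfTorus q v * m v.1)) v := by
  have h2 := hm.hasFDerivAt.comp v (hasFDerivAt_fst (𝕜 := ℝ) (p := v))
  refine ((hq.hasFDerivAt_hopfTorus hγ v).mul' h2).congr_fderiv (ContinuousLinearMap.ext fun w => ?_)
  simp only [add_apply, ContinuousLinearMap.smulRight_apply, horizontalForm_apply,
    verticalForm_apply, smul_apply, ContinuousLinearMap.comp_apply,
    ContinuousLinearMap.coe_fst', Function.comp_apply, smul_eq_mul,
    MulOpposite.smul_eq_mul_unop, MulOpposite.unop_op,
    ContinuousLinearMap.toSpanSingleton_apply, smul_add, mul_smul_comm,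
    smul_mul_assoc]
  module

variable {ν : ℝ → ℍ[ℝ]} (hν : IsUnitNormalAlongCurve γ ν)

include hν

lemma orthonormal_frame {σ : ℝ} (hσ : σ = 1 ∨ σ = -1) (v : ℝ × ℝ) : Orthonormal ℝ
    ![hopfTorus q v, horizontal γ q (arcDeriv γ γ) v, σ • (qi * hopfTorus q v),
      horizontal γ q ν v] := by
  have h := hγ.orthonormal_transport hν (hq.norm_hopfTorus v) (hq.hopf_hopfTorus v)
  rw [hq.transport_mul_eq, hq.transport_mul_eq] at h
  rcases hσ with rfl | rfl
  · rwa [one_smul]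
  · rw [neg_one_smul]
    constructor
    · intro i
      have := h.1 i
      fin_cases i <;> simpa using this
    · intro i j hij
      have := h.2 hij
      fin_cases i <;> fin_cases j <;> simp at hij ⊢ <;> simpa using this

variable {σ : ℝ} (hσ : σ = 1 ∨ σ = -1)
  (hsign : ∀ s, σ • (qi * star (γ s) * arcDeriv γ γ s) = ν s)

include hσ hsign

-- With P the point of the torus, iP = Pγ̄i, so iE = Pγ̄(iγ̄T). This is where the orientation σ of
-- the fibres is tied to ν.
omit hν hγ in
lemma qi_mul_horizontal_tangent (v : ℝ × ℝ) :
    qi * horizontal γ q (arcDeriv γ γ) v = σ • horizontal γ q ν v := by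
  have h1 := transport_mul_qi (hq.norm_hopfTorus v)
  rw [transport, hq.hopf_hopfTorus] at h1
  have h2 : σ * σ = 1 := by rcases hσ with rfl | rfl <;> norm_num
  rw [horizontal, horizontal, ← hsign, ← mul_assoc, ← h1, mul_smul_comm, mul_smul_comm, smul_smul,
    h2, one_smul]
  simp only [mul_assoc]

omit hν hσ hq in
lemma star_tangent_mul_normal (s : ℝ) :
    star (arcDeriv γ γ s) * ν s = -(σ • (star (γ s) * qi)) := by
  have h := mul_star_mul (arcDeriv γ γ s) (γ s)
  rw [hγ.inner_tangent_self, hγ.norm_tangent] at h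
  rw [← hsign, mul_smul_comm, ← mul_assoc, ← mul_assoc, ← qi_mul_eq (hγ.imI_tangent s), mul_assoc,
    mul_assoc, ← mul_assoc (arcDeriv γ γ s), h, ← qi_mul_eq (hγ.imI_eq_zero s), ← smul_neg]
  simp

/-- The frame along the Hopf torus in terms of parameters that depend on a point of the plane. -/
lemma hopfFrame {U : Set Plane} (hU : IsOpen U) {h : Plane → ℝ × ℝ} (hh : ContDiffOn ℝ ∞ h U)
    (hinj : ∀ y ∈ U, Function.Injective (fderiv ℝ h y)) :
    HopfFrame (hopfTorus q ∘ h) (horizontal γ q (arcDeriv γ γ) ∘ h)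
      (fun y => σ • (qi * hopfTorus q (h y))) (horizontal γ q ν ∘ h)
      (fun y => (horizontalForm γ (h y)).comp (fderiv ℝ h y))
      (fun y => σ • (verticalForm q (h y)).comp (fderiv ℝ h y))
      (fun n y => 2 ^ n * (arcDeriv γ)^[n] (signedCurvature γ ν) (h y).1) U := by
  have hσσ : σ * σ = 1 := by rcases hσ with rfl | rfl <;> norm_num
  have hat {y : Plane} (hy : y ∈ U) : ContDiffAt ℝ ∞ h y := hh.contDiffAt (hU.mem_nhds hy)
  have hd {y : Plane} (hy : y ∈ U) : HasFDerivAt h (fderiv ℝ h y) y :=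
    ((hat hy).differentiableAt (by simp)).hasFDerivAt
  have hd' {y : Plane} (hy : y ∈ U) : DifferentiableAt ℝ (fderiv ℝ h) y :=
    ((hat hy).fderiv_right (m := 1) (n := ∞)
      (WithTop.coe_le_coe.2 (le_top : (1 + 1 : ℕ∞) ≤ ⊤))).differentiableAt (by simp)
  have hfst {y : Plane} (hy : y ∈ U) : DifferentiableAt ℝ (fun y => (h y).1) y :=
    (hd hy).differentiableAt.fst
  have hiT := hq.qi_mul_horizontal_tangent hσ hsign
  have hiN (v : ℝ × ℝ) : qi * horizontal γ q ν v = -(σ • horizontal γ q (arcDeriv γ γ) v) := by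
    have : horizontal γ q ν v = σ • (qi * horizontal γ q (arcDeriv γ γ) v) := by
      rw [hiT, smul_smul, hσσ, one_smul]
    rw [this, mul_smul_comm, ← mul_assoc, qi_mul_qi]
    simp
  have hqiP (v : ℝ × ℝ) : hopfTorus q v * (star (γ v.1) * qi) = qi * hopfTorus q v := by
    have h1 := transport_mul_qi (hq.norm_hopfTorus v)
    rwa [transport, hq.hopf_hopfTorus, mul_assoc] at h1
  have hγstar (s : ℝ) : HasDerivAt (fun s => star (γ s)) (‖deriv γ s‖ • star (arcDeriv γ γ s)) s := by
    refine (starL.hasFDerivAt.comp_hasDerivAt s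
      (hγ.hasDerivAt_of_contDiff hγ.smooth s)).congr_deriv ?_
    rw [map_smul, starL_apply]
  have hmT (s : ℝ) : HasDerivAt (fun s => star (γ s) * arcDeriv γ γ s)
      (‖deriv γ s‖ • (signedCurvature γ ν s • (star (γ s) * ν s))) s := by
    refine ((hγstar s).mul (hγ.hasDerivAt_of_contDiff hγ.contDiff_tangent s)).congr_deriv ?_
    rw [hγ.arcDeriv_tangent hν, smul_mul_assoc, star_mul_of_norm_eq_one (hγ.norm_tangent s),
      mul_smul_comm, mul_sub, star_mul_of_norm_eq_one (hγ.norm_eq_one s), mul_smul_comm]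
    module
  have hmN (s : ℝ) : HasDerivAt (fun s => star (γ s) * ν s)
      (‖deriv γ s‖ • (-(σ • (star (γ s) * qi))
        - signedCurvature γ ν s • (star (γ s) * arcDeriv γ γ s))) s := by
    refine ((hγstar s).mul (hγ.hasDerivAt_of_contDiff hν.smooth s)).congr_deriv ?_
    rw [hγ.arcDeriv_normal hν, smul_mul_assoc, star_tangent_mul_normal hγ hsign,
      mul_smul_comm, mul_neg, mul_smul_comm]
    module
  -- As γ ⊥ T are unit vectors, γ̄T is an imaginary unit and squares to -1.
  have hET (v : ℝ × ℝ) : horizontal γ q (arcDeriv γ γ) v * (star (γ v.1) * arcDeriv γ γ v.1) =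
      -hopfTorus q v := by
    rw [horizontal, mul_assoc, star_mul_mul_star_mul_self (hγ.norm_tangent _) (hγ.norm_eq_one _)
      (hγ.inner_tangent_self _), mul_neg, mul_one]
  have hEN (v : ℝ × ℝ) : horizontal γ q (arcDeriv γ γ) v * (star (γ v.1) * ν v.1) =
      σ • (qi * hopfTorus q v) := by
    have e : star (γ v.1) * arcDeriv γ γ v.1 * (star (γ v.1) * ν v.1) = σ • (star (γ v.1) * qi) := by
      rw [mul_assoc, ← mul_assoc (arcDeriv γ γ v.1), mul_star_eq_neg (hγ.inner_tangent_self _),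
        neg_mul, mul_assoc (γ v.1), star_tangent_mul_normal hγ hsign, mul_neg, mul_neg, mul_neg, neg_neg,
        ← mul_assoc, star_mul_of_norm_eq_one (hγ.norm_eq_one _), one_mul]
    rw [horizontal, mul_assoc, e, mul_smul_comm, hqiP]
  refine
    { isOpen := hU
      deriv_f := fun y hy => ?_
      deriv_E := fun y hy => ?_
      deriv_V := fun y hy => ?_
      deriv_N := fun y hy => ?_
      deriv_k := fun n y hy => ?_
      diff_α := fun y hy => ?_
      diff_β := fun y hy => ?_
      orthonormal := fun y hy => hq.orthonormal_frame hγ hν hσ (h y)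
      indep := fun y hy v h1 h2 => ?_ }
  · refine ((hq.hasFDerivAt_hopfTorus hγ (h y)).comp y (hd hy)).congr_fderiv
      (ContinuousLinearMap.ext fun w => ?_)
    simp [smul_smul, mul_right_comm, hσσ]
  · refine ((hq.hasFDerivAt_hopfTorus_mul hγ (hmT (h y).1)).comp y (hd hy)).congr_fderiv
      (ContinuousLinearMap.ext fun w => ?_)
    have e := hiT (h y)
    rw [horizontal, ← mul_assoc] at e
    simp only [hET, e, add_apply, ContinuousLinearMap.comp_apply,
      ContinuousLinearMap.smulRight_apply, smul_apply, Function.comp_apply, pow_zero,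
      Function.iterate_zero, id, mul_smul_comm, smul_eq_mul]
    rw [← horizontal.eq_1 γ q ν]
    module
  · refine (((ContinuousLinearMap.mul ℝ ℍ[ℝ] qi).hasFDerivAt.comp y
      ((hq.hasFDerivAt_hopfTorus hγ (h y)).comp y (hd hy))).const_smul σ).congr_fderiv
      (ContinuousLinearMap.ext fun w => ?_)
    simp only [add_apply, sub_apply, ContinuousLinearMap.comp_apply,
      ContinuousLinearMap.smulRight_apply, smul_apply, Function.comp_apply, smul_add, smul_eq_mul,
      ContinuousLinearMap.mul_apply', mul_add, mul_smul_comm, hiT, ← mul_assoc, qi_mul_qi, neg_mul, one_mul]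
    simp only [smul_smul, mul_comm σ, mul_assoc, hσσ]
    module
  · refine ((hq.hasFDerivAt_hopfTorus_mul hγ (hmN (h y).1)).comp y (hd hy)).congr_fderiv
      (ContinuousLinearMap.ext fun w => ?_)
    have e := hiN (h y)
    rw [horizontal, ← mul_assoc] at e
    simp only [hEN, e, add_apply, neg_apply, ContinuousLinearMap.comp_apply,
      ContinuousLinearMap.smulRight_apply, smul_apply, Function.comp_apply, pow_zero,
      Function.iterate_zero, id, mul_smul_comm, smul_eq_mul, mul_sub, mul_neg, hqiP]
    rw [← horizontal.eq_1 γ q (arcDeriv γ γ)]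
    module
  -- Each arc-length derivative on the base is paired with |γ'| ds, which is 2α; the powers of 2 in
  -- the definition of `k n` absorb this.
  · have h1 := (hγ.hasDerivAt_of_contDiff (hγ.contDiff_iterate_arcDeriv hν n) (h y).1)
    have h2 := (h1.hasFDerivAt.comp y (hd hy).fst).const_mul (2 ^ n)
    refine h2.congr_fderiv (ContinuousLinearMap.ext fun w => ?_)
    rw [Function.iterate_succ_apply']
    simp [horizontalForm]
    ring
  · have h1 : DifferentiableAt ℝ (fun y => ‖deriv γ (h y).1‖ / 2) y := by
      have h0 : DifferentiableAt ℝ (fun y => ‖deriv γ (h y).1‖) y :=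
        (hγ.contDiff_speed.differentiable (by simp)).differentiableAt.comp y (hfst hy)
      exact h0.fun_mul (differentiableAt_const _)
    have h2 : DifferentiableAt ℝ (fun y => (ContinuousLinearMap.fst ℝ ℝ ℝ).comp (fderiv ℝ h y)) y :=
      (differentiableAt_const _).clm_comp (hd' hy)
    exact h1.fun_smul h2
  · have hω : ContDiff ℝ ∞ (fibreSpeed q) :=
      ((contDiff_infty_iff_deriv.1 hq.contDiff).2).inner ℝ (contDiff_const.mul hq.contDiff)
    have h1 : DifferentiableAt ℝ (fun y => fibreSpeed q (h y).1) y :=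
      (hω.differentiable (by simp)).differentiableAt.comp y (hfst hy)
    have h2 : DifferentiableAt ℝ (fun y => (ContinuousLinearMap.fst ℝ ℝ ℝ).comp (fderiv ℝ h y)) y :=
      (differentiableAt_const _).clm_comp (hd' hy)
    have h3 : DifferentiableAt ℝ (fun y => (ContinuousLinearMap.snd ℝ ℝ ℝ).comp (fderiv ℝ h y)) y :=
      (differentiableAt_const _).clm_comp (hd' hy)
    exact ((h1.fun_smul h2).fun_add h3).fun_const_smul σ
  · refine hinj y hy ?_
    rw [map_zero]
    have hσ0 : σ ≠ 0 := fun h => by simp [h] at hσσ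
    rw [ContinuousLinearMap.comp_apply, horizontalForm_apply, mul_eq_zero] at h1
    have h1' := h1.resolve_left (by have := hγ.speed_pos (h y).1; positivity)
    rw [smul_apply, ContinuousLinearMap.comp_apply, verticalForm_apply, h1', smul_eq_mul,
      mul_eq_zero, or_iff_right hσ0, mul_zero, zero_add] at h2
    exact Prod.ext h1' h2

end IsClosedLift

end HopfWillmore

/-! ### Lattice quotients of the plane and local left inverses of immersions. -/

/-- The integral lattice in the plane. -/
def latticeSubgroup : AddSubgroup (ℝ × ℝ) :=
  AddMonoidHom.range ((Int.castAddHom ℝ).prodMap (Int.castAddHom ℝ))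

lemma mem_latticeSubgroup {v : ℝ × ℝ} : v ∈ latticeSubgroup ↔ ∃ l, v = latticePoint l := by
  simp only [latticeSubgroup, AddMonoidHom.mem_range, eq_comm (a := v)]
  rfl

lemma isDiscrete_latticeSubgroup : IsDiscrete (latticeSubgroup : Set (ℝ × ℝ)) := by
  rw [isDiscrete_iff_forall_mem_exists_isOpen]
  rintro v hv
  obtain ⟨l, rfl⟩ := mem_latticeSubgroup.1 hv
  refine ⟨Metric.ball (latticePoint l) 1, Metric.isOpen_ball, ?_⟩
  ext w
  simp only [Set.mem_inter_iff, Metric.mem_ball, SetLike.mem_coe, Set.mem_singleton_iff]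
  constructor
  · rintro ⟨h, hw⟩
    obtain ⟨l', rfl⟩ := mem_latticeSubgroup.1 hw
    rw [Prod.dist_eq, max_lt_iff] at h
    simp only [latticePoint, Real.dist_eq] at h
    have key {m n : ℤ} (h : |(m : ℝ) - n| < 1) : m = n :=
      sub_eq_zero.1 (Int.abs_lt_one_iff.1 (by exact_mod_cast h))
    rw [Prod.ext (key h.1) (key h.2)]
  · rintro rfl
    exact ⟨Metric.mem_ball_self one_pos, hv⟩

lemma IsTorusCovering.of_continuous {Y : Type} [TopologicalSpace Y] [T2Space Y] {p : ℝ × ℝ → Y}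
    (hp : Continuous p) (hsurj : Function.Surjective p)
    (hiff : ∀ v w, p v = p w ↔ ∃ l, w = v + latticePoint l) : IsTorusCovering p where
  surjective := hsurj
  apply_eq_iff := hiff
  isCoveringMap := by
    have hq : Topology.IsQuotientMap p := by
      -- The compact unit square already surjects onto the Hausdorff space `Y`, by fractional parts,
      -- so `p` is a quotient map. A quotient by a discrete group of translations is a covering.
      let K : Set (ℝ × ℝ) := Set.Icc 0 1 ×ˢ Set.Icc 0 1
      have : CompactSpace K := isCompact_iff_compactSpace.1 (isCompact_Icc.prod isCompact_Icc)
      have hc : Continuous (p ∘ ((↑) : K → ℝ × ℝ)) := hp.comp continuous_subtype_val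
      refine Topology.IsQuotientMap.of_comp continuous_subtype_val hp
        (hc.isClosedMap.isQuotientMap hc fun y => ?_)
      obtain ⟨v, rfl⟩ := hsurj y
      refine ⟨⟨(Int.fract v.1, Int.fract v.2), ⟨Int.fract_nonneg _, (Int.fract_lt_one _).le⟩,
        ⟨Int.fract_nonneg _, (Int.fract_lt_one _).le⟩⟩, (hiff _ _).2 ⟨(⌊v.1⌋, ⌊v.2⌋), ?_⟩⟩
      simp [latticePoint]
    refine (hq.isAddQuotientCoveringMap_of_addSubgroup latticeSubgroup isDiscrete_latticeSubgroup
      fun {v w} => ?_).isCoveringMap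
    rw [hiff, mem_latticeSubgroup]
    refine exists_congr fun l => ?_
    rw [← sub_eq_add_neg, sub_eq_iff_eq_add']

section LeftInverse

variable {E F : Type*} [NormedAddCommGroup E] [NormedSpace ℝ E] [FiniteDimensional ℝ E]
  [NormedAddCommGroup F] [NormedSpace ℝ F] [FiniteDimensional ℝ F]

/-- An immersion has a smooth left inverse locally. -/
lemma ContDiffAt.exists_leftInverse {f : E → F} {a : E} (hf : ContDiffAt ℝ ∞ f a)
    (hinj : Function.Injective (fderiv ℝ f a)) :
    ∃ R : F → E, ContDiffAt ℝ ∞ R (f a) ∧ ∀ᶠ x in nhds a, R (f x) = x := by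
  have : CompleteSpace E := FiniteDimensional.complete ℝ E
  -- Composing with a linear left inverse of the differential gives a map with derivative the
  -- identity, to which the inverse function theorem applies.
  obtain ⟨B, hB⟩ := (fderiv ℝ f a).toLinearMap.exists_leftInverse_of_injective
    (LinearMap.ker_eq_bot.2 hinj)
  let B' : F →L[ℝ] E := LinearMap.toContinuousLinearMap B
  have h1 : ContDiffAt ℝ ∞ (B' ∘ f) a := B'.contDiff.contDiffAt.comp a hf
  have h2 : HasFDerivAt (B' ∘ f) ((ContinuousLinearEquiv.refl ℝ E : E ≃L[ℝ] E) : E →L[ℝ] E) a := by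
    refine (B'.hasFDerivAt.comp a (hf.differentiableAt (by simp)).hasFDerivAt).congr_fderiv ?_
    ext1 v
    exact LinearMap.congr_fun hB v
  refine ⟨h1.localInverse h2 (by simp) ∘ B', ?_, ?_⟩
  · exact ContDiffAt.comp (g := h1.localInverse h2 (by simp)) (f a)
      (h1.to_localInverse h2 (by simp)) B'.contDiff.contDiffAt
  · exact (h1.hasStrictFDerivAt' h2 (by simp)).eventually_left_inverse

end LeftInverse

/-! ### An immersed torus of degree ±1 as a reparametrization of the Hopf torus. -/

namespace HopfWillmore

namespace IsClosedLift

variable {γ q : ℝ → ℍ[ℝ]} {L : ℝ}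

lemma injective_fderiv_hopfTorus (hq : IsClosedLift γ q L) (hγ : IsSimpleClosedCurve γ L)
    (v : ℝ × ℝ) : Function.Injective (fderiv ℝ (hopfTorus q) v) := by
  rw [(hq.hasFDerivAt_hopfTorus hγ v).fderiv, injective_iff_map_eq_zero]
  intro w hw
  have ho := hq.orthonormal_frame hγ hγ.isUnitNormalAlongCurve (.inl rfl) v
  rw [one_smul] at ho
  have h1 := congrArg (fun x => (inner ℝ (horizontal γ q (arcDeriv γ γ) v) x : ℝ)) hw
  have h2 := congrArg (fun x => (inner ℝ (qi * hopfTorus q v) x : ℝ)) hw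
  have e11 : ‖horizontal γ q (arcDeriv γ γ) v‖ = 1 := ho.1 1
  have e22 : ‖qi * hopfTorus q v‖ = 1 := ho.1 2
  have e12 : (inner ℝ (horizontal γ q (arcDeriv γ γ) v) (qi * hopfTorus q v) : ℝ) = 0 :=
    ho.2 (i := 1) (j := 2) (by decide)
  have e21 := e12
  rw [real_inner_comm] at e21
  simp only [add_apply, ContinuousLinearMap.smulRight_apply, inner_add_right,
    real_inner_smul_right, real_inner_self_eq_norm_sq, e11, e22, e12, e21, inner_zero_right,
    one_pow, mul_one, mul_zero, add_zero, zero_add] at h1 h2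
  rw [horizontalForm_apply, mul_eq_zero] at h1
  have h1' := h1.resolve_left (by have := hγ.speed_pos v.1; positivity)
  rw [verticalForm_apply, h1', mul_zero, zero_add] at h2
  exact Prod.ext h1' h2

end IsClosedLift

section Charts

variable {M : Type} [TopologicalSpace M] [ChartedSpace Plane M]

variable [IsManifold (𝓡 2) ∞ M] {F : M → ℍ[ℝ]}

lemma contDiffAt_inChart (hF : ContMDiff (𝓡 2) 𝓘(ℝ, ℍ[ℝ]) ∞ F) (x : M) {y : Plane}
    (hy : y ∈ (extChartAt (𝓡 2) x).target) : ContDiffAt ℝ ∞ (inChart F x) y := by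
  rw [← contMDiffAt_iff_contDiffAt]
  exact hF.contMDiffAt.comp y ((contMDiffOn_extChartAt_symm x).contMDiffAt
    ((isOpen_extChartAt_target x).mem_nhds hy))

omit [IsManifold (𝓡 2) ∞ M] in
lemma fderiv_inChart (hF : ContMDiff (𝓡 2) 𝓘(ℝ, ℍ[ℝ]) ∞ F) (x : M) :
    fderiv ℝ (inChart F x) (extChartAt (𝓡 2) x x) = dF F x := by
  have h := (hF.mdifferentiable (by simp) x).hasMFDerivAt.2
  rw [ModelWithCorners.range_eq_univ] at h
  exact HasFDerivAt.fderiv (hasFDerivWithinAt_univ.1 h)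

lemma injective_fderiv_inChart (hF : IsSphereImmersion F) (x : M) {y : Plane}
    (hy : y ∈ (extChartAt (𝓡 2) x).target) :
    Function.Injective (fderiv ℝ (inChart F x) y) := by
  have hc := ((contMDiffOn_extChartAt_symm (I := 𝓡 2) (n := ∞) x).contMDiffAt
    ((isOpen_extChartAt_target x).mem_nhds hy)).mdifferentiableAt (by simp)
  have h1 := isInvertible_mfderivWithin_extChartAt_symm hy
  rw [ModelWithCorners.range_eq_univ, mfderivWithin_univ] at h1
  rw [← mfderiv_eq_fderiv, inChart,
    mfderiv_comp y (hF.smooth.mdifferentiable (by simp) _) hc]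
  exact (hF.injective_mfderiv _).comp h1.injective

end Charts

section LocalLift

variable {M : Type} [TopologicalSpace M] [ChartedSpace Plane M] [IsManifold (𝓡 2) ∞ M]
  {F : M → ℍ[ℝ]} {T : Set ℍ[ℝ]} {P : ℝ × ℝ → ℍ[ℝ]}

/-- An immersion into a surface is a change of parameters, in terms of a chart and of a local
parametrization of the surface. -/
lemma exists_contDiffOn_of_parametrization (hF : IsSphereImmersion F) (hP : ContDiff ℝ ∞ P)
    (hP' : ∀ v, Function.Injective (fderiv ℝ P v)) {f : M → T} (hf : Continuous f)
    (hfF : ∀ x, (f x : ℍ[ℝ]) = F x) (φ : OpenPartialHomeomorph (ℝ × ℝ) T)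
    (hφ : ∀ v, (φ v : ℍ[ℝ]) = P v) {x : M} (hx : f x ∈ φ.target) :
    ∃ U : Set Plane, IsOpen U ∧ extChartAt (𝓡 2) x x ∈ U ∧ U ⊆ (extChartAt (𝓡 2) x).target ∧
      (∀ y ∈ U, f ((extChartAt (𝓡 2) x).symm y) ∈ φ.target) ∧
      ContDiffOn ℝ ∞ (fun y => φ.symm (f ((extChartAt (𝓡 2) x).symm y))) U ∧
      ∀ y ∈ U, Function.Injective
        (fderiv ℝ (fun y => φ.symm (f ((extChartAt (𝓡 2) x).symm y))) y) := by
  set c := (extChartAt (𝓡 2) x).symm with hc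
  set h : Plane → ℝ × ℝ := fun y => φ.symm (f (c y)) with hh
  have hcont : ContinuousOn (fun y => f (c y)) (extChartAt (𝓡 2) x).target :=
    hf.comp_continuousOn (continuousOn_extChartAt_symm x)
  refine ⟨(extChartAt (𝓡 2) x).target ∩ (fun y => f (c y)) ⁻¹' φ.target,
    hcont.isOpen_inter_preimage (isOpen_extChartAt_target x) φ.open_target,
    ⟨mem_extChartAt_target x, by simpa [hc] using hx⟩, Set.inter_subset_left,
    fun y hy => hy.2, ?_⟩
  have hopen := hcont.isOpen_inter_preimage (isOpen_extChartAt_target x) φ.open_target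
  set U := (extChartAt (𝓡 2) x).target ∩ (fun y => f (c y)) ⁻¹' φ.target with hU
  have heq (y : Plane) (hy : y ∈ U) : P (h y) = inChart F x y := by
    rw [← hφ, φ.right_inv hy.2, hfF]
    rfl
  have hcontU : ContinuousOn h U := φ.continuousOn_symm.comp (hcont.mono Set.inter_subset_left)
    fun y hy => hy.2
  -- The target `T` is only a topological subspace, so `h` is a priori just continuous. Near `y` it
  -- equals `R` composed with `F` in the chart, where `R` is a smooth local left inverse of `P`.
  have hdiff (y : Plane) (hy : y ∈ U) : ContDiffAt ℝ ∞ h y := by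
    obtain ⟨R, hR, hRP⟩ := (hP.contDiffAt (x := h y)).exists_leftInverse (hP' _)
    rw [heq y hy] at hR
    refine (ContDiffAt.comp y hR (contDiffAt_inChart hF.smooth x hy.1)).congr_of_eventuallyEq ?_
    filter_upwards [hopen.mem_nhds hy, (hcontU.continuousAt (hopen.mem_nhds hy)).eventually hRP]
      with z hz hz'
    rw [Function.comp_apply, ← heq z hz, hz']
  refine ⟨fun y hy => (hdiff y hy).contDiffWithinAt, fun y hy => ?_⟩
  have h1 : fderiv ℝ (inChart F x) y = (fderiv ℝ P (h y)).comp (fderiv ℝ h y) := by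
    refine HasFDerivAt.fderiv (((hP.differentiable (by simp)).differentiableAt.hasFDerivAt.comp y
      ((hdiff y hy).differentiableAt (by simp)).hasFDerivAt).congr_of_eventuallyEq ?_)
    filter_upwards [hopen.mem_nhds hy] with z hz
    rw [Function.comp_apply, heq z hz]
  have h2 := injective_fderiv_inChart hF x hy.1
  rw [h1] at h2
  exact Function.Injective.of_comp h2

/-- In a chart of `M` and local parameters of `T`, `f` becomes a smooth map with injective
differential between planes; equality of dimensions permits the inverse function theorem. -/
lemma isLocalHomeomorph_of_parametrization (hF : IsSphereImmersion F) (hP : ContDiff ℝ ∞ P)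
    (hP' : ∀ v, Function.Injective (fderiv ℝ P v)) {f : M → T} (hf : Continuous f)
    (hfF : ∀ x, (f x : ℍ[ℝ]) = F x) {p : ℝ × ℝ → T} (hp : IsLocalHomeomorph p)
    (hsurj : Function.Surjective p) (hpP : ∀ v, (p v : ℍ[ℝ]) = P v) : IsLocalHomeomorph f := by
  refine IsLocalHomeomorph.mk _ fun x => ?_
  obtain ⟨v, hv⟩ := hsurj (f x)
  obtain ⟨φ, hvφ, rfl⟩ := hp v
  have hx : f x ∈ φ.target := hv ▸ φ.map_source hvφ
  obtain ⟨U, hU, hxU, hUt, hUφ, hh, hh'⟩ :=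
    exists_contDiffOn_of_parametrization hF hP hP' hf hfF φ hpP hx
  set y₀ := extChartAt (𝓡 2) x x with hy₀
  set h : Plane → ℝ × ℝ := fun y => φ.symm (f ((extChartAt (𝓡 2) x).symm y)) with hhdef
  have hat : ContDiffAt ℝ ∞ h y₀ := hh.contDiffAt (hU.mem_nhds hxU)
  let A : Plane ≃L[ℝ] ℝ × ℝ := (LinearEquiv.ofInjectiveOfFinrankEq
    (fderiv ℝ h y₀).toLinearMap (hh' y₀ hxU) (by simp)).toContinuousLinearEquiv
  have hA : HasFDerivAt h (A : Plane →L[ℝ] ℝ × ℝ) y₀ :=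
    (hat.differentiableAt (by simp)).hasFDerivAt
  let e₁ := hat.toOpenPartialHomeomorph h hA (by simp)
  have he₁ : y₀ ∈ e₁.source := hat.mem_toOpenPartialHomeomorph_source hA (by simp)
  let e₀ := (chartAt Plane x).trans (e₁.trans φ)
  have hsrc (z : M) (hz : z ∈ (chartAt Plane x).source) :
      h (chartAt Plane x z) = φ.symm (f z) := by
    simp only [hhdef]
    rw [show chartAt Plane x z = extChartAt (𝓡 2) x z by simp [mfld_simps],
      PartialEquiv.left_inv _ (by simpa [mfld_simps] using hz)]
  have hopen : IsOpen (f ⁻¹' φ.target) := φ.open_target.preimage hf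
  have hval (z : M) (hz : z ∈ (e₀.restrOpen _ hopen).source) : e₀.restrOpen _ hopen z = f z := by
    have h1 : z ∈ e₀.source := (by simpa using hz : _ ∧ _).1
    have h2 : f z ∈ φ.target := (by simpa using hz : _ ∧ _).2
    have h3 : z ∈ (chartAt Plane x).source := h1.1
    change φ (h (chartAt Plane x z)) = f z
    rw [hsrc z h3, φ.right_inv h2]
  have hmem : x ∈ (e₀.restrOpen _ hopen).source := by
    rw [OpenPartialHomeomorph.restrOpen_source]
    refine ⟨⟨mem_chart_source Plane x, he₁, ?_⟩, hx⟩
    change h (chartAt Plane x x) ∈ φ.source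
    rw [hsrc x (mem_chart_source Plane x)]
    exact φ.map_target hx
  exact ⟨e₀.restrOpen _ hopen, hmem, fun z hz => (hval z hz).symm⟩

end LocalLift

lemma IsTorus.compactSpace {X : Type} [TopologicalSpace X] (h : IsTorus X) : CompactSpace X :=
  h.some.symm.compactSpace

lemma IsTorus.t2Space {X : Type} [TopologicalSpace X] (h : IsTorus X) : T2Space X :=
  h.some.symm.t2Space

lemma IsTorus.pathConnectedSpace {X : Type} [TopologicalSpace X] (h : IsTorus X) :
    PathConnectedSpace X := by
  have : PathConnectedSpace Circle := by
    have hs : Function.Surjective Circle.exp := fun z => ⟨_, Circle.exp_arg z⟩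
    exact hs.pathConnectedSpace Circle.exp.continuous
  exact h.some.symm.surjective.pathConnectedSpace h.some.symm.continuous

section

variable {M : Type} [TopologicalSpace M] [ChartedSpace Plane M]

/-- `G` is a covering of the surface `M` by the plane which expresses `F` as the standard
parametrization of the Hopf torus. -/
structure IsTorusParam (F : M → ℍ[ℝ]) (q : ℝ → ℍ[ℝ]) (G : ℝ × ℝ → M) : Prop where
  apply : ∀ v, F (G v) = hopfTorus q v
  isCoveringMap : IsCoveringMap G
  surjective : Function.Surjective G
  injective : Function.Injective F
  exists_local : ∀ v, ∃ (U : Set Plane) (h : Plane → ℝ × ℝ), IsOpen U ∧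
    extChartAt (𝓡 2) (G v) (G v) ∈ U ∧ U ⊆ (extChartAt (𝓡 2) (G v)).target ∧
    ContDiffOn ℝ ∞ h U ∧ (∀ y ∈ U, Function.Injective (fderiv ℝ h y)) ∧
    h (extChartAt (𝓡 2) (G v) (G v)) = v ∧ ∀ y ∈ U, G (h y) = (extChartAt (𝓡 2) (G v)).symm y

variable [IsManifold (𝓡 2) ∞ M] {F : M → ℍ[ℝ]} {γ q : ℝ → ℍ[ℝ]} {L : ℝ}

namespace IsClosedLift

/-- The universal covering of the Hopf torus, by coordinates in which the deck group is the
integral lattice. -/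
lemma isTorusCovering (hq : IsClosedLift γ q L) (hγ : IsSimpleClosedCurve γ L) :
    IsTorusCovering (fun v : ℝ × ℝ =>
      (⟨hopfTorus q (L * v.1, 2 * Real.pi * v.2),
        hq.range_hopfTorus ▸ Set.mem_range_self _⟩ : hopfPreimage (Set.range γ))) := by
  have hL := hγ.pos.ne'
  have hpi := Real.two_pi_pos.ne'
  refine .of_continuous ?_ ?_ ?_
  · refine Continuous.subtype_mk (hq.contDiff_hopfTorus.continuous.comp ?_) _
    fun_prop
  · rintro ⟨p, hp⟩
    rw [← hq.range_hopfTorus] at hp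
    obtain ⟨v, rfl⟩ := hp
    refine ⟨(v.1 / L, v.2 / (2 * Real.pi)), Subtype.ext ?_⟩
    simp only [mul_div_cancel₀ _ hL, mul_div_cancel₀ _ hpi]
  · intro v w
    rw [Subtype.mk.injEq, hq.hopfTorus_eq_iff hγ, Prod.exists]
    refine exists_congr fun m => exists_congr fun n => ?_
    simp only [Prod.ext_iff, latticePoint, Prod.fst_add, Prod.snd_add]
    refine and_congr ?_ ?_
    · rw [mul_comm (m : ℝ), ← mul_add]
      exact mul_right_inj' hL
    · rw [mul_comm (n : ℝ), ← mul_add]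
      exact mul_right_inj' hpi

/-- The universal covering of the Hopf torus. -/
lemma isCoveringMap (hq : IsClosedLift γ q L) (hγ : IsSimpleClosedCurve γ L) :
    IsCoveringMap (fun v : ℝ × ℝ => (⟨hopfTorus q v, hq.range_hopfTorus ▸ Set.mem_range_self _⟩ :
      hopfPreimage (Set.range γ))) := by
  have hL := hγ.pos.ne'
  have hpi := Real.two_pi_pos.ne'
  have := (hq.isTorusCovering hγ).isCoveringMap.comp_homeomorph
    ((Homeomorph.mulLeft₀ L hL).symm.prodCongr (Homeomorph.mulLeft₀ _ hpi).symm)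
  convert this using 1
  funext v
  refine Subtype.ext (congrArg (hopfTorus q) (Prod.ext ?_ ?_))
  · simp [mul_inv_cancel_left₀ hL]
  · exact (mul_inv_cancel_left₀ hpi _).symm

/-- An immersed torus that covers the Hopf torus simply is parametrized by it. -/
theorem exists_isTorusParam (hq : IsClosedLift γ q L) (hγ : IsSimpleClosedCurve γ L)
    (hF : IsSphereImmersion F) (hsimple : MapsSimplyOnto F (hopfPreimage (Set.range γ))) :
    ∃ G : ℝ × ℝ → M, IsTorusParam F q G := by
  obtain ⟨-, f, hf, hs⟩ := hsimple
  have := hs.source_torus.compactSpace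
  have := hs.source_torus.t2Space
  have := hs.source_torus.pathConnectedSpace
  have := hs.target_torus.t2Space
  have hp := hq.isCoveringMap hγ
  set p : ℝ × ℝ → hopfPreimage (Set.range γ) := fun v =>
    ⟨hopfTorus q v, hq.range_hopfTorus ▸ Set.mem_range_self _⟩ with hpdef
  have hpsurj : Function.Surjective p := by
    rintro ⟨x, hx⟩
    obtain ⟨v, hv⟩ := hq.range_hopfTorus ▸ hx
    exact ⟨v, Subtype.ext hv⟩
  have hloc : IsLocalHomeomorph f := isLocalHomeomorph_of_parametrization hF
    hq.contDiff_hopfTorus (hq.injective_fderiv_hopfTorus hγ) f.continuous hf hp.isLocalHomeomorph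
    hpsurj fun _ => rfl
  -- A local homeomorphism from a compact to a Hausdorff space is a covering here. The homology
  -- hypothesis then excludes more than one sheet.
  have hcov : IsCoveringMap f := isLocalHomeomorph_iff_isCoveringMap.1 hloc
  have hinj : Function.Injective f := by
    refine (hq.isTorusCovering hγ).injective_of_epi_homology f hcov ?_
    have := hs.isIso_homology
    exact (inferInstance : CategoryTheory.Epi
      (((AlgebraicTopology.singularHomologyFunctor (ModuleCat.{0} ℤ) 2).obj
        (ModuleCat.of ℤ ℤ)).map (TopCat.ofHom f)))
  have hsurj : Function.Surjective f := by
    have ho : IsOpen (Set.range f) := hloc.isOpenMap.isOpen_range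
    have hc : IsClosed (Set.range f) := (isCompact_range f.continuous).isClosed
    have := hs.target_torus.pathConnectedSpace
    have hne : (Set.range f).Nonempty := Set.range_nonempty f
    exact Set.range_eq_univ.1 (IsClopen.eq_univ ⟨hc, ho⟩ hne)
  let e : M ≃ₜ hopfPreimage (Set.range γ) :=
    f.continuous.homeoOfEquivCompactToT2 (f := Equiv.ofBijective f ⟨hinj, hsurj⟩)
  have he (x : M) : e x = f x := rfl
  refine ⟨fun v => e.symm (p v), fun v => ?_, hp.homeomorph_comp e.symm,
    e.symm.surjective.comp hpsurj, fun x y hxy => hinj (Subtype.ext (by rw [hf, hf, hxy])),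
    fun v => ?_⟩
  · rw [← hf, ← he, e.apply_symm_apply]
  · obtain ⟨φ, hvφ, hφ⟩ := hp.isLocalHomeomorph v
    have hfv : f (e.symm (p v)) = φ v := by rw [← he, e.apply_symm_apply, hφ]
    obtain ⟨U, hU, hxU, hUt, hUφ, hh, hh'⟩ := exists_contDiffOn_of_parametrization hF
      hq.contDiff_hopfTorus (hq.injective_fderiv_hopfTorus hγ) f.continuous hf φ
      (fun v => by rw [← hφ]) (x := e.symm (p v)) (hfv ▸ φ.map_source hvφ)
    refine ⟨U, _, hU, hxU, hUt, hh, hh', ?_, fun y hy => ?_⟩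
    · simp only [extChartAt_to_inv, hfv, φ.left_inv hvφ]
    · exact e.symm_apply_eq.2 ((congrFun hφ _).trans (φ.right_inv (hUφ y hy)))

end IsClosedLift

end

lemma HopfFrame.congr {f E V N : Plane → ℍ[ℝ]} {α β : Plane → Plane →L[ℝ] ℝ}
    {k : ℕ → Plane → ℝ} {U : Set Plane} (h : HopfFrame f E V N α β k U) {f' : Plane → ℍ[ℝ]}
    (hf : ∀ y ∈ U, f' y = f y) : HopfFrame f' E V N α β k U where
  isOpen := h.isOpen
  deriv_f y hy := (h.deriv_f y hy).congr_of_eventuallyEq ((h.eventually_mem hy).mono hf)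
  deriv_E y hy := by rw [hf y hy]; exact h.deriv_E y hy
  deriv_V y hy := by rw [hf y hy]; exact h.deriv_V y hy
  deriv_N := h.deriv_N
  deriv_k := h.deriv_k
  diff_α := h.diff_α
  diff_β := h.diff_β
  orthonormal y hy := by rw [hf y hy]; exact h.orthonormal y hy
  indep := h.indep

/-! ### Transfer of the frame computation to the immersed surface. -/

namespace IsTorusParam

variable {M : Type} [TopologicalSpace M] [ChartedSpace Plane M]
  {F : M → ℍ[ℝ]} {γ q : ℝ → ℍ[ℝ]} {L : ℝ} {G : ℝ × ℝ → M} (hG : IsTorusParam F q G)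

include hG

lemma apply_eq_iff (v w : ℝ × ℝ) : G v = G w ↔ hopfTorus q v = hopfTorus q w := by
  rw [← hG.apply, ← hG.apply]
  exact hG.injective.eq_iff.symm

lemma norm_apply (hq : IsClosedLift γ q L) (x : M) : ‖F x‖ = 1 := by
  obtain ⟨v, rfl⟩ := hG.surjective x
  rw [hG.apply, hq.norm_hopfTorus]

lemma hopf_apply (hq : IsClosedLift γ q L) (v : ℝ × ℝ) : hopf (F (G v)) = γ v.1 := by
  rw [hG.apply, hq.hopf_hopfTorus]

lemma exists_eq (hq : IsClosedLift γ q L) {x : M} {s : ℝ} (h : hopf (F x) = γ s) :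
    ∃ t, G (s, t) = x := by
  obtain ⟨t, ht⟩ := exists_expI_mul_eq (hG.norm_apply hq x) (hq.norm_eq_one s)
    (by rw [h, hq.hopf_eq])
  exact ⟨t, hG.injective (by rw [hG.apply, ht, hopfTorus])⟩

variable [IsManifold (𝓡 2) ∞ M]

/-- Since `G ∘ h` is the inverse chart, `G` is locally the inverse chart after the smooth local
inverse of `h`. -/
lemma contMDiff : ContMDiff 𝓘(ℝ, ℝ × ℝ) (𝓡 2) ∞ G := by
  intro v
  obtain ⟨U, h, hU, hyU, hUt, hh, hinj, hhv, hGh⟩ := hG.exists_local v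
  set y₀ := extChartAt (𝓡 2) (G v) (G v) with hy₀
  have hat : ContDiffAt ℝ ∞ h y₀ := hh.contDiffAt (hU.mem_nhds hyU)
  let A : Plane ≃L[ℝ] ℝ × ℝ := (LinearEquiv.ofInjectiveOfFinrankEq
    (fderiv ℝ h y₀).toLinearMap (hinj y₀ hyU) (by simp)).toContinuousLinearEquiv
  have hA : HasFDerivAt h (A : Plane →L[ℝ] ℝ × ℝ) y₀ :=
    (hat.differentiableAt (by simp)).hasFDerivAt
  have hk := hat.to_localInverse hA (by simp)
  have hk₀ := hat.localInverse_apply_image hA (by simp)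
  have hkr := (hat.hasStrictFDerivAt' hA (by simp)).eventually_right_inverse
  change ∀ᶠ w in nhds (h y₀), h (hat.localInverse hA (by simp) w) = w at hkr
  set k := hat.localInverse hA (by simp)
  rw [hhv] at hk hk₀ hkr
  have hc : ContMDiffAt 𝓘(ℝ, Plane) (𝓡 2) ∞ (extChartAt (𝓡 2) (G v)).symm (k v) := by
    rw [hk₀]
    exact (contMDiffOn_extChartAt_symm _).contMDiffAt
      ((isOpen_extChartAt_target (G v)).mem_nhds (mem_extChartAt_target _))
  refine (hc.comp v hk.contMDiffAt).congr_of_eventuallyEq ?_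
  filter_upwards [hkr, hk.continuousAt.eventually (by rw [hk₀]; exact hU.mem_nhds hyU)] with w h1 h2
  rw [Function.comp_apply, ← hGh _ h2, h1]

variable (hq : IsClosedLift γ q L) (hγ : IsSimpleClosedCurve γ L) {ν : ℝ → ℍ[ℝ]}
  (hν : IsUnitNormalAlongCurve γ ν) {σ : ℝ} (hσ : σ = 1 ∨ σ = -1)
  (hsign : ∀ s, σ • (qi * star (γ s) * arcDeriv γ γ s) = ν s)

include hq hγ hν hσ hsign

-- The map `h` expresses the parameters (s, t) in the preferred chart, where `F` is `hopfTorus q ∘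
-- h`. The structure equations hold for every such `h`, so no independence of charts has to be
-- established.
omit [IsManifold (𝓡 2) ∞ M] in
lemma exists_hopfFrame (v : ℝ × ℝ) : ∃ (U : Set Plane) (h : Plane → ℝ × ℝ),
    extChartAt (𝓡 2) (G v) (G v) ∈ U ∧ U ⊆ (extChartAt (𝓡 2) (G v)).target ∧
    ContDiffOn ℝ ∞ h U ∧ h (extChartAt (𝓡 2) (G v) (G v)) = v ∧
    (∀ y ∈ U, G (h y) = (extChartAt (𝓡 2) (G v)).symm y) ∧
    HopfFrame (inChart F (G v)) (horizontal γ q (arcDeriv γ γ) ∘ h)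
      (fun y => σ • (qi * hopfTorus q (h y))) (horizontal γ q ν ∘ h)
      (fun y => (horizontalForm γ (h y)).comp (fderiv ℝ h y))
      (fun y => σ • (verticalForm q (h y)).comp (fderiv ℝ h y))
      (fun n y => 2 ^ n * (arcDeriv γ)^[n] (signedCurvature γ ν) (h y).1) U := by
  obtain ⟨U, h, hU, hyU, hUt, hh, hinj, hhv, hGh⟩ := hG.exists_local v
  refine ⟨U, h, hyU, hUt, hh, hhv, hGh,
    (hq.hopfFrame hγ hν hσ hsign hU hh hinj).congr fun y hy => ?_⟩
  rw [Function.comp_apply, ← hG.apply, hGh y hy, inChart, Function.comp_apply]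

omit [IsManifold (𝓡 2) ∞ M] in
/-- The values of the geometric quantities at a point of an immersed Hopf torus. -/
lemma exists_dual (hF : IsSphereImmersion F) (v : ℝ × ℝ) :
    ∃ (α β : Plane →L[ℝ] ℝ), (∀ a b, ∃ w, α w = a ∧ β w = b) ∧
      (∀ w, dF F (G v) w = α w • horizontal γ q (arcDeriv γ γ) v
        + β w • (σ • (qi * hopfTorus q v))) ∧
      (∀ w w', secondFF F (G v) w w' = (2 * signedCurvature γ ν v.1 * (α w * α w')
        + α w * β w' + β w * α w') • horizontal γ q ν v) ∧
      ∀ w w', tracefreeFF F (G v) w w' = (signedCurvature γ ν v.1 * (α w * α w' - β w * β w')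
        + α w * β w' + β w * α w') • horizontal γ q ν v := by
  obtain ⟨U, h, hyU, -, -, hhv, -, hfr⟩ := hG.exists_hopfFrame hq hγ hν hσ hsign v
  have h1 := hfr.secondFF_apply hyU
  have h2 := hfr.tracefreeFF_apply hyU
  have h3 := hfr.fderiv_f hyU
  have h4 := hfr.exists_dual hyU
  simp only [hhv, Function.comp_apply, pow_zero, one_mul, Function.iterate_zero, id] at h1 h2 h3 h4
  refine ⟨_, _, h4, fun w => ?_, h1, h2⟩
  rw [← fderiv_inChart hF.smooth]
  exact h3 w

omit [IsManifold (𝓡 2) ∞ M] in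
lemma meanCurv_eq (v : ℝ × ℝ) :
    meanCurv F (G v) = (2 * signedCurvature γ ν v.1) • horizontal γ q ν v := by
  obtain ⟨U, h, hyU, -, -, hhv, -, hfr⟩ := hG.exists_hopfFrame hq hγ hν hσ hsign v
  have h1 := hfr.meanCurv_eq hyU
  simp only [hhv, Function.comp_apply, pow_zero, one_mul, Function.iterate_zero, id] at h1
  exact h1

omit [IsManifold (𝓡 2) ∞ M] in
lemma tracefreeFFNormSq_eq (v : ℝ × ℝ) :
    tracefreeFFNormSq F (G v) = 2 * (signedCurvature γ ν v.1 ^ 2 + 1) := by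
  obtain ⟨U, h, hyU, -, -, hhv, -, hfr⟩ := hG.exists_hopfFrame hq hγ hν hσ hsign v
  have h1 := hfr.tracefreeFF_normSq hyU
  simp only [hhv, pow_zero, one_mul, Function.iterate_zero, id] at h1
  exact h1

omit [IsManifold (𝓡 2) ∞ M] in
lemma Q_meanCurv_eq (v : ℝ × ℝ) : Q F (G v) (meanCurv F (G v)) =
    (4 * (signedCurvature γ ν v.1 ^ 3 + signedCurvature γ ν v.1)) • horizontal γ q ν v := by
  rw [hG.meanCurv_eq hq hγ hν hσ hsign]
  obtain ⟨U, h, hyU, -, -, hhv, -, hfr⟩ := hG.exists_hopfFrame hq hγ hν hσ hsign v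
  have h1 := hfr.Q_eq hyU (2 * signedCurvature γ ν v.1)
  simp only [hhv, Function.comp_apply, pow_zero, one_mul, Function.iterate_zero, id] at h1
  refine h1.trans ?_
  congr 1
  ring

omit [IsManifold (𝓡 2) ∞ M] in
lemma normalLaplacian_meanCurv_eq (v : ℝ × ℝ) : normalLaplacian F (meanCurv F) (G v) =
    (8 * (arcDeriv γ)^[2] (signedCurvature γ ν) v.1) • horizontal γ q ν v := by
  obtain ⟨U, h, hyU, -, -, hhv, hGh, hfr⟩ := hG.exists_hopfFrame hq hγ hν hσ hsign v
  refine (hfr.normalLaplacian_eq hyU ?_).trans ?_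
  -- The mean curvature at a neighbouring point is computed in that point's own preferred chart;
  -- `meanCurv_eq` at the parameters `h y` gives it in a form common to all charts.
  · filter_upwards [hfr.eventually_mem hyU] with y hy
    rw [inChart, Function.comp_apply, ← hGh y hy, hG.meanCurv_eq hq hγ hν hσ hsign]
    simp
  · simp only [hhv, Function.comp_apply]
    congr 1
    ring

omit [IsManifold (𝓡 2) ∞ M] in
lemma secondFFDerivNormSq_eq {n : ℕ} (hn : 1 ≤ n) (v : ℝ × ℝ) :
    secondFFDerivNormSq n F (G v) =
      2 ^ (2 + 2 * n) * |(arcDeriv γ)^[n] (signedCurvature γ ν) v.1| ^ 2 := by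
  obtain ⟨U, h, hyU, -, -, hhv, -, hfr⟩ := hG.exists_hopfFrame hq hγ hν hσ hsign v
  refine (hfr.secondFFDeriv_normSq hyU hn).trans ?_
  rw [hhv, sq_abs]
  ring

omit [IsManifold (𝓡 2) ∞ M] in
lemma willmoreGradient_eq (v : ℝ × ℝ) : willmoreGradient F (G v) =
    (2 * (2 * (arcDeriv γ)^[2] (signedCurvature γ ν) v.1
      + signedCurvature γ ν v.1 ^ 3 + signedCurvature γ ν v.1)) • horizontal γ q ν v := by
  rw [willmoreGradient, hG.normalLaplacian_meanCurv_eq hq hγ hν hσ hsign,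
    hG.Q_meanCurv_eq hq hγ hν hσ hsign]
  module

omit [IsManifold (𝓡 2) ∞ M] hγ hσ hsign in
lemma dHopf_horizontal (v : ℝ × ℝ) :
    dHopf (F (G v)) (horizontal γ q ν v) = (2 : ℝ) • ν v.1 := by
  rw [hG.apply, ← hq.transport_mul_eq, dHopf_transport_mul (hq.norm_hopfTorus v) (hν.imI_eq_zero _)]

omit [IsManifold (𝓡 2) ∞ M] in
lemma dHopf_willmoreGradient (v : ℝ × ℝ) :
    dHopf (F (G v)) (willmoreGradient F (G v)) = (4 : ℝ) • elasticGradient γ v.1 := by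
  rw [hG.willmoreGradient_eq hq hγ hν hσ hsign, dHopf_smul, hG.dHopf_horizontal hq hν,
    hγ.elasticGradient_eq hν]
  module

-- Periodicity of ν is not assumed: it follows from ν = σiγ̄T. Hence the horizontal lift of ν
-- descends to the surface.
omit hν hσ [IsManifold (𝓡 2) ∞ M] in
lemma horizontal_normal_eq {v w : ℝ × ℝ} (h : G v = G w) :
    horizontal γ q ν v = horizontal γ q ν w := by
  have h1 := (hG.apply_eq_iff v w).1 h
  obtain ⟨m, n, rfl⟩ := (hq.hopfTorus_eq_iff hγ v w).1 h1
  have hper {W : ℝ → ℍ[ℝ]} (hW : Function.Periodic W L) (s : ℝ) : W (s + m * L) = W s := by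
    rw [← zsmul_eq_mul]; exact hW.zsmul m s
  have h2 : Function.Periodic (arcDeriv γ γ) L := fun s => by
    rw [arcDeriv, hγ.periodic_deriv]; rfl
  rw [horizontal, horizontal, ← h1, ← hsign, ← hsign, hper hγ.periodic, hper h2]

omit [IsManifold (𝓡 2) ∞ M] in
/-- The unit normal field along the immersion over the unit normal field along the curve. -/
lemma exists_isUnitNormalAlongSurface (hF : IsSphereImmersion F) :
    ∃ N : M → ℍ[ℝ], IsUnitNormalAlongSurface F N ∧ ∀ v, N (G v) = horizontal γ q ν v := by
  have hN (v : ℝ × ℝ) : horizontal γ q ν (Function.surjInv hG.surjective (G v)) =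
      horizontal γ q ν v :=
    hG.horizontal_normal_eq hq hγ hsign (Function.surjInv_eq hG.surjective (G v))
  refine ⟨fun x => horizontal γ q ν (Function.surjInv hG.surjective x), ⟨fun x => ?_, fun x => ?_,
    fun x => ?_, fun x w => ?_⟩, hN⟩
  · obtain ⟨v, rfl⟩ := hG.surjective x
    obtain ⟨U, h, hyU, hUt, hh, hhv, hGh, hfr⟩ := hG.exists_hopfFrame hq hγ hν hσ hsign v
    have hsm : ContDiff ℝ ∞ (horizontal γ q ν) :=
      hq.contDiff_hopfTorus.mul (((starL.contDiff.comp hγ.smooth).mul hν.smooth).comp contDiff_fst)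
    have h1 : ContDiffAt ℝ ∞ (horizontal γ q ν ∘ h) (extChartAt (𝓡 2) (G v) (G v)) :=
      hsm.contDiffAt.comp _ (hh.contDiffAt (hfr.isOpen.mem_nhds hyU))
    refine (h1.contMDiffAt.comp (G v) contMDiffAt_extChartAt).congr_of_eventuallyEq ?_
    filter_upwards [extChartAt_source_mem_nhds (I := 𝓡 2) (G v),
      (continuousAt_extChartAt (I := 𝓡 2) (G v)).eventually (hfr.isOpen.mem_nhds hyU)] with z hz hz'
    have : z = G (h (extChartAt (𝓡 2) (G v) z)) := by
      rw [hGh _ hz', PartialEquiv.left_inv _ hz]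
    rw [Function.comp_apply, Function.comp_apply, ← hN (h _), ← this]
  · exact (hq.orthonormal_frame hγ hν hσ _).1 3
  · set w := Function.surjInv hG.surjective x with hw
    have : (inner ℝ (horizontal γ q ν w) (hopfTorus q w) : ℝ) = 0 :=
      (hq.orthonormal_frame hγ hν hσ w).2 (i := 3) (j := 0) (by decide)
    rwa [← hG.apply, hw, Function.surjInv_eq hG.surjective x] at this
  · obtain ⟨v, rfl⟩ := hG.surjective x
    obtain ⟨α, β, -, hd, -⟩ := hG.exists_dual hq hγ hν hσ hsign hF v
    have ho := (hq.orthonormal_frame hγ hν hσ v).2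
    have h1 : (inner ℝ (horizontal γ q ν v) (horizontal γ q (arcDeriv γ γ) v) : ℝ) = 0 :=
      ho (i := 3) (j := 1) (by decide)
    have h2 : (inner ℝ (horizontal γ q ν v) (σ • (qi * hopfTorus q v)) : ℝ) = 0 :=
      ho (i := 3) (j := 2) (by decide)
    rw [hN, hd, inner_add_right, real_inner_smul_right, real_inner_smul_right, h1, h2]
    ring

end IsTorusParam

/-! ### Horizontal lifts and the horizontal-vertical frame. -/

namespace IsTorusParam

variable {M : Type} [TopologicalSpace M] [ChartedSpace Plane M] [IsManifold (𝓡 2) ∞ M]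
  {F : M → ℍ[ℝ]} {γ q : ℝ → ℍ[ℝ]} {L : ℝ} {G : ℝ × ℝ → M} (hG : IsTorusParam F q G)
  (hq : IsClosedLift γ q L) (hγ : IsSimpleClosedCurve γ L)

include hG hq hγ

omit [IsManifold (𝓡 2) ∞ M] in
/-- The kernel of the differential of `π ∘ F` is vertical. -/
lemma inner_horizontal_of_dHopf_eq_zero (v : ℝ × ℝ)
    {w : TangentSpace (𝓡 2) (G v)} (hw : dHopf (F (G v)) (dF F (G v) w) = 0) :
    (inner ℝ (dF F (G v) w) (horizontal γ q (arcDeriv γ γ) v) : ℝ) = 0 := by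
  have h := inner_dHopf (hG.norm_apply hq (G v)) (dF F (G v) w) (hγ.imI_tangent v.1)
  rw [hw, inner_zero_left, hG.apply, hq.transport_mul_eq] at h
  linarith

omit [IsManifold (𝓡 2) ∞ M] in
/-- The velocity of a horizontal lift. -/
lemma deriv_horizontalLift (hF : IsSphereImmersion F) {a b : ℝ} {η : ℝ → M}
    (hη : IsHorizontalLift F γ a b η) {s t : ℝ} (hs : s ∈ Set.Ioo a b) (ht : G (s, t) = η s) :
    deriv (fun t => F (η t)) s = (‖deriv γ s‖ / 2) • horizontal γ q (arcDeriv γ γ) (s, t) := by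
  have hν := hγ.isUnitNormalAlongCurve
  obtain ⟨σ, hσ, hsign⟩ := hγ.exists_sign hν
  have hη' : ContMDiffAt 𝓘(ℝ, ℝ) (𝓡 2) ∞ η s :=
    hη.smooth.contMDiffAt (Ioo_mem_nhds hs.1 hs.2)
  have hd : HasDerivAt (fun t => F (η t)) (deriv (fun t => F (η t)) s) s :=
    (((hF.smooth.contMDiffAt.comp s hη').contDiffAt).differentiableAt (by simp)).hasDerivAt
  set w := deriv (fun t => F (η t)) s with hw
  have hFη : F (η s) = hopfTorus q (s, t) := by rw [← ht, hG.apply]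
  have h1 : dHopf (F (η s)) w = ‖deriv γ s‖ • arcDeriv γ γ s := by
    rw [← hγ.deriv_eq_smul_arcDeriv, dHopf, (hasFDerivAt_hopf _).fderiv]
    refine ((hasFDerivAt_hopf (F (η s))).comp_hasDerivAt s hd).unique ?_
    refine (hγ.hasDerivAt s).congr_of_eventuallyEq ?_
    filter_upwards [Ioo_mem_nhds hs.1 hs.2] with t ht using hη.lift t ht
  have h2 : (inner ℝ w (F (η s)) : ℝ) = 0 := by
    have := (hd.inner ℝ hd).unique
      ((hasDerivAt_const s (1 : ℝ)).congr_of_eventuallyEq (Filter.Eventually.of_forall fun t => by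
        change (inner ℝ (F (η t)) (F (η t)) : ℝ) = 1
        rw [real_inner_self_eq_norm_sq, hF.norm_eq_one, one_pow]))
    rw [real_inner_comm] at this
    linarith
  -- The tangent vector dual to (0, σ) is mapped by dF to iF, which the Hopf differential kills, so
  -- horizontality can be tested on it.
  have h3 : (inner ℝ w (qi * F (η s)) : ℝ) = 0 := by
    obtain ⟨α, β, hdual, hdF, -⟩ := hG.exists_dual hq hγ hν hσ hsign hF (s, t)
    obtain ⟨e, he1, he2⟩ := hdual 0 σ
    have hσσ : σ * σ = 1 := by rcases hσ with rfl | rfl <;> norm_num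
    have he := hdF e
    rw [he1, he2, zero_smul, zero_add, smul_smul, hσσ, one_smul] at he
    have hh := hη.horizontal s hs
    rw [← ht] at hh
    have := hh e (by
      rw [he, ← hG.apply]; exact dHopf_qi_mul (hF.norm_eq_one _))
    rw [he, ← hFη] at this
    rwa [real_inner_comm]
  have := hγ.eq_of_dHopf_eq hν (hF.norm_eq_one (η s)) (hη.lift s hs) h2 h1
  rw [h3, zero_smul, add_zero, hFη, hq.transport_mul_eq (arcDeriv γ γ) (s, t)] at this
  exact this

/-- Existence of horizontal lifts. -/
lemma exists_horizontalLift {s₀ : ℝ} {x₀ : M}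
    (h : hopf (F x₀) = γ s₀) (a b : ℝ) :
    ∃ η : ℝ → M, IsHorizontalLift F γ a b η ∧ η s₀ = x₀ := by
  obtain ⟨t₀, ht₀⟩ := hG.exists_eq hq h
  have hω : ContDiff ℝ ∞ (fibreSpeed q) :=
    ((contDiff_infty_iff_deriv.1 hq.contDiff).2).inner ℝ (contDiff_const.mul hq.contDiff)
  -- The vertical component of the velocity of (s, τ(s)) is `fibreSpeed q s` + τ', so τ has to be a
  -- primitive of minus the fibre speed. It exists on the whole line, and the lift does not depend
  -- on the interval.
  set τ : ℝ → ℝ := fun s => t₀ - ∫ u in s₀..s, fibreSpeed q u with hτ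
  have hτ' (s : ℝ) : HasDerivAt τ (-fibreSpeed q s) s :=
    (hω.continuous.integral_hasStrictDerivAt s₀ s).hasDerivAt.const_sub t₀
  have hτs : ContDiff ℝ ∞ τ := by
    rw [contDiff_infty_iff_deriv]
    refine ⟨fun s => (hτ' s).differentiableAt, ?_⟩
    rw [funext fun s => (hτ' s).deriv]
    exact hω.neg
  refine ⟨fun s => G (s, τ s), ⟨?_, fun s _ => hG.hopf_apply hq (s, τ s), fun s _ w hw => ?_⟩, ?_⟩
  · exact (hG.contMDiff.comp (contDiff_id.prodMk hτs).contMDiff).contMDiffOn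
  · have hd : HasDerivAt (fun s => F (G (s, τ s)))
        ((‖deriv γ s‖ / 2) • horizontal γ q (arcDeriv γ γ) (s, τ s)) s := by
      have h1 : HasDerivAt (fun s => (s, τ s)) ((1 : ℝ), -fibreSpeed q s) s :=
        (hasDerivAt_id s).prodMk (hτ' s)
      have h2 := (hq.hasFDerivAt_hopfTorus hγ (s, τ s)).comp_hasDerivAt s h1
      simp only [add_apply, ContinuousLinearMap.smulRight_apply, horizontalForm_apply,
        verticalForm_apply, mul_one, add_neg_cancel, zero_smul, add_zero] at h2
      exact h2.congr_of_eventuallyEq (Filter.Eventually.of_forall fun t => hG.apply _)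
    rw [hd.deriv, real_inner_smul_right,
      hG.inner_horizontal_of_dHopf_eq_zero hq hγ (s, τ s) hw, mul_zero]
  · simp [hτ, ht₀]

omit [IsManifold (𝓡 2) ∞ M] in
/-- The second fundamental form of an immersed Hopf torus in the orthonormal frame that consists of
a horizontal and a vertical vector. -/
lemma exists_frame (hF : IsSphereImmersion F) {ν : ℝ → ℍ[ℝ]} (hν : IsUnitNormalAlongCurve γ ν)
    {σ : ℝ} (hσ : σ = 1 ∨ σ = -1) (hsign : ∀ s, σ • (qi * star (γ s) * arcDeriv γ γ s) = ν s)
    (v : ℝ × ℝ) : ∃ e : Fin 2 → TangentSpace (𝓡 2) (G v),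
      dF F (G v) (e 0) = horizontal γ q (arcDeriv γ γ) v ∧
      dF F (G v) (e 1) = σ • (qi * F (G v)) ∧
      (∀ i j, inner ℝ (dF F (G v) (e i)) (dF F (G v) (e j)) =
        (1 : Matrix (Fin 2) (Fin 2) ℝ) i j) ∧
      (∀ i j, secondFF F (G v) (e i) (e j) =
        (!![2 * signedCurvature γ ν v.1, 1; 1, 0] : Matrix (Fin 2) (Fin 2) ℝ) i j
          • horizontal γ q ν v) ∧
      (∀ i j, tracefreeFF F (G v) (e i) (e j) =
        (!![signedCurvature γ ν v.1, 1; 1, -signedCurvature γ ν v.1] :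
          Matrix (Fin 2) (Fin 2) ℝ) i j • horizontal γ q ν v) := by
  obtain ⟨α, β, hdual, hdF, hA, hA0⟩ := hG.exists_dual hq hγ hν hσ hsign hF v
  obtain ⟨e0, h00, h01⟩ : ∃ e : TangentSpace (𝓡 2) (G v), α e = 1 ∧ β e = 0 := hdual 1 0
  obtain ⟨e1, h10, h11⟩ : ∃ e : TangentSpace (𝓡 2) (G v), α e = 0 ∧ β e = 1 := hdual 0 1
  have ho := hq.orthonormal_frame hγ hν hσ v
  have n1 : ‖horizontal γ q (arcDeriv γ γ) v‖ = 1 := ho.1 1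
  have n2 : ‖σ • (qi * hopfTorus q v)‖ = 1 := ho.1 2
  have n12 : (inner ℝ (horizontal γ q (arcDeriv γ γ) v) (σ • (qi * hopfTorus q v)) : ℝ) = 0 :=
    ho.2 (i := 1) (j := 2) (by decide)
  have d0 : dF F (G v) e0 = horizontal γ q (arcDeriv γ γ) v := by
    rw [hdF, h00, h01, one_smul, zero_smul, add_zero]
  have d1 : dF F (G v) e1 = σ • (qi * hopfTorus q v) := by
    rw [hdF, h10, h11, one_smul, zero_smul, zero_add]
  refine ⟨![e0, e1], d0, by rw [hG.apply]; exact d1, ?_, ?_, ?_⟩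
  · have n21 := n12
    rw [real_inner_comm] at n21
    simp only [Fin.forall_fin_two, Matrix.cons_val_zero, Matrix.cons_val_one, d0, d1,
      real_inner_self_eq_norm_sq, n1, n2, n12, n21]
    simp
  · simp [Fin.forall_fin_two, hA, h00, h01, h10, h11]
  · simp [Fin.forall_fin_two, hA0, h00, h01, h10, h11]

end IsTorusParam

/-! ### The area measure and integration along the fibres. -/

open MeasureTheory

/-- The pair of coordinates of a point of the plane. -/
def toPair : Plane →L[ℝ] ℝ × ℝ := (EuclideanSpace.proj 0).prod (EuclideanSpace.proj 1)

@[simp] lemma toPair_apply (z : Plane) : toPair z = (z 0, z 1) := rfl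

lemma injective_toPair : Function.Injective toPair := fun z w h => by
  rw [toPair_apply, toPair_apply, Prod.mk.injEq] at h
  ext i
  fin_cases i
  exacts [h.1, h.2]

lemma measurePreserving_toPair : MeasurePreserving toPair :=
  (volume_preserving_finTwoArrow ℝ).comp
    (EuclideanSpace.volume_preserving_symm_measurableEquiv_toLp (Fin 2))

namespace Loc

lemma g_comp {f : Plane → ℍ[ℝ]} {k : Plane → Plane} {z : Plane} {k' : Plane →L[ℝ] Plane}
    (hf : DifferentiableAt ℝ f (k z)) (hk : HasFDerivAt k k' z) :
    g (f ∘ k) z = (LinearMap.toMatrix (EuclideanSpace.basisFun (Fin 2) ℝ).toBasis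
        (EuclideanSpace.basisFun (Fin 2) ℝ).toBasis k'.toLinearMap).transpose * g f (k z) *
      LinearMap.toMatrix (EuclideanSpace.basisFun (Fin 2) ℝ).toBasis
        (EuclideanSpace.basisFun (Fin 2) ℝ).toBasis k'.toLinearMap := by
  have hp (i : Fin 2) : pderiv i (f ∘ k) z = ∑ j, k' (coordVec i) j • pderiv j f (k z) := by
    rw [pderiv, (hf.hasFDerivAt.comp z hk).fderiv, ContinuousLinearMap.comp_apply]
    conv_lhs => rw [sum_coordVec (k' (coordVec i)), map_sum]
    simp only [map_smul, pderiv]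
  ext i j
  simp only [g, hp, Matrix.mul_apply, Matrix.transpose_apply, LinearMap.toMatrix_apply,
    OrthonormalBasis.coe_toBasis, EuclideanSpace.basisFun_apply, Fin.sum_univ_two, inner_add_left,
    inner_add_right, real_inner_smul_left, real_inner_smul_right,
    OrthonormalBasis.coe_toBasis_repr_apply, EuclideanSpace.basisFun_repr,
    ContinuousLinearMap.coe_coe, ← coordVec.eq_1]
  ring

lemma det_g_comp {f : Plane → ℍ[ℝ]} {k : Plane → Plane} {z : Plane} {k' : Plane →L[ℝ] Plane}
    (hf : DifferentiableAt ℝ f (k z)) (hk : HasFDerivAt k k' z) :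
    (g (f ∘ k) z).det = k'.det ^ 2 * (g f (k z)).det := by
  rw [g_comp hf hk, Matrix.det_mul, Matrix.det_mul, Matrix.det_transpose,
    LinearMap.det_toMatrix, ContinuousLinearMap.det]
  ring

end Loc

namespace IsClosedLift

variable {γ q : ℝ → ℍ[ℝ]} {L : ℝ}

/-- The area form α∧β is ±½|γ'| ds∧dt: the fibre speed is a shear and does not enter the
determinant. -/
lemma det_g_hopfTorus (hq : IsClosedLift γ q L) (hγ : IsSimpleClosedCurve γ L) (z : Plane) :
    (Loc.g (hopfTorus q ∘ toPair) z).det = (‖deriv γ (z 0)‖ / 2) ^ 2 := by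
  obtain ⟨σ, hσ, hsign⟩ := hγ.exists_sign hγ.isUnitNormalAlongCurve
  have h := hq.hopfFrame hγ hγ.isUnitNormalAlongCurve hσ hsign isOpen_univ
    toPair.contDiff.contDiffOn fun y _ => by rw [toPair.fderiv]; exact injective_toPair
  rw [h.det_g (Set.mem_univ z)]
  simp only [toPair.fderiv, ContinuousLinearMap.comp_apply, smul_apply, horizontalForm_apply,
    verticalForm_apply, toPair_apply]
  rcases hσ with rfl | rfl <;> simp [coordVec]

end IsClosedLift

/-- The fundamental domain of the parametrization of the Hopf torus. -/
def fundDomain (L : ℝ) : Set Plane := toPair ⁻¹' (Set.Ico 0 L ×ˢ Set.Ico 0 (2 * Real.pi))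

lemma measurableSet_fundDomain (L : ℝ) : MeasurableSet (fundDomain L) :=
  (measurableSet_Ico.prod measurableSet_Ico).preimage toPair.continuous.measurable

/-- The area measure of the Hopf torus, in terms of its parameters. -/
def paramMeasure (γ : ℝ → ℍ[ℝ]) (L : ℝ) : Measure Plane :=
  (volume.restrict (fundDomain L)).withDensity fun z => ENNReal.ofReal (‖deriv γ (z 0)‖ / 2)

lemma eq_of_mem_Ico_of_eq_add_int_mul {a b c : ℝ} (ha : a ∈ Set.Ico 0 c) (hb : b ∈ Set.Ico 0 c)
    {n : ℤ} (h : b = a + n * c) : a = b := by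
  have hc : 0 < c := ha.1.trans_lt ha.2
  have h1 : (n : ℝ) * c < 1 * c := by linarith [ha.1, hb.2]
  have h2 : (-1 : ℝ) * c < n * c := by linarith [ha.2, hb.1]
  have h1' : n < 1 := by exact_mod_cast lt_of_mul_lt_mul_right h1 hc.le
  have h2' : -1 < n := by exact_mod_cast lt_of_mul_lt_mul_right h2 hc.le
  obtain rfl : n = 0 := by omega
  simpa using h.symm

lemma exists_add_int_mul_mem_Ico {c : ℝ} (hc : 0 < c) (a : ℝ) :
    ∃ n : ℤ, a + n * c ∈ Set.Ico 0 c := by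
  refine ⟨-toIcoDiv hc 0 a, ?_⟩
  have := toIcoMod_mem_Ico hc 0 a
  rw [toIcoMod, zero_add, zsmul_eq_mul] at this
  push_cast
  rwa [neg_mul, ← sub_eq_add_neg]

namespace IsTorusParam

variable {M : Type} [TopologicalSpace M] [ChartedSpace Plane M]
  {F : M → ℍ[ℝ]} {γ q : ℝ → ℍ[ℝ]} {L : ℝ} {G : ℝ × ℝ → M} (hG : IsTorusParam F q G)
  (hq : IsClosedLift γ q L) (hγ : IsSimpleClosedCurve γ L)

include hG hq hγ

lemma injOn_fundDomain : Set.InjOn (G ∘ toPair) (fundDomain L) := by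
  intro z hz w hw h
  obtain ⟨m, n, hmn⟩ := (hq.hopfTorus_eq_iff hγ _ _).1 ((hG.apply_eq_iff _ _).1 h)
  refine injective_toPair (Prod.ext ?_ ?_)
  · exact eq_of_mem_Ico_of_eq_add_int_mul hz.1 hw.1 (congrArg Prod.fst hmn)
  · exact eq_of_mem_Ico_of_eq_add_int_mul hz.2 hw.2 (congrArg Prod.snd hmn)

lemma exists_mem_fundDomain (x : M) : ∃ z ∈ fundDomain L, G (toPair z) = x := by
  obtain ⟨v, rfl⟩ := hG.surjective x
  obtain ⟨m, hm⟩ := exists_add_int_mul_mem_Ico hγ.pos v.1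
  obtain ⟨n, hn⟩ := exists_add_int_mul_mem_Ico Real.two_pi_pos v.2
  refine ⟨!₂[v.1 + m * L, v.2 + n * (2 * Real.pi)], ⟨by simpa using hm, by simpa using hn⟩, ?_⟩
  rw [hG.apply_eq_iff, eq_comm, hq.hopfTorus_eq_iff hγ]
  exact ⟨m, n, by simp⟩

variable [IsManifold (𝓡 2) ∞ M] [MeasurableSpace M] [BorelSpace M]

/-- The area measure in a chart is the image of the area measure in terms of the parameters of the
Hopf torus. -/
lemma map_chart_eq (hF : IsSphereImmersion F) (x : M) :
    Measure.map (extChartAt (𝓡 2) x).symm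
      ((volume.restrict (extChartAt (𝓡 2) x).target).withDensity
        (fun y => ENNReal.ofReal (Real.sqrt (Loc.g (inChart F x) y).det))) =
    (Measure.map (G ∘ toPair) (paramMeasure γ L)).restrict (extChartAt (𝓡 2) x).source := by
  set c := extChartAt (𝓡 2) x with hc
  have hGc : Continuous (G ∘ toPair) := hG.contMDiff.continuous.comp toPair.continuous
  have htm : MeasurableSet c.target := (isOpen_extChartAt_target x).measurableSet
  have hsm : MeasurableSet c.source := (isOpen_extChartAt_source x).measurableSet
  have hae : AEMeasurable c.symm ((volume.restrict c.target).withDensity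
      (fun y => ENNReal.ofReal (Real.sqrt (Loc.g (inChart F x) y).det))) :=
    ((continuousOn_extChartAt_symm x).aemeasurable htm).mono_ac (withDensity_absolutelyContinuous _ _)
  ext A hA
  -- Here `κ` is the change from the parameters (s, t) to the chart, and `s` is the part of the
  -- fundamental domain lying over `A` and the chart domain. On it `κ` is injective, so the change
  -- of variables formula applies.
  set κ : Plane → Plane := fun z => c (G (toPair z)) with hκ
  set s : Set Plane := fundDomain L ∩ (G ∘ toPair) ⁻¹' (A ∩ c.source) with hs
  have hsmeas : MeasurableSet s :=
    (measurableSet_fundDomain L).inter (hGc.measurable (hA.inter hsm))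
  have hκd (z : Plane) (hz : z ∈ s) : HasFDerivAt κ (fderiv ℝ κ z) z := by
    have h1 : ContMDiffAt 𝓘(ℝ, Plane) 𝓘(ℝ, Plane) ∞ κ z :=
      (contMDiffAt_extChartAt' (by simpa [hc, mfld_simps] using hz.2.2)).comp z
        ((hG.contMDiff.comp toPair.contDiff.contMDiff).contMDiffAt)
    exact (h1.contDiffAt.differentiableAt (by simp)).hasFDerivAt
  have himage : c.symm ⁻¹' A ∩ c.target = κ '' s := by
    ext y
    constructor
    · rintro ⟨hyA, hyt⟩
      obtain ⟨z, hz, hzy⟩ := hG.exists_mem_fundDomain hq hγ (c.symm y)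
      refine ⟨z, ⟨hz, ?_⟩, ?_⟩
      · rw [Set.mem_preimage, Function.comp_apply, hzy]
        exact ⟨hyA, c.map_target hyt⟩
      · simp only [hκ, hzy, c.right_inv hyt]
    · rintro ⟨z, hz, rfl⟩
      refine ⟨?_, c.map_source hz.2.2⟩
      change c.symm (c ((G ∘ toPair) z)) ∈ A
      rw [c.left_inv hz.2.2]
      exact hz.2.1
  have hinj : Set.InjOn κ s := fun z hz w hw h =>
    hG.injOn_fundDomain hq hγ hz.1 hw.1 (c.injOn hz.2.2 hw.2.2 h)
  -- `F` in the chart composed with `κ` is the standard parametrization, so the area densities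
  -- differ by |det Dκ|.
  have hdens (z : Plane) (hz : z ∈ s) :
      ENNReal.ofReal |(fderiv ℝ κ z).det| *
        ENNReal.ofReal (Real.sqrt (Loc.g (inChart F x) (κ z)).det) =
      ENNReal.ofReal (‖deriv γ (z 0)‖ / 2) := by
    have hκt : κ z ∈ c.target := c.map_source hz.2.2
    have h1 := Loc.det_g_comp
      ((contDiffAt_inChart hF.smooth x hκt).differentiableAt (by simp)) (hκd z hz)
    have h2 : Loc.g (inChart F x ∘ κ) z = Loc.g (hopfTorus q ∘ toPair) z := by
      have : inChart F x ∘ κ =ᶠ[nhds z] hopfTorus q ∘ toPair := by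
        filter_upwards [hGc.continuousAt.eventually
          ((isOpen_extChartAt_source x).mem_nhds hz.2.2)] with w hw
        rw [Function.comp_apply, inChart, Function.comp_apply, Function.comp_apply, ← hG.apply]
        exact congrArg F (c.left_inv hw)
      ext i j
      simp only [Loc.g, pderiv, this.fderiv_eq]
    rw [h2, hq.det_g_hopfTorus hγ] at h1
    have hr := hγ.speed_pos (z 0)
    rw [← ENNReal.ofReal_mul (abs_nonneg _), ← Real.sqrt_sq_eq_abs,
      ← Real.sqrt_mul (sq_nonneg _), ← h1, Real.sqrt_sq (by positivity)]
  rw [Measure.map_apply_of_aemeasurable hae hA, withDensity_apply', Measure.restrict_restrict' htm,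
    himage, lintegral_image_eq_lintegral_abs_det_fderiv_mul volume hsmeas
      (fun z hz => (hκd z hz).hasFDerivWithinAt) hinj, setLIntegral_congr_fun hsmeas hdens,
    Measure.restrict_apply hA, Measure.map_apply hGc.measurable (hA.inter hsm), paramMeasure,
    withDensity_apply', Measure.restrict_restrict (hGc.measurable (hA.inter hsm)), Set.inter_comm]

/-- The area measure of an immersed Hopf torus. -/
lemma areaMeasure_eq [CompactSpace M] (hF : IsSphereImmersion F) :
    areaMeasure F = Measure.map (G ∘ toPair) (paramMeasure γ L) := by
  set m := Measure.map (G ∘ toPair) (paramMeasure γ L) with hm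
  -- The area measure is a supremum of restrictions of `m` to chart domains. Compactness gives a
  -- finite cover, and measures that agree on its members are equal.
  have harea : areaMeasure F = ⨆ x : M, m.restrict (extChartAt (𝓡 2) x).source := by
    simp only [areaMeasure, hG.map_chart_eq hq hγ hF, ← hm]
  have hle : areaMeasure F ≤ m := by
    rw [harea]
    exact iSup_le fun x => Measure.restrict_le_self
  obtain ⟨t, ht⟩ := CompactSpace.elim_nhds_subcover (fun x : M => (extChartAt (𝓡 2) x).source)
    fun x => extChartAt_source_mem_nhds x
  have hU : ⋃ x : t, (extChartAt (𝓡 2) (x : M)).source = Set.univ := by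
    refine Set.eq_univ_of_forall fun z => ?_
    have hz : z ∈ ⋃ x ∈ t, (extChartAt (𝓡 2) x).source := ht ▸ Set.mem_univ z
    obtain ⟨x, hx, hzx⟩ := Set.mem_iUnion₂.1 hz
    exact Set.mem_iUnion.2 ⟨⟨x, hx⟩, hzx⟩
  rw [Measure.ext_iff_of_iUnion_eq_univ hU]
  intro x
  refine le_antisymm (Measure.restrict_mono le_rfl hle) ?_
  have h1 : m.restrict (extChartAt (𝓡 2) (x : M)).source ≤ areaMeasure F := by
    rw [harea]
    exact le_iSup (fun x : M => m.restrict (extChartAt (𝓡 2) x).source) (x : M)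
  have h2 := Measure.restrict_mono (le_refl (extChartAt (𝓡 2) (x : M)).source) h1
  rwa [Measure.restrict_restrict (isOpen_extChartAt_source _).measurableSet, Set.inter_self] at h2

omit [IsManifold (𝓡 2) ∞ M] in
/-- Integration over an immersed Hopf torus of a function that is constant along the fibres. -/
lemma integral_eq [IsManifold (𝓡 2) ∞ M] [CompactSpace M] (hF : IsSphereImmersion F) {φ : M → ℝ}
    {c : ℝ → ℝ} (hc : Continuous c) (hφ : ∀ v, φ (G v) = c v.1) :
    ∫ x, φ x ∂(areaMeasure F) = Real.pi * ∫ s in (0 : ℝ)..L, c s * ‖deriv γ s‖ := by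
  have hr : Continuous fun s => ‖deriv γ s‖ := hγ.contDiff_speed.continuous
  have hGc : Continuous (G ∘ toPair) := hG.contMDiff.continuous.comp toPair.continuous
  have hφc : Continuous φ := by
    rw [(hG.isCoveringMap.isQuotientMap hG.surjective).continuous_iff]
    exact (hc.comp continuous_fst).congr fun v => (hφ v).symm
  have hpre : ∫ z in fundDomain L, (c (z 0) * (‖deriv γ (z 0)‖ / 2)) =
      ∫ v in Set.Ico 0 L ×ˢ Set.Ico 0 (2 * Real.pi), (c v.1 * (‖deriv γ v.1‖ / 2)) :=
    measurePreserving_toPair.setIntegral_preimage_emb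
      (toPair.continuous.measurableEmbedding injective_toPair)
      (fun v => c v.1 * (‖deriv γ v.1‖ / 2)) _
  rw [hG.areaMeasure_eq hq hγ hF, integral_map hGc.measurable.aemeasurable
    hφc.aestronglyMeasurable, paramMeasure,
    integral_withDensity_eq_integral_toReal_smul (by
      have : Continuous fun z : Plane => ‖deriv γ (z 0)‖ / 2 :=
        (hr.comp (by fun_prop : Continuous fun z : Plane => z 0)).div_const 2
      exact this.measurable.ennreal_ofReal) (by simp)]
  have h1 (z : Plane) : (ENNReal.ofReal (‖deriv γ (z 0)‖ / 2)).toReal • φ ((G ∘ toPair) z) =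
      c (z 0) * (‖deriv γ (z 0)‖ / 2) := by
    rw [ENNReal.toReal_ofReal (by positivity), Function.comp_apply, hφ, smul_eq_mul, mul_comm]
    rfl
  simp only [h1]
  rw [hpre]
  have h2 := setIntegral_prod_mul (μ := (volume : Measure ℝ)) (ν := (volume : Measure ℝ))
    (fun s => c s * (‖deriv γ s‖ / 2)) (fun _ : ℝ => (1 : ℝ)) (Set.Ico 0 L)
    (Set.Ico 0 (2 * Real.pi))
  simp only [mul_one] at h2
  rw [Measure.volume_eq_prod, h2, intervalIntegral.integral_of_le hγ.pos.le,
    ← integral_Ico_eq_integral_Ioc]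
  have h3 : ∫ s in Set.Ico 0 L, c s * (‖deriv γ s‖ / 2) =
      (∫ s in Set.Ico 0 L, c s * ‖deriv γ s‖) / 2 := by
    rw [← integral_div]
    simp only [mul_div_assoc]
  rw [h3]
  -- The fibre has parameter length 2π and the density contributes ½, which leaves π.
  simp [Real.pi_pos.le]
  ring

end IsTorusParam

end HopfWillmore

end

/-! ### The Hopf–Willmore identity. -/

open HopfWillmore in
theorem proposition3p2
    (M : Type) [TopologicalSpace M] [ChartedSpace Plane M] [IsManifold (𝓡 2) ∞ M]
    [MeasurableSpace M] [BorelSpace M]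
    (γ : ℝ → ℍ[ℝ]) (L : ℝ) (hγ : IsSimpleClosedCurve γ L)
    (F : M → ℍ[ℝ]) (hF : IsSphereImmersion F)
    (hsimple : MapsSimplyOnto F (hopfPreimage (Set.range γ))) :
    (∃ ε : ℝ, 0 < ε ∧ 2 * ε ≤ L ∧
      -- existence of horizontal lifts through all points over `γ s₀`
      (∀ (s₀ : ℝ) (x₀ : M), hopf (F x₀) = γ s₀ →
        ∃ η : ℝ → M, IsHorizontalLift F γ (s₀ - ε) (s₀ + ε) η ∧ η s₀ = x₀) ∧
      ∀ ν : ℝ → ℍ[ℝ], IsUnitNormalAlongCurve γ ν →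
        -- the curvature vector in terms of the unit normal field
        (∀ s : ℝ, curvatureVector γ s =
          -((‖deriv γ s‖ ^ 2)⁻¹ • ((star (deriv γ s) * deriv ν s) * ν s))) ∧
        -- the unit normal field along `F` and the orientation `σ` of the fibres fixed by `ν`
        ∃ (N : M → ℍ[ℝ]) (σ : ℝ), IsUnitNormalAlongSurface F N ∧ (σ = 1 ∨ σ = -1) ∧
          (∀ (x : M) (s : ℝ), hopf (F x) = γ s → dHopf (F x) (N x) = (2 : ℝ) • ν s) ∧
          ∀ (s₀ : ℝ) (η : ℝ → M), IsHorizontalLift F γ (s₀ - ε) (s₀ + ε) η →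
            ∀ s ∈ Set.Ioo (s₀ - ε) (s₀ + ε),
              -- `e 0` is the unit tangent of the lift, `e 1` the unit tangent of the fibre
              (∃ e : Fin 2 → TangentSpace (𝓡 2) (η s),
                deriv (fun t => F (η t)) s ≠ 0 ∧
                dF F (η s) (e 0) = ‖deriv (fun t => F (η t)) s‖⁻¹ • deriv (fun t => F (η t)) s ∧
                dF F (η s) (e 1) = σ • (qi * F (η s)) ∧
                (∀ i j, inner ℝ (dF F (η s) (e i)) (dF F (η s) (e j)) =
                  (1 : Matrix (Fin 2) (Fin 2) ℝ) i j) ∧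
                (∀ i j, secondFF F (η s) (e i) (e j) =
                  (!![2 * signedCurvature γ ν s, 1; 1, 0] : Matrix (Fin 2) (Fin 2) ℝ) i j
                    • N (η s)) ∧
                (∀ i j, tracefreeFF F (η s) (e i) (e j) =
                  (!![signedCurvature γ ν s, 1; 1, -signedCurvature γ ν s] :
                    Matrix (Fin 2) (Fin 2) ℝ) i j • N (η s))) ∧
              meanCurv F (η s) = (2 * signedCurvature γ ν s) • N (η s) ∧
              tracefreeFFNormSq F (η s) = 2 * (signedCurvature γ ν s ^ 2 + 1) ∧
              Q F (η s) (meanCurv F (η s)) =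
                (4 * (signedCurvature γ ν s ^ 3 + signedCurvature γ ν s)) • N (η s) ∧
              normalLaplacian F (meanCurv F) (η s) =
                (8 * (arcDeriv γ)^[2] (signedCurvature γ ν) s) • N (η s) ∧
              (∀ k : ℕ, 1 ≤ k → secondFFDerivNormSq k F (η s) =
                2 ^ (2 + 2 * k) * |(arcDeriv γ)^[k] (signedCurvature γ ν) s| ^ 2) ∧
              willmoreGradient F (η s) =
                (2 * (2 * (arcDeriv γ)^[2] (signedCurvature γ ν) s
                  + signedCurvature γ ν s ^ 3 + signedCurvature γ ν s)) • N (η s) ∧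
              dHopf (F (η s)) (willmoreGradient F (η s)) = (4 : ℝ) • elasticGradient γ s) ∧
    willmoreEnergy F = Real.pi * elasticEnergy γ L ∧
    ∫ x, ‖willmoreGradient F x‖ ^ 2 ∂(areaMeasure F) =
      4 * Real.pi * ∫ s in (0 : ℝ)..L, ‖elasticGradient γ s‖ ^ 2 * ‖deriv γ s‖ := by
  obtain ⟨q, h1, h2, h3, h4⟩ := hγ.exists_closed_lift
  have hq : IsClosedLift γ q L := ⟨h1, h2, h3, h4⟩
  have hM : CompactSpace M := by
    obtain ⟨-, f, -, hf⟩ := hsimple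
    exact hf.source_torus.compactSpace
  obtain ⟨G, hG⟩ := hq.exists_isTorusParam hγ hF hsimple
  -- Horizontal lifts exist over intervals of any length, so ε can be the largest admissible value.
  refine ⟨⟨L / 2, half_pos hγ.pos, by linarith, fun s₀ x₀ h =>
    hG.exists_horizontalLift hq hγ h _ _, fun ν hν => ⟨hγ.curvatureVector_formula hν, ?_⟩⟩, ?_, ?_⟩
  · obtain ⟨σ, hσ, hsign⟩ := hγ.exists_sign hν
    obtain ⟨N, hN, hNG⟩ := hG.exists_isUnitNormalAlongSurface hq hγ hν hσ hsign hF
    refine ⟨N, σ, hN, hσ, fun x s h => ?_, fun s₀ η hη s hs => ?_⟩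
    · obtain ⟨t, rfl⟩ := hG.exists_eq hq h
      rw [hNG]
      exact hG.dHopf_horizontal hq hν (s, t)
    obtain ⟨t, ht⟩ := hG.exists_eq hq (hη.lift s hs)
    have hd := hG.deriv_horizontalLift hq hγ hF hη hs ht
    rw [← ht, hd, hNG]
    refine ⟨?_, hG.meanCurv_eq hq hγ hν hσ hsign _, hG.tracefreeFFNormSq_eq hq hγ hν hσ hsign _,
      hG.Q_meanCurv_eq hq hγ hν hσ hsign _, hG.normalLaplacian_meanCurv_eq hq hγ hν hσ hsign _,
      fun k hk => hG.secondFFDerivNormSq_eq hq hγ hν hσ hsign hk _,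
      hG.willmoreGradient_eq hq hγ hν hσ hsign _, hG.dHopf_willmoreGradient hq hγ hν hσ hsign _⟩
    obtain ⟨e, he0, he1, he, hA, hA0⟩ := hG.exists_frame hq hγ hF hν hσ hsign (s, t)
    have hr := hγ.speed_pos s
    have hE : ‖horizontal γ q (arcDeriv γ γ) (s, t)‖ = 1 :=
      (hq.orthonormal_frame hγ hν hσ (s, t)).1 1
    have hr' : ‖deriv γ s‖ / 2 ≠ 0 := by positivity
    refine ⟨e, smul_ne_zero hr' (norm_ne_zero_iff.1 (by rw [hE]; exact one_ne_zero)), ?_, he1, he,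
      hA, hA0⟩
    rw [he0, norm_smul, hE, mul_one, norm_div, norm_norm, Real.norm_ofNat, smul_smul,
      inv_mul_cancel₀ hr', one_smul]
  -- The two integral identities do not mention a normal field, so the explicit choice iγ̄T serves
  -- to compute both sides.
  all_goals
    have hν := hγ.isUnitNormalAlongCurve
    obtain ⟨σ, hσ, hsign⟩ := hγ.exists_sign hν
    set ν : ℝ → ℍ[ℝ] := fun s => qi * star (γ s) * arcDeriv γ γ s with hνdef
    have hN (v : ℝ × ℝ) : ‖horizontal γ q ν v‖ = 1 := (hq.orthonormal_frame hγ hν hσ v).1 3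
    have hκ := hγ.contDiff_signedCurvature hν
  · refine (hG.integral_eq hq hγ hF (c := fun s => 1 + signedCurvature γ ν s ^ 2)
      (continuous_const.add (hκ.continuous.pow 2)) fun v => ?_).trans ?_
    · rw [hG.meanCurv_eq hq hγ hν hσ hsign, norm_smul, hN, mul_one, Real.norm_eq_abs, sq_abs]
      ring
    · simp only [elasticEnergy, hγ.norm_curvatureVector_sq hν]
  · have hκ2 := hγ.contDiff_iterate_arcDeriv hν 2
    refine (hG.integral_eq hq hγ hF (c := fun s => (2 * (2 * (arcDeriv γ)^[2] (signedCurvature γ ν) s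
      + signedCurvature γ ν s ^ 3 + signedCurvature γ ν s)) ^ 2)
      ((continuous_const.mul (((continuous_const.mul hκ2.continuous).add
        (hκ.continuous.pow 3)).add hκ.continuous)).pow 2) fun v => ?_).trans ?_
    · rw [hG.willmoreGradient_eq hq hγ hν hσ hsign, norm_smul, hN, mul_one, Real.norm_eq_abs, sq_abs]
    · rw [mul_comm (4 : ℝ), mul_assoc, ← intervalIntegral.integral_const_mul (4 : ℝ)]
      congr 2
      funext s
      rw [hγ.elasticGradient_eq hν, norm_smul, hν.norm_eq_one, mul_one, Real.norm_eq_abs, sq_abs]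
      ring
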